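/- Let $N\ge 1$, let $E\subset\mathbb{R}^N$ be open, $T>0$, $E_T:=E\times(0,T)$, $p>1$, $q>0$ and $C_o,C_1>0$. Let $\mathbf A(x,t,v,\xi)\in\mathbb{R}^N$, for $(x,t)\in E_T$, $(v,\xi)\in\mathbb{R}\times\mathbb{R}^N$, be measurable in $(x,t)$ for all $(v,\xi)$, continuous in $(v,\xi)$ for a.e. $(x,t)$, and satisfy, for a.e. $(x,t)\in E_T$ and all $(v,\xi)$, $$\mathbf A(x,t,v,\xi)\cdot\xi\ge C_o|\xi|^p,\qquad |\mathbf A(x,t,v,\xi)|\le C_1|\xi|^{p-1}.$$ Let $u$ be a local weak supersolution of $\partial_t(|u|^{q-1}u)-\operatorname{div}\mathbf A(x,t,u,Du)=0$ in $E_T$; that is, $u\in L^q_{\rm loc}(E_T)\cap L^p_{\rm loc}(0,T;W^{1,p}_{\rm loc}(E))$ and, for every compact $K\subset E$ and every $[t_1,t_2]\subset(0,T)$, $$\int_{t_1}^{t_2}\int_K\left[-|u|^{q-1}u\,\zeta_t+\mathbf A(x,t,u,Du)\cdot D\zeta\right]dx\,dt\ge 0$$ for all non-negative $\zeta\in C^1_o(K\times(t_1,t_2))$.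 Assume that $u$ is locally essentially bounded below in $E_T$, and let $$u_*(x,t):=\operatorname*{ess\,lim\,inf}_{(y,s)\to(x,t)}u(y,s)\in(-\infty,+\infty]$$ be its lower semicontinuous regularization. For $\rho,\theta>0$ let $K_\rho(x)$ be the cube with centre $x$ and side length $2\rho$ (with sides parallel to the axes), and let $$Q'_\rho(\theta;x,t):=K_\rho(x)\times(t-2\theta\rho^p,\,t-\theta\rho^p),\qquad Q^-_\rho(x,t):=K_\rho(x)\times(t-\rho^p,\,t).$$ Then for every $(x,t)\in E_T$ $$u_*(x,t)=\inf_{\theta>0}\liminf_{\rho\to0}\operatorname*{ess\,inf}_{Q'_\rho(\theta;x,t)}u=\inf_{\theta>0}\limsup_{\rho\to0}\operatorname*{ess\,inf}_{Q'_\rho(\theta;x,t)}u .$$ In particular, $u_*(x,t)$ is recovered from past times only: for every $(x,t)\in E_T$ the limit below exists and $$u_*(x,t)=\lim_{\rho\to0}\operatorname*{ess\,inf}_{Q^-_\rho(x,t)}u=\operatorname*{ess\,lim\,inf}_{\substack{(y,s)\to(x,t)\\ s<t}}u(y,s).$$ -/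

import Mathlib

open MeasureTheory Filter Topology Set

noncomputable section

namespace DoublyNonlinear

/-- Space-time `ℝ^N × ℝ`, with points `(x, t)`. -/
abbrev SpaceTime (N : ℕ) : Type := EuclideanSpace ℝ (Fin N) × ℝ

/-- The space-time cylinder `E_T = E × (0, T)`. -/
def spaceTimeCylinder {N : ℕ} (E : Set (EuclideanSpace ℝ (Fin N))) (T : ℝ) : Set (SpaceTime N) :=
  E ×ˢ Ioo 0 T

/-- The open cube `K_ρ(x)` with centre `x` and side length `2ρ`. -/
def cube {N : ℕ} (x : EuclideanSpace ℝ (Fin N)) (ρ : ℝ) : Set (EuclideanSpace ℝ (Fin N)) :=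
  {y | ∀ i, |y i - x i| < ρ}

/-- The centred cylinder `(x,t) + Q_ρ = K_ρ(x) × (t - ρ^p, t + ρ^p)`. -/
def centeredCyl {N : ℕ} (p : ℝ) (z : SpaceTime N) (ρ : ℝ) : Set (SpaceTime N) :=
  cube z.1 ρ ×ˢ Ioo (z.2 - ρ ^ p) (z.2 + ρ ^ p)

/-- The backward cylinder `(x,t) + Q⁻_ρ = K_ρ(x) × (t - ρ^p, t)`. -/
def backwardCyl {N : ℕ} (p : ℝ) (z : SpaceTime N) (ρ : ℝ) : Set (SpaceTime N) :=
  cube z.1 ρ ×ˢ Ioo (z.2 - ρ ^ p) z.2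

/-- The detached backward cylinder
`(x,t) + Q'_ρ(θ) = K_ρ(x) × (t - 2θρ^p, t - θρ^p)`. -/
def pastCyl {N : ℕ} (p θ : ℝ) (z : SpaceTime N) (ρ : ℝ) : Set (SpaceTime N) :=
  cube z.1 ρ ×ˢ Ioo (z.2 - 2 * θ * ρ ^ p) (z.2 - θ * ρ ^ p)

/-- The essential infimum of `u` over `S`, with respect to Lebesgue measure, as an extended real. -/
def essInfOn {N : ℕ} (u : SpaceTime N → ℝ) (S : Set (SpaceTime N)) : EReal :=
  essInf (fun w => (u w : EReal)) (volume.restrict S)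

/-- `ess lim inf` of `u` along the filter `l`: the limit inferior which disregards
Lebesgue null sets, as an extended real. -/
def essLiminf {N : ℕ} (u : SpaceTime N → ℝ) (l : Filter (SpaceTime N)) : EReal :=
  liminf (fun w => (u w : EReal)) (l ⊓ ae volume)

/-- The lower semicontinuous regularization `u_*(z) = ess lim inf_{w → z} u(w)`. -/
def lscReg {N : ℕ} (u : SpaceTime N → ℝ) (z : SpaceTime N) : EReal :=
  essLiminf u (𝓝 z)

theorem isOpen_cube_and_mem {N : ℕ} (x : EuclideanSpace ℝ (Fin N)) {ρ : ℝ} (hρ : 0 < ρ) :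
    IsOpen (cube x ρ) ∧ x ∈ cube x ρ := by
  refine ⟨?_, fun i => by simpa using hρ⟩
  have : cube x ρ = ⋂ i, {y | |y i - x i| < ρ} := by ext y; simp [cube]
  rw [this]
  exact isOpen_iInter_of_finite fun i => isOpen_lt (by fun_prop) continuous_const

/-- The regularization is the limit of the essential infima over the shrinking centred cylinders:
`u_*(z) = lim_{ρ → 0} ess inf_{z + Q_ρ} u`. -/
theorem tendsto_essInfOn_centeredCyl {N : ℕ} {p : ℝ} (hp : 0 < p) (u : SpaceTime N → ℝ)
    (z : SpaceTime N) :
    Tendsto (fun ρ : ℝ => essInfOn u (centeredCyl p z ρ)) (𝓝[>] 0) (𝓝 (lscReg u z)) := by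
  have hopen : ∀ ρ : ℝ, 0 < ρ → IsOpen (centeredCyl p z ρ) ∧ z ∈ centeredCyl p z ρ := by
    intro ρ hρ
    have h := isOpen_cube_and_mem z.1 hρ
    have h' := Real.rpow_pos_of_pos hρ p
    exact ⟨h.1.prod isOpen_Ioo, h.2, by constructor <;> linarith⟩
  rw [tendsto_order]
  constructor
  · intro a ha
    obtain ⟨b, hab, hb⟩ := exists_between ha
    have h1 : ∀ᶠ w in 𝓝 z ⊓ ae volume, b < (u w : EReal) := eventually_lt_of_lt_liminf hb
    obtain ⟨s, hs, t, ht, hst⟩ := eventually_inf.1 h1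
    obtain ⟨ε, hε, hball⟩ := Metric.mem_nhds_iff.1 hs
    have h2 : ∀ᶠ ρ : ℝ in 𝓝[>] 0, centeredCyl p z ρ ⊆ s := by
      have c1 : Tendsto (fun ρ : ℝ => Real.sqrt N * ρ) (𝓝[>] 0) (𝓝 0) := by
        have : Tendsto (fun ρ : ℝ => Real.sqrt N * ρ) (𝓝 0) (𝓝 (Real.sqrt N * 0)) :=
          (by fun_prop : Continuous fun ρ : ℝ => Real.sqrt N * ρ).tendsto 0
        rw [mul_zero] at this
        exact this.mono_left nhdsWithin_le_nhds
      have c2 : Tendsto (fun ρ : ℝ => ρ ^ p) (𝓝[>] 0) (𝓝 0) := by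
        have : Tendsto (fun ρ : ℝ => ρ ^ p) (𝓝 0) (𝓝 ((0 : ℝ) ^ p)) :=
          (Real.continuous_rpow_const hp.le).tendsto 0
        rw [Real.zero_rpow hp.ne'] at this
        exact this.mono_left nhdsWithin_le_nhds
      filter_upwards [c1.eventually (gt_mem_nhds hε), c2.eventually (gt_mem_nhds hε),
        self_mem_nhdsWithin] with ρ h1 h2 h3
      rintro ⟨y, s'⟩ ⟨hy, hs'⟩
      apply hball
      rw [Metric.mem_ball, Prod.dist_eq, max_lt_iff]
      constructor
      · refine lt_of_le_of_lt ?_ h1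
        have h3' : (0 : ℝ) < ρ := h3
        rw [EuclideanSpace.dist_eq]
        calc √(∑ i, dist (y i) (z.1 i) ^ 2) ≤ √(∑ _i : Fin N, ρ ^ 2) := by
              apply Real.sqrt_le_sqrt
              refine Finset.sum_le_sum fun i _ => ?_
              have := hy i
              rw [Real.dist_eq]
              exact pow_le_pow_left₀ (abs_nonneg _) this.le 2
          _ = Real.sqrt N * ρ := by
              simp [Real.sqrt_sq h3'.le]
      · rw [Real.dist_eq, abs_lt]
        have := hs'.1
        have := hs'.2
        constructor <;> simp at * <;> linarith
    filter_upwards [h2, self_mem_nhdsWithin] with ρ hρ hρ0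
    refine lt_of_lt_of_le hab (le_liminf_of_le (by isBoundedDefault) ?_)
    rw [ae_restrict_eq (hopen ρ hρ0).1.measurableSet]
    refine eventually_inf.2 ⟨t, ht, _, mem_principal_self _, ?_⟩
    intro w hw
    exact (hst w ⟨hρ hw.2, hw.1⟩).le
  · intro a ha
    filter_upwards [self_mem_nhdsWithin] with ρ hρ
    refine lt_of_le_of_lt ?_ ha
    refine liminf_le_liminf_of_le ?_ (by isBoundedDefault) (by isBoundedDefault)
    rw [ae_restrict_eq (hopen ρ hρ).1.measurableSet, inf_comm]
    exact inf_le_inf_left _ (le_principal_iff.2 ((hopen ρ hρ).1.mem_nhds (hopen ρ hρ).2))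

/-- The assumptions on the vector field `A(x,t,v,ξ)` on `E_T`: a Carathéodory function with
`A · ξ ≥ C₀ |ξ|^p` and `|A| ≤ C₁ |ξ|^(p-1)`. The values off `E_T` are irrelevant. -/
structure IsAdmissibleField {N : ℕ} (E : Set (EuclideanSpace ℝ (Fin N))) (T p C₀ C₁ : ℝ)
    (A : SpaceTime N → ℝ → EuclideanSpace ℝ (Fin N) → EuclideanSpace ℝ (Fin N)) : Prop where
  /-- Lebesgue measurable in `(x,t)`. -/
  measurable : ∀ v ξ, AEMeasurable (fun z => A z v ξ) (volume.restrict (spaceTimeCylinder E T))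
  continuous : ∀ᵐ z ∂volume.restrict (spaceTimeCylinder E T),
    Continuous fun w : ℝ × EuclideanSpace ℝ (Fin N) => A z w.1 w.2
  coercive : ∀ᵐ z ∂volume.restrict (spaceTimeCylinder E T),
    ∀ v ξ, C₀ * ‖ξ‖ ^ p ≤ inner ℝ (A z v ξ) ξ
  growth : ∀ᵐ z ∂volume.restrict (spaceTimeCylinder E T),
    ∀ v ξ, ‖A z v ξ‖ ≤ C₁ * ‖ξ‖ ^ (p - 1)

/-- `f ∈ L^r_loc(U)`, for `0 < r < ∞` (also for `r < 1`). -/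
def MemLpLocOn {N : ℕ} {F : Type*} [NormedAddCommGroup F] (f : SpaceTime N → F) (r : ℝ)
    (U : Set (SpaceTime N)) : Prop :=
  ∀ K, IsCompact K → K ⊆ U → MemLp f (ENNReal.ofReal r) (volume.restrict K)

/-- `Du` is the weak spatial gradient of `u` in the open set `U` of space-time: for every
`φ ∈ C_c^∞(U)` and every coordinate `i`, `∬ u ∂_{x_i} φ = - ∬ (Du)_i φ`. -/
def IsWeakSpatialGradient {N : ℕ} (u : SpaceTime N → ℝ)
    (Du : SpaceTime N → EuclideanSpace ℝ (Fin N)) (U : Set (SpaceTime N)) : Prop :=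
  ∀ φ : SpaceTime N → ℝ, ContDiff ℝ (⊤ : ℕ∞) φ → HasCompactSupport φ → tsupport φ ⊆ U →
    ∀ i : Fin N,
      ∫ z in U, u z * fderiv ℝ φ z (EuclideanSpace.single i 1, 0) = - ∫ z in U, Du z i * φ z

/-- `u` is a local, weak supersolution of `∂_t(|u|^{q-1}u) - div A(x,t,u,Du) = 0` in `E_T`:
`u ∈ L^q_loc(E_T)`, `u ∈ L^p_loc(0,T; W^{1,p}_loc(E))` (that is, `u` and its weak spatial gradient
`Du`, which is unique up to null sets, are in `L^p_loc(E_T)`), and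
`∬_{K × (t₁,t₂)} [-|u|^{q-1} u ζ_t + A(x,t,u,Du) · Dζ] dx dt ≥ 0` for all compact `K ⊆ E`,
all `[t₁,t₂] ⊆ (0,T)` and all nonnegative `ζ ∈ C¹_o(K × (t₁,t₂))`.
Here `ζ_t = ζ'(0,1)`, and `A · Dζ = ζ'(A,0)`. -/
def IsWeakSupersolution {N : ℕ} (E : Set (EuclideanSpace ℝ (Fin N))) (T p q : ℝ)
    (A : SpaceTime N → ℝ → EuclideanSpace ℝ (Fin N) → EuclideanSpace ℝ (Fin N))
    (u : SpaceTime N → ℝ) : Prop :=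
  MemLpLocOn u q (spaceTimeCylinder E T) ∧
  MemLpLocOn u p (spaceTimeCylinder E T) ∧
  ∃ Du : SpaceTime N → EuclideanSpace ℝ (Fin N),
    IsWeakSpatialGradient u Du (spaceTimeCylinder E T) ∧
    MemLpLocOn Du p (spaceTimeCylinder E T) ∧
    ∀ K : Set (EuclideanSpace ℝ (Fin N)), IsCompact K → K ⊆ E →
    ∀ t₁ t₂ : ℝ, t₁ < t₂ → Icc t₁ t₂ ⊆ Ioo 0 T →
    ∀ ζ : SpaceTime N → ℝ, ContDiff ℝ 1 ζ → HasCompactSupport ζ → tsupport ζ ⊆ K ×ˢ Ioo t₁ t₂ →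
      (∀ z, 0 ≤ ζ z) →
      0 ≤ ∫ z in K ×ˢ Ioo t₁ t₂,
        (-(|u z| ^ (q - 1) * u z) * fderiv ℝ ζ z (0, 1)
          + fderiv ℝ ζ z (A z (u z) (Du z), 0))

/-- `u` is locally, essentially bounded below in `U`. -/
def LocEssBddBelow {N : ℕ} (u : SpaceTime N → ℝ) (U : Set (SpaceTime N)) : Prop :=
  ∀ K, IsCompact K → K ⊆ U → ∃ m : ℝ, ∀ᵐ z ∂volume.restrict K, m ≤ u z

end DoublyNonlinear

end

noncomputable section

namespace DoublyNonlinear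

section Mollification

open scoped Convolution ENNReal

variable {G F : Type*} [NormedAddCommGroup G] [NormedSpace ℝ G] [FiniteDimensional ℝ G]
  [MeasurableSpace G] [BorelSpace G] [NormedAddCommGroup F]
  {μ : Measure G} [μ.IsAddHaarMeasure]

/-- Translations act continuously on `L^p`. -/
theorem tendsto_eLpNorm_translate_sub {p : ℝ≥0∞} (hp1 : 1 ≤ p) (hp : p ≠ ∞) {f : G → F}
    (hf : MemLp f p μ) :
    Tendsto (fun y => eLpNorm (fun z => f (z + y) - f z) p μ) (𝓝 0) (𝓝 0) := by
  have : Fact (1 ≤ p) := ⟨hp1⟩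
  let c : C(G × G, G) := ⟨fun a => a.2 + a.1, by fun_prop⟩
  have hm : ∀ y, MeasurePreserving (c.curry y) μ μ := fun y => measurePreserving_add_right μ y
  have h := Filter.Tendsto.compMeasurePreservingLp (f := fun _ : G => hf.toLp f)
    (tendsto_const_nhds (f := 𝓝 (0 : G)))
    (c.curry.continuous.tendsto 0) hm (hm 0) hp
  rw [Lp.tendsto_Lp_iff_tendsto_eLpNorm'] at h
  refine h.congr fun y => ?_
  refine eLpNorm_congr_ae ?_
  have h1 : ∀ y, Lp.compMeasurePreserving (c.curry y) (hm y) (hf.toLp f) =ᵐ[μ]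
      fun z => f (z + y) := by
    intro y
    refine (Lp.coeFn_compMeasurePreserving _ _).trans ?_
    exact (hm y).quasiMeasurePreserving.ae_eq_comp hf.coeFn_toLp
  filter_upwards [h1 y, h1 0] with z a b
  simp only [Pi.sub_apply, a, b, add_zero]

variable [NormedSpace ℝ F] [CompleteSpace F]

theorem eLpNorm_convolution_sub_le {p : ℝ} (hp : 1 ≤ p) {f : G → F} (hfm : StronglyMeasurable f)
    (hf : MemLp f (ENNReal.ofReal p) μ) (φ : ContDiffBump (0 : G)) {ε : ℝ≥0∞}
    (hε : ∀ y, ‖y‖ ≤ φ.rOut → eLpNorm (fun z => f (z + y) - f z) (ENNReal.ofReal p) μ ≤ ε) :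
    eLpNorm (fun z => (φ.normed μ ⋆[ContinuousLinearMap.lsmul ℝ ℝ, μ] f) z - f z)
      (ENNReal.ofReal p) μ ≤ ε := by
  have hp0 : 0 < p := by linarith
  have hlint : LocallyIntegrable f μ := hf.locallyIntegrable (by simpa using hp)
  set w : G → ℝ≥0∞ := fun y => ENNReal.ofReal (φ.normed μ y) with hw
  have hwm : Measurable w := (φ.continuous_normed).measurable.ennreal_ofReal
  set ν := μ.withDensity w with hν
  have : IsProbabilityMeasure ν := by
    constructor
    rw [hν, withDensity_apply _ MeasurableSet.univ, Measure.restrict_univ,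
      ← ofReal_integral_eq_lintegral_ofReal φ.integrable_normed
        (Eventually.of_forall φ.nonneg_normed), φ.integral_normed, ENNReal.ofReal_one]
  have key : ∀ x, ‖(φ.normed μ ⋆[ContinuousLinearMap.lsmul ℝ ℝ, μ] f) x - f x‖ₑ ^ p ≤
      ∫⁻ y, ‖f (x - y) - f x‖ₑ ^ p ∂ν := by
    intro x
    have hce : ConvolutionExistsAt (φ.normed μ) f x (ContinuousLinearMap.lsmul ℝ ℝ) μ :=
      φ.hasCompactSupport_normed.convolutionExists_left _ φ.continuous_normed hlint x
    have h1 : (φ.normed μ ⋆[ContinuousLinearMap.lsmul ℝ ℝ, μ] f) x - f x =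
        ∫ y, φ.normed μ y • (f (x - y) - f x) ∂μ := by
      simp_rw [smul_sub]
      have hce' : Integrable (fun y => φ.normed μ y • f (x - y)) μ := hce
      rw [integral_sub hce' (φ.integrable_normed.smul_const _), integral_smul_const,
        φ.integral_normed, one_smul]
      rfl
    have h2 : ‖(φ.normed μ ⋆[ContinuousLinearMap.lsmul ℝ ℝ, μ] f) x - f x‖ₑ ≤
        ∫⁻ y, ‖f (x - y) - f x‖ₑ ∂ν := by
      rw [h1, hν, lintegral_withDensity_eq_lintegral_mul₀ hwm.aemeasurable]
      · refine (enorm_integral_le_lintegral_enorm _).trans (lintegral_mono fun y => ?_)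
        rw [enorm_smul, Real.enorm_eq_ofReal (φ.nonneg_normed y)]
        rfl
      · exact ((hfm.comp_measurable (measurable_const.sub measurable_id)).sub
          stronglyMeasurable_const).enorm.aemeasurable
    refine (ENNReal.rpow_le_rpow h2 hp0.le).trans ?_
    have h3 : eLpNorm (fun y => f (x - y) - f x) 1 ν ≤
        eLpNorm (fun y => f (x - y) - f x) (ENNReal.ofReal p) ν :=
      eLpNorm_le_eLpNorm_of_exponent_le (by simpa using hp)
        ((hfm.comp_measurable (measurable_const.sub measurable_id)).sub
          stronglyMeasurable_const).aestronglyMeasurable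
    rw [eLpNorm_one_eq_lintegral_enorm, eLpNorm_eq_lintegral_rpow_enorm_toReal (by simpa using hp0)
      ENNReal.ofReal_ne_top, ENNReal.toReal_ofReal hp0.le] at h3
    have := ENNReal.rpow_le_rpow h3 hp0.le
    rwa [← ENNReal.rpow_mul, one_div_mul_cancel hp0.ne', ENNReal.rpow_one] at this
  have hpow : ∀ y, ‖y‖ ≤ φ.rOut → ∫⁻ x, ‖f (x - y) - f x‖ₑ ^ p ∂μ ≤ ε ^ p := by
    intro y hy
    have := hε (-y) (by simpa using hy)
    simp_rw [← sub_eq_add_neg] at this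
    rw [eLpNorm_eq_lintegral_rpow_enorm_toReal (by simpa using hp0)
      ENNReal.ofReal_ne_top, ENNReal.toReal_ofReal hp0.le] at this
    have := ENNReal.rpow_le_rpow this hp0.le
    rwa [← ENNReal.rpow_mul, one_div_mul_cancel hp0.ne', ENNReal.rpow_one] at this
  have hsupp : ∀ᵐ y ∂ν, ‖y‖ ≤ φ.rOut := by
    rw [hν, ae_withDensity_iff hwm]
    refine Eventually.of_forall fun y hy => ?_
    by_contra hcon
    apply hy
    have : y ∉ Function.support (φ.normed μ) := by
      rw [φ.support_normed_eq]; simp; linarith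
    simp [hw, Function.notMem_support.1 this]
  rw [eLpNorm_eq_lintegral_rpow_enorm_toReal (by simpa using hp0)
      ENNReal.ofReal_ne_top, ENNReal.toReal_ofReal hp0.le]
  have main : ∫⁻ x, ‖(φ.normed μ ⋆[ContinuousLinearMap.lsmul ℝ ℝ, μ] f) x - f x‖ₑ ^ p ∂μ ≤ ε ^ p :=
    calc _ ≤ ∫⁻ x, ∫⁻ y, ‖f (x - y) - f x‖ₑ ^ p ∂ν ∂μ := lintegral_mono key
      _ = ∫⁻ y, ∫⁻ x, ‖f (x - y) - f x‖ₑ ^ p ∂μ ∂ν := by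
        refine lintegral_lintegral_swap ?_
        refine Measurable.aemeasurable (Measurable.pow_const ?_ _)
        exact ((hfm.comp_measurable (measurable_fst.sub measurable_snd)).sub
          (hfm.comp_measurable measurable_fst)).enorm
      _ ≤ ∫⁻ y, ε ^ p ∂ν := lintegral_mono_ae (hsupp.mono hpow)
      _ = ε ^ p := by simp
  calc _ ≤ (ε ^ p) ^ (1 / p) := ENNReal.rpow_le_rpow main (by positivity)
    _ = ε := by rw [← ENNReal.rpow_mul, mul_one_div_cancel hp0.ne', ENNReal.rpow_one]

/-- Mollifications converge in `L^p`. -/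
theorem tendsto_eLpNorm_convolution_sub {p : ℝ} (hp : 1 ≤ p) {f : G → F}
    (hf : MemLp f (ENNReal.ofReal p) μ) {φ : ℕ → ContDiffBump (0 : G)}
    (hφ : Tendsto (fun n => (φ n).rOut) atTop (𝓝 0)) :
    Tendsto (fun n => eLpNorm
      (fun z => ((φ n).normed μ ⋆[ContinuousLinearMap.lsmul ℝ ℝ, μ] f) z - f z)
      (ENNReal.ofReal p) μ) atTop (𝓝 0) := by
  obtain ⟨g, hgm, hfg⟩ := hf.1
  have hg : MemLp g (ENNReal.ofReal p) μ := (memLp_congr_ae hfg).1 hf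
  have heq : ∀ n, eLpNorm
      (fun z => ((φ n).normed μ ⋆[ContinuousLinearMap.lsmul ℝ ℝ, μ] f) z - f z)
      (ENNReal.ofReal p) μ = eLpNorm
      (fun z => ((φ n).normed μ ⋆[ContinuousLinearMap.lsmul ℝ ℝ, μ] g) z - g z)
      (ENNReal.ofReal p) μ := by
    intro n
    rw [convolution_congr _ EventuallyEq.rfl hfg]
    refine eLpNorm_congr_ae ?_
    filter_upwards [hfg] with z hz
    rw [hz]
  simp_rw [heq]
  rw [ENNReal.tendsto_nhds_zero]
  intro ε hε
  have h1 := (ENNReal.tendsto_nhds_zero.1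
    (tendsto_eLpNorm_translate_sub (by simpa using hp) ENNReal.ofReal_ne_top hg)) ε hε
  obtain ⟨δ, hδ, hball⟩ := Metric.eventually_nhds_iff.1 h1
  filter_upwards [hφ.eventually (gt_mem_nhds hδ)] with n hn
  refine eLpNorm_convolution_sub_le hp hgm hg _ fun y hy => hball ?_
  simpa using lt_of_le_of_lt hy hn

end Mollification

end DoublyNonlinear

end

noncomputable section

namespace DoublyNonlinear

open scoped Convolution ENNReal

variable {N : ℕ}

instance isAddHaarMeasure_volume_spaceTime :
    (volume : Measure (SpaceTime N)).IsAddHaarMeasure :=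
  inferInstanceAs ((volume : Measure (EuclideanSpace ℝ (Fin N))).prod
    (volume : Measure ℝ)).IsAddHaarMeasure

theorem memLp_indicator_of_restrict {α F : Type*} [MeasurableSpace α] {μ : Measure α}
    [NormedAddCommGroup F] {f : α → F} {r : ℝ≥0∞} {s : Set α} (hs : MeasurableSet s)
    (h : MemLp f r (μ.restrict s)) : MemLp (s.indicator f) r μ :=
  (memLp_indicator_iff_restrict hs).2 h

/-- The differential of `f` in the space variables. -/
def spatialDeriv (f : SpaceTime N → ℝ) (z : SpaceTime N) : EuclideanSpace ℝ (Fin N) →L[ℝ] ℝ :=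
  (fderiv ℝ f z).comp (ContinuousLinearMap.inl ℝ (EuclideanSpace ℝ (Fin N)) ℝ)

theorem spatialDeriv_apply (f : SpaceTime N → ℝ) (z : SpaceTime N) (ξ : EuclideanSpace ℝ (Fin N)) :
    spatialDeriv f z ξ = fderiv ℝ f z (ξ, 0) := rfl

/-- Mollification commutes with the weak spatial gradient, at points where the mollifier is
supported well inside the domain. -/
theorem spatialDeriv_convolution {U Q' : Set (SpaceTime N)}
    (hQ'U : Q' ⊆ U) {u : SpaceTime N → ℝ} {Du : SpaceTime N → EuclideanSpace ℝ (Fin N)}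
    (hgrad : IsWeakSpatialGradient u Du U)
    (hu : LocallyIntegrable (Q'.indicator u) volume)
    (hDu : LocallyIntegrable (Q'.indicator fun w => innerSL ℝ (Du w)) volume)
    (φ : ContDiffBump (0 : SpaceTime N)) {z : SpaceTime N} (hz : Metric.closedBall z φ.rOut ⊆ Q') :
    spatialDeriv (φ.normed volume ⋆[ContinuousLinearMap.lsmul ℝ ℝ, volume] Q'.indicator u) z =
      (φ.normed volume ⋆[ContinuousLinearMap.lsmul ℝ ℝ, volume]
        Q'.indicator fun w => innerSL ℝ (Du w)) z := by
  set f := φ.normed (volume : Measure (SpaceTime N)) with hf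
  have hfs : ContDiff ℝ (⊤ : ℕ∞) f := φ.contDiff_normed
  have hfc : HasCompactSupport f := φ.hasCompactSupport_normed
  have hψ : ContDiff ℝ (⊤ : ℕ∞) (fun w => f (z - w)) := hfs.comp (contDiff_const.sub contDiff_id)
  have hts : tsupport (fun w => f (z - w)) ⊆ Metric.closedBall z φ.rOut := by
    refine closure_minimal ?_ Metric.isClosed_closedBall
    intro w hw
    have h1 : z - w ∈ Function.support f := hw
    rw [hf, φ.support_normed_eq, mem_ball_zero_iff] at h1
    rw [Metric.mem_closedBall, dist_comm, dist_eq_norm]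
    exact h1.le
  have hcψ : HasCompactSupport (fun w => f (z - w)) :=
    (isCompact_closedBall z φ.rOut).of_isClosed_subset (isClosed_tsupport _) hts
  have hfd : ∀ w v, fderiv ℝ (fun w => f (z - w)) w v = - fderiv ℝ f (z - w) v := by
    intro w v
    have h1 : HasFDerivAt f (fderiv ℝ f (z - w)) (z - w) :=
      (hfs.differentiable (by simp) _).hasFDerivAt
    have h2 : HasFDerivAt (fun w => z - w) (-ContinuousLinearMap.id ℝ (SpaceTime N)) w :=
      (hasFDerivAt_id w).const_sub z
    have h3 : HasFDerivAt (fun w => f (z - w)) _ w := h1.comp w h2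
    rw [h3.fderiv]
    simp
  have hd := hfc.hasFDerivAt_convolution_left (ContinuousLinearMap.lsmul ℝ ℝ)
    (hfs.of_le (by norm_cast)) hu z
  have hcex : ConvolutionExistsAt (fderiv ℝ f) (Q'.indicator u) z
      ((ContinuousLinearMap.lsmul ℝ ℝ).precompL (SpaceTime N)) volume :=
    (hfc.fderiv ℝ).convolutionExists_left _ (hfs.continuous_fderiv (by simp)) hu z
  have hcex2 : ConvolutionExistsAt f (Q'.indicator fun w => innerSL ℝ (Du w)) z
      (ContinuousLinearMap.lsmul ℝ ℝ) volume :=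
    hfc.convolutionExists_left _ hfs.continuous hDu z
  have hbasis : ∀ i : Fin N,
      spatialDeriv (f ⋆[ContinuousLinearMap.lsmul ℝ ℝ, volume] Q'.indicator u) z
        (EuclideanSpace.single i 1) =
      (f ⋆[ContinuousLinearMap.lsmul ℝ ℝ, volume]
        Q'.indicator fun w => innerSL ℝ (Du w)) z (EuclideanSpace.single i 1) := by
    intro i
    rw [spatialDeriv_apply, hd.fderiv, convolution_eq_swap, convolution_eq_swap,
      ContinuousLinearMap.integral_apply hcex.integrable_swap,
      ContinuousLinearMap.integral_apply hcex2.integrable_swap]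
    have h2 := hgrad (fun w => f (z - w)) hψ hcψ (hts.trans (hz.trans hQ'U)) i
    have h3 : ∫ w, (((ContinuousLinearMap.lsmul ℝ ℝ).precompL (SpaceTime N)) (fderiv ℝ f (z - w))
        (Q'.indicator u w)) (EuclideanSpace.single i 1, 0) =
        - ∫ w in U, u w * fderiv ℝ (fun w => f (z - w)) w (EuclideanSpace.single i 1, 0) := by
      rw [setIntegral_eq_integral_of_forall_compl_eq_zero, ← integral_neg]
      · refine integral_congr_ae (Eventually.of_forall fun w => ?_)
        simp only [ContinuousLinearMap.precompL_apply, ContinuousLinearMap.lsmul_apply, hfd,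
          smul_eq_mul]
        by_cases hw : w ∈ Q'
        · simp only [indicator_of_mem hw]; ring
        · have : fderiv ℝ (fun w => f (z - w)) w (EuclideanSpace.single i 1, 0) = 0 := by
            rw [fderiv_of_notMem_tsupport ℝ (fun h => hw (hz (hts h)))]; rfl
          rw [hfd] at this
          simp only [indicator_of_notMem hw]
          rw [this]; simp
      · intro w hw
        rw [fderiv_of_notMem_tsupport ℝ (fun h => hw (hQ'U (hz (hts h))))]
        simp
    rw [h3, h2, neg_neg, setIntegral_eq_integral_of_forall_compl_eq_zero]
    · refine integral_congr_ae (Eventually.of_forall fun w => ?_)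
      simp only [ContinuousLinearMap.lsmul_apply]
      by_cases hw : w ∈ Q'
      · simp [indicator_of_mem hw, mul_comm, EuclideanSpace.inner_single_right]
      · have : f (z - w) = 0 := image_eq_zero_of_notMem_tsupport
          (f := fun w => f (z - w)) (fun h => hw (hz (hts h)))
        simp [indicator_of_notMem hw, this]
    · intro w hw
      have : f (z - w) = 0 := image_eq_zero_of_notMem_tsupport
          (f := fun w => f (z - w)) (fun h => hw (hQ'U (hz (hts h))))
      simp [this]
  have := (EuclideanSpace.basisFun (Fin N) ℝ).toBasis.ext
    (f₁ := (spatialDeriv (f ⋆[ContinuousLinearMap.lsmul ℝ ℝ, volume] Q'.indicator u) z).toLinearMap)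
    (f₂ := ((f ⋆[ContinuousLinearMap.lsmul ℝ ℝ, volume]
        Q'.indicator fun w => innerSL ℝ (Du w)) z).toLinearMap) (by
      intro i
      simpa using hbasis i)
  exact ContinuousLinearMap.coe_injective this

/-- Local approximation by smooth functions: convergence almost everywhere, and in `L^p` of the
spatial gradients. -/
theorem exists_smooth_approx {p : ℝ} (hp : 1 ≤ p) {U Q : Set (SpaceTime N)} (hU : IsOpen U)
    (hQ : IsCompact Q) (hQU : Q ⊆ U) {u : SpaceTime N → ℝ}
    {Du : SpaceTime N → EuclideanSpace ℝ (Fin N)} (hu : MemLpLocOn u p U)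
    (hDu : MemLpLocOn Du p U) (hgrad : IsWeakSpatialGradient u Du U) :
    ∃ v : ℕ → SpaceTime N → ℝ, (∀ n, ContDiff ℝ (⊤ : ℕ∞) (v n)) ∧
      (∀ᵐ z ∂volume.restrict Q, Tendsto (fun n => v n z) atTop (𝓝 (u z))) ∧
      Tendsto (fun n => eLpNorm (fun z => spatialDeriv (v n) z - innerSL ℝ (Du z))
        (ENNReal.ofReal p) (volume.restrict Q)) atTop (𝓝 0) := by
  obtain ⟨δ, hδ, hδU⟩ := hQ.exists_cthickening_subset_open hU hQU
  set Q' := Metric.cthickening δ Q with hQ'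
  have hQ'c : IsCompact Q' := hQ.cthickening
  have hQ'm : MeasurableSet Q' := hQ'c.measurableSet
  have hp' : 1 ≤ ENNReal.ofReal p := by simpa using hp
  have hum : MemLp (Q'.indicator u) (ENNReal.ofReal p) volume :=
    (memLp_indicator_iff_restrict hQ'm).2 (hu Q' hQ'c hδU)
  have hDm : MemLp (Q'.indicator fun w => innerSL ℝ (Du w)) (ENNReal.ofReal p) volume := by
    have h : MemLp (fun w => innerSL ℝ (Du w)) (ENNReal.ofReal p) (volume.restrict Q') := by
      refine (hDu Q' hQ'c hδU).of_le (f := fun w => innerSL ℝ (Du w)) ?_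
        (Eventually.of_forall fun w => (innerSL_apply_norm ℝ (Du w)).le)
      exact (innerSL ℝ (E := EuclideanSpace ℝ (Fin N))).continuous.comp_aestronglyMeasurable
        (hDu Q' hQ'c hδU).1
    exact memLp_indicator_of_restrict hQ'm h
  let φ : ℕ → ContDiffBump (0 : SpaceTime N) := fun n =>
    ⟨δ / (n + 1) / 2, δ / (n + 1), by positivity, half_lt_self (by positivity)⟩
  have hφ : Tendsto (fun n => (φ n).rOut) atTop (𝓝 0) := by
    have := (tendsto_one_div_add_atTop_nhds_zero_nat (𝕜 := ℝ)).const_mul δ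
    rw [mul_zero] at this
    refine this.congr fun n => ?_
    simp [φ, div_eq_mul_inv]
  refine ⟨fun n => (φ n).normed volume ⋆[ContinuousLinearMap.lsmul ℝ ℝ, volume] Q'.indicator u,
    fun n => ?_, ?_, ?_⟩
  · exact (φ n).hasCompactSupport_normed.contDiff_convolution_left _ (φ n).contDiff_normed
      (hum.locallyIntegrable hp')
  · have h := ContDiffBump.ae_convolution_tendsto_right_of_locallyIntegrable (K := 2) hφ
      (Eventually.of_forall fun n => by simp only [φ]; linarith) (hum.locallyIntegrable hp')
    filter_upwards [ae_restrict_of_ae h, ae_restrict_mem hQ.measurableSet] with z hz hzQ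
    rwa [indicator_of_mem (Metric.self_subset_cthickening Q hzQ)] at hz
  · have h := tendsto_eLpNorm_convolution_sub hp hDm hφ
    refine tendsto_of_tendsto_of_tendsto_of_le_of_le tendsto_const_nhds h (fun _ => zero_le)
      fun n => ?_
    refine le_trans (le_of_eq ?_) (eLpNorm_mono_measure _ (Measure.restrict_le_self (s := Q)))
    refine eLpNorm_congr_ae ?_
    filter_upwards [ae_restrict_mem hQ.measurableSet] with z hzQ
    have hle : δ / ((n : ℝ) + 1) ≤ δ :=
      div_le_self hδ.le (by linarith [n.cast_nonneg (α := ℝ)])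
    rw [spatialDeriv_convolution hδU hgrad (hum.locallyIntegrable hp')
      (hDm.locallyIntegrable hp') (φ n)
      ((Metric.closedBall_subset_closedBall hle).trans
        (Metric.closedBall_subset_cthickening hzQ δ)),
      indicator_of_mem (Metric.self_subset_cthickening Q hzQ)]

end DoublyNonlinear

end

noncomputable section

namespace DoublyNonlinear

open scoped ENNReal

variable {N : ℕ}

/-- The unit vector in the direction of time, multiplied by `σ`. -/
abbrev timeShift (N : ℕ) (σ : ℝ) : SpaceTime N := (0, σ)

theorem norm_timeShift (σ : ℝ) : ‖timeShift N σ‖ = |σ| := by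
  simp [timeShift, Prod.norm_def]

theorem continuous_timeShift : Continuous (timeShift N) := by
  unfold timeShift; fun_prop

theorem continuous_spatialDeriv {f : SpaceTime N → ℝ} (hf : ContDiff ℝ 1 f) :
    Continuous (spatialDeriv f) :=
  (hf.continuous_fderiv (by simp)).clm_comp continuous_const

theorem spatialDeriv_eq_zero {f : SpaceTime N → ℝ} {z : SpaceTime N} (hz : z ∉ tsupport f) :
    spatialDeriv f z = 0 := by
  rw [spatialDeriv, fderiv_of_notMem_tsupport ℝ hz]; simp

theorem exists_bound_of_hasCompactSupport {F : Type*} [NormedAddCommGroup F] {f : SpaceTime N → F}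
    (hc : Continuous f) (hs : HasCompactSupport f) : ∃ C, 0 ≤ C ∧ ∀ z, ‖f z‖ ≤ C := by
  obtain ⟨C, hC⟩ := hs.exists_bound_of_continuous hc
  exact ⟨C, (norm_nonneg _).trans (hC 0), hC⟩

theorem exists_bound_spatialDeriv {f : SpaceTime N → ℝ}
    (hf : ContDiff ℝ 1 f) (hs : HasCompactSupport f) :
    ∃ C, 0 ≤ C ∧ ∀ z, ‖spatialDeriv f z‖ ≤ C := by
  refine exists_bound_of_hasCompactSupport (continuous_spatialDeriv hf) (hs.mono' ?_)
  intro z hz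
  by_contra h
  exact hz (spatialDeriv_eq_zero h)

section Steklov

/-- The forward time average, without the normalizing factor. -/
def timeAverage (h : ℝ) (Φ : SpaceTime N → ℝ) (z : SpaceTime N) : ℝ :=
  ∫ σ in (0 : ℝ)..h, Φ (z + timeShift N σ)

variable {Φ : SpaceTime N → ℝ}

theorem hasFDerivAt_timeAverage (hΦ : ContDiff ℝ 1 Φ) (hs : HasCompactSupport Φ) (h : ℝ)
    (z : SpaceTime N) :
    HasFDerivAt (timeAverage h Φ) (∫ σ in (0 : ℝ)..h, fderiv ℝ Φ (z + timeShift N σ)) z := by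
  obtain ⟨C, -, hC⟩ := exists_bound_of_hasCompactSupport (hΦ.continuous_fderiv (by simp))
    (hs.fderiv ℝ)
  have hcs : Continuous (timeShift N) := continuous_timeShift
  have hcd : Continuous (fderiv ℝ Φ) := hΦ.continuous_fderiv (by simp)
  refine intervalIntegral.hasFDerivAt_integral_of_dominated_of_fderiv_le
    (F := fun z σ => Φ (z + timeShift N σ)) (F' := fun z σ => fderiv ℝ Φ (z + timeShift N σ))
    (bound := fun _ => C) (s := univ) univ_mem ?_ ?_ ?_ ?_ ?_ ?_
  · refine Eventually.of_forall fun x => Continuous.aestronglyMeasurable ?_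
    exact hΦ.continuous.comp (continuous_const.add hcs)
  · exact (hΦ.continuous.comp (continuous_const.add hcs)).intervalIntegrable _ _
  · exact (hcd.comp (continuous_const.add hcs)).aestronglyMeasurable
  · exact Eventually.of_forall fun σ _ x _ => hC _
  · exact continuous_const.intervalIntegrable _ _
  · refine Eventually.of_forall fun σ _ x _ => ?_
    have h1 : HasFDerivAt Φ (fderiv ℝ Φ (x + timeShift N σ)) (x + timeShift N σ) :=
      (hΦ.differentiable (by simp) _).hasFDerivAt
    have h2 := h1.comp x ((hasFDerivAt_id x).add_const (timeShift N σ))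
    rw [ContinuousLinearMap.comp_id] at h2
    exact h2

theorem contDiff_timeAverage (hΦ : ContDiff ℝ 1 Φ) (hs : HasCompactSupport Φ) (h : ℝ) :
    ContDiff ℝ 1 (timeAverage h Φ) := by
  rw [contDiff_one_iff_fderiv]
  refine ⟨fun z => (hasFDerivAt_timeAverage hΦ hs h z).differentiableAt, ?_⟩
  have : fderiv ℝ (timeAverage h Φ) = fun z => ∫ σ in (0 : ℝ)..h, fderiv ℝ Φ (z + timeShift N σ) :=
    funext fun z => (hasFDerivAt_timeAverage hΦ hs h z).fderiv
  rw [this]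
  refine intervalIntegral.continuous_parametric_intervalIntegral_of_continuous'
    (f := fun z σ => fderiv ℝ Φ (z + timeShift N σ)) ?_ _ _
  have hcs : Continuous (timeShift N) := continuous_timeShift
  exact (hΦ.continuous_fderiv (by simp)).comp (continuous_fst.add (hcs.comp continuous_snd))

theorem fderiv_timeAverage_apply (hΦ : ContDiff ℝ 1 Φ) (hs : HasCompactSupport Φ) (h : ℝ)
    (z v : SpaceTime N) :
    fderiv ℝ (timeAverage h Φ) z v = ∫ σ in (0 : ℝ)..h, fderiv ℝ Φ (z + timeShift N σ) v := by
  rw [(hasFDerivAt_timeAverage hΦ hs h z).fderiv]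
  refine ContinuousLinearMap.intervalIntegral_apply (Continuous.intervalIntegrable ?_ _ _) v
  have hcs : Continuous (timeShift N) := continuous_timeShift
  exact (hΦ.continuous_fderiv (by simp)).comp (continuous_const.add hcs)

theorem fderiv_timeAverage_time (hΦ : ContDiff ℝ 1 Φ) (hs : HasCompactSupport Φ) (h : ℝ)
    (z : SpaceTime N) :
    fderiv ℝ (timeAverage h Φ) z (0, 1) = Φ (z + timeShift N h) - Φ z := by
  rw [fderiv_timeAverage_apply hΦ hs]
  have hcs : Continuous (timeShift N) := continuous_timeShift
  have hd : ∀ σ, HasDerivAt (fun σ => Φ (z + timeShift N σ))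
      (fderiv ℝ Φ (z + timeShift N σ) (0, 1)) σ := by
    intro σ
    have h1 : HasFDerivAt Φ (fderiv ℝ Φ (z + timeShift N σ)) (z + timeShift N σ) :=
      (hΦ.differentiable (by simp) _).hasFDerivAt
    refine h1.comp_hasDerivAt σ ?_
    have : HasDerivAt (timeShift N) (0, 1) σ :=
      (hasDerivAt_const σ (0 : EuclideanSpace ℝ (Fin N))).prodMk (hasDerivAt_id σ)
    exact this.const_add z
  rw [intervalIntegral.integral_eq_sub_of_hasDerivAt (fun σ _ => hd σ)]
  · rw [show timeShift N 0 = 0 from rfl, add_zero]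
  · refine Continuous.intervalIntegrable ?_ _ _
    exact ((hΦ.continuous_fderiv (by simp)).comp (continuous_const.add hcs)).clm_apply
      continuous_const

theorem tsupport_timeAverage_subset {K : Set (SpaceTime N)} {h : ℝ} (h0 : 0 ≤ h)
    (hK : ∀ z, z ∉ K → Φ z = 0) : tsupport (timeAverage h Φ) ⊆ Metric.cthickening h K := by
  refine closure_minimal ?_ Metric.isClosed_cthickening
  intro z hz
  by_contra hcon
  apply hz
  rw [timeAverage, intervalIntegral.integral_congr (g := fun _ => (0 : ℝ))]
  · simp
  · intro σ hσ
    rw [uIcc_of_le h0] at hσ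
    refine hK _ fun hmem => hcon ?_
    refine Metric.mem_cthickening_of_dist_le z (z + timeShift N σ) h K hmem ?_
    rw [dist_self_add_right, norm_timeShift, abs_of_nonneg hσ.1]
    exact hσ.2

theorem timeAverage_nonneg {h : ℝ} (h0 : 0 ≤ h) (hΦ : ∀ z, 0 ≤ Φ z) (z : SpaceTime N) :
    0 ≤ timeAverage h Φ z :=
  intervalIntegral.integral_nonneg h0 fun _ _ => hΦ _

end Steklov

theorem tendsto_eLpNorm_zero_of_dominated {α F : Type*} [MeasurableSpace α] {μ : Measure α}
    [NormedAddCommGroup F] {p : ℝ} (hp : 0 < p) {g : ℕ → α → F} {b : α → ℝ}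
    (hgm : ∀ n, AEStronglyMeasurable (g n) μ) (hb : MemLp b (ENNReal.ofReal p) μ)
    (hgb : ∀ n, ∀ᵐ z ∂μ, ‖g n z‖ ≤ b z) (hlim : ∀ᵐ z ∂μ, Tendsto (fun n => g n z) atTop (𝓝 0)) :
    Tendsto (fun n => eLpNorm (g n) (ENNReal.ofReal p) μ) atTop (𝓝 0) := by
  have hp' : ENNReal.ofReal p ≠ 0 := by simpa using hp
  have h1 : ∀ n, eLpNorm (g n) (ENNReal.ofReal p) μ = (∫⁻ z, ‖g n z‖ₑ ^ p ∂μ) ^ (1 / p) := fun n => by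
    rw [eLpNorm_eq_lintegral_rpow_enorm_toReal hp' ENNReal.ofReal_ne_top,
      ENNReal.toReal_ofReal hp.le]
  simp_rw [h1]
  have h2 : Tendsto (fun n => ∫⁻ z, ‖g n z‖ₑ ^ p ∂μ) atTop (𝓝 (∫⁻ _, 0 ∂μ)) := by
    refine tendsto_lintegral_of_dominated_convergence' (fun z => ‖b z‖ₑ ^ p)
      (fun n => ((hgm n).enorm.pow_const p)) (fun n => ?_) ?_ ?_
    · filter_upwards [hgb n] with z hz
      gcongr
      rw [← ofReal_norm, ← ofReal_norm]
      exact ENNReal.ofReal_le_ofReal (hz.trans (le_abs_self _))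
    · have := lintegral_rpow_enorm_lt_top_of_eLpNorm_lt_top hp' ENNReal.ofReal_ne_top hb.2
      rw [ENNReal.toReal_ofReal hp.le] at this
      exact this.ne
    · filter_upwards [hlim] with z hz
      have h3 : Tendsto (fun n => ‖g n z‖ₑ) atTop (𝓝 0) := by
        simpa using hz.enorm
      have := h3.ennrpow_const p
      rwa [ENNReal.zero_rpow_of_pos hp] at this
  have h3 := h2.ennrpow_const (1 / p)
  rwa [lintegral_zero, ENNReal.zero_rpow_of_pos (by positivity)] at h3

theorem aestronglyMeasurable_pairing {α : Type*} [MeasurableSpace α] {μ : Measure α}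
    {f : α → EuclideanSpace ℝ (Fin N) →L[ℝ] ℝ} {a : α → EuclideanSpace ℝ (Fin N)}
    (hf : AEStronglyMeasurable f μ) (ha : AEStronglyMeasurable a μ) :
    AEStronglyMeasurable (fun z => f z (a z)) μ :=
  (isBoundedBilinearMap_apply (𝕜 := ℝ)).continuous.comp_aestronglyMeasurable (hf.prodMk ha)

/-- Hölder's inequality for the pairing of covectors and vectors. -/
theorem enorm_integral_pairing_le {α : Type*} [MeasurableSpace α] {μ : Measure α} {r s : ℝ≥0∞}
    [ENNReal.HolderConjugate r s] {f : α → EuclideanSpace ℝ (Fin N) →L[ℝ] ℝ}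
    {a : α → EuclideanSpace ℝ (Fin N)} (hf : AEStronglyMeasurable f μ)
    (ha : AEStronglyMeasurable a μ) :
    ‖∫ z, f z (a z) ∂μ‖ₑ ≤ eLpNorm f r μ * eLpNorm a s μ := by
  refine (enorm_integral_le_lintegral_enorm _).trans ?_
  rw [← eLpNorm_one_eq_lintegral_enorm]
  have := eLpNorm_le_eLpNorm_mul_eLpNorm_of_nnnorm (p := r) (q := s) (r := 1) hf ha
    (fun f a => f a) 1 (Eventually.of_forall fun z => by simpa using (f z).le_opNNNorm (a z))
  simpa using this

theorem integrable_pairing {α : Type*} [MeasurableSpace α] {μ : Measure α} {r s : ℝ≥0∞}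
    [ENNReal.HolderConjugate r s] {f : α → EuclideanSpace ℝ (Fin N) →L[ℝ] ℝ}
    {a : α → EuclideanSpace ℝ (Fin N)} (hf : MemLp f r μ) (ha : MemLp a s μ) :
    Integrable (fun z => f z (a z)) μ := by
  rw [← memLp_one_iff_integrable]
  exact MemLp.of_bilin (p := r) (q := s) (r := 1) (fun f a => f a) 1 hf ha
    (aestronglyMeasurable_pairing hf.1 ha.1) (Eventually.of_forall fun z => by simpa using (f z).le_opNNNorm (a z))

end DoublyNonlinear

end

noncomputable section

namespace DoublyNonlinear

open scoped ENNReal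

variable {N : ℕ}

theorem eLpNorm_eq_restrict_of_support_subset {α F : Type*} [MeasurableSpace α] {μ : Measure α}
    [NormedAddCommGroup F] {f : α → F} {r : ℝ≥0∞} {s : Set α} (h : Function.support f ⊆ s) :
    eLpNorm f r μ = eLpNorm f r (μ.restrict s) :=
  (eLpNorm_restrict_eq_of_support_subset h).symm

theorem memLp_fun_add {α F : Type*} [MeasurableSpace α] {μ : Measure α}
    [NormedAddCommGroup F] {f g : α → F} {r : ℝ≥0∞} (hf : MemLp f r μ) (hg : MemLp g r μ) :
    MemLp (fun z => f z + g z) r μ :=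
  hf.add hg

theorem eLpNorm_add_add_le {α F : Type*} [MeasurableSpace α] {μ : Measure α}
    [NormedAddCommGroup F] {f g h : α → F} {r : ℝ≥0∞} (hr : 1 ≤ r)
    (hf : AEStronglyMeasurable f μ) (hg : AEStronglyMeasurable g μ)
    (hh : AEStronglyMeasurable h μ) :
    eLpNorm (fun z => f z + g z + h z) r μ ≤ eLpNorm f r μ + eLpNorm g r μ + eLpNorm h r μ := by
  refine (eLpNorm_add_le (hf.add hg) hh hr).trans ?_
  gcongr
  exact eLpNorm_add_le hf hg hr

/-- The local data of a supersolution `u` of `∂_t β(u) - div a = 0` in a bounded open set `O`,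
with spatial differential `D`. -/
structure IsLocalSupersolution (O : Set (SpaceTime N)) (p : ℝ) (r : ℝ≥0∞) (β : ℝ → ℝ)
    (u : SpaceTime N → ℝ) (D : SpaceTime N → EuclideanSpace ℝ (Fin N) →L[ℝ] ℝ)
    (a : SpaceTime N → EuclideanSpace ℝ (Fin N)) : Prop where
  isOpen : IsOpen O
  volume_ne_top : volume O ≠ ∞
  aestronglyMeasurable : AEStronglyMeasurable u (volume.restrict O)
  memLp_deriv : MemLp D (ENNReal.ofReal p) (volume.restrict O)
  memLp_flux : MemLp a r (volume.restrict O)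
  integrableOn : IntegrableOn (fun z => β (u z)) O
  approx : ∃ v : ℕ → SpaceTime N → ℝ, (∀ n, ContDiff ℝ 1 (v n)) ∧
    (∀ᵐ z ∂volume.restrict O, Tendsto (fun n => v n z) atTop (𝓝 (u z))) ∧
    Tendsto (fun n => eLpNorm (fun z => spatialDeriv (v n) z - D z) (ENNReal.ofReal p)
      (volume.restrict O)) atTop (𝓝 0)
  supersolution : ∀ ζ : SpaceTime N → ℝ, ContDiff ℝ 1 ζ → HasCompactSupport ζ → tsupport ζ ⊆ O →
    (∀ z, 0 ≤ ζ z) →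
    0 ≤ ∫ z in O, (-(β (u z)) * fderiv ℝ ζ z (0, 1) + spatialDeriv ζ z (a z))

/-- The spatial differential of `F(u) η`, when `D` is that of `u`. -/
def derivComp (F : ℝ → ℝ) (η u : SpaceTime N → ℝ)
    (D : SpaceTime N → EuclideanSpace ℝ (Fin N) →L[ℝ] ℝ) (z : SpaceTime N) :
    EuclideanSpace ℝ (Fin N) →L[ℝ] ℝ :=
  (deriv F (u z) * η z) • D z + F (u z) • spatialDeriv η z

theorem derivComp_eq_zero {F : ℝ → ℝ} {η u : SpaceTime N → ℝ}
    {D : SpaceTime N → EuclideanSpace ℝ (Fin N) →L[ℝ] ℝ} {z : SpaceTime N}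
    (hz : z ∉ tsupport η) : derivComp F η u D z = 0 := by
  rw [derivComp, spatialDeriv_eq_zero hz, image_eq_zero_of_notMem_tsupport hz]
  simp

theorem spatialDeriv_comp_mul {F : ℝ → ℝ} {η v : SpaceTime N → ℝ} (hF : ContDiff ℝ 1 F)
    (hη : ContDiff ℝ 1 η) (hv : ContDiff ℝ 1 v) (z : SpaceTime N) :
    spatialDeriv (fun w => F (v w) * η w) z = derivComp F η v (spatialDeriv v) z := by
  have h1 : HasFDerivAt v (fderiv ℝ v z) z := (hv.differentiable (by simp) z).hasFDerivAt
  have h2 : HasDerivAt F (deriv F (v z)) (v z) := (hF.differentiable (by simp) _).hasDerivAt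
  have h3 : HasFDerivAt η (fderiv ℝ η z) z := (hη.differentiable (by simp) z).hasFDerivAt
  have h4 : HasFDerivAt (fun w => F (v w) * η w) _ z := (h2.comp_hasFDerivAt z h1).mul h3
  ext ξ
  rw [spatialDeriv_apply, h4.fderiv]
  simp [derivComp, spatialDeriv]
  ring

variable {O : Set (SpaceTime N)} {p : ℝ} {r : ℝ≥0∞} {β : ℝ → ℝ} {u : SpaceTime N → ℝ}
  {D : SpaceTime N → EuclideanSpace ℝ (Fin N) →L[ℝ] ℝ} {a : SpaceTime N → EuclideanSpace ℝ (Fin N)}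
  {F : ℝ → ℝ} {η : SpaceTime N → ℝ} {M : ℝ}

theorem memLp_derivComp (hu : IsLocalSupersolution O p r β u D a)
    (hF : ContDiff ℝ 1 F) (hM : ∀ s, |F s| ≤ M) (hM' : ∀ s, |deriv F s| ≤ M)
    (hη : ContDiff ℝ 1 η) (hηs : HasCompactSupport η) (hηO : tsupport η ⊆ O) :
    MemLp (derivComp F η u D) (ENNReal.ofReal p) volume := by
  obtain ⟨C, hC0, hC⟩ := exists_bound_of_hasCompactSupport hη.continuous hηs
  obtain ⟨C', hC'0, hC'⟩ := exists_bound_spatialDeriv hη hηs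
  have hM0 : 0 ≤ M := (abs_nonneg _).trans (hM 0)
  have hdF : Continuous (deriv F) := hF.continuous_deriv (by simp)
  have hfin : IsFiniteMeasure (volume.restrict O) :=
    ⟨by rw [Measure.restrict_apply_univ]; exact hu.volume_ne_top.lt_top⟩
  have h : MemLp (derivComp F η u D) (ENNReal.ofReal p) (volume.restrict O) := by
    have h1 : MemLp (fun z => (deriv F (u z) * η z) • D z) (ENNReal.ofReal p)
        (volume.restrict O) := by
      refine MemLp.of_le_mul (c := M * C) hu.memLp_deriv ?_ (Eventually.of_forall fun z => ?_)
      · exact ((hdF.comp_aestronglyMeasurable hu.aestronglyMeasurable).mul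
          hη.continuous.aestronglyMeasurable).smul hu.memLp_deriv.1
      · rw [norm_smul, norm_mul]
        gcongr
        · exact hM' _
        · exact hC z
    have h2 : MemLp (fun z => F (u z) • spatialDeriv η z) (ENNReal.ofReal p)
        (volume.restrict O) := by
      refine MemLp.of_bound (C := M * C') ?_ (Eventually.of_forall fun z => ?_)
      · exact (hF.continuous.comp_aestronglyMeasurable hu.aestronglyMeasurable).smul
          (continuous_spatialDeriv hη).aestronglyMeasurable
      · rw [norm_smul]
        gcongr
        · exact hM _
        · exact hC' z
    exact memLp_fun_add h1 h2
  have h2 := memLp_indicator_of_restrict hu.isOpen.measurableSet h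
  have h3 : O.indicator (derivComp F η u D) = derivComp F η u D := by
    refine indicator_eq_self.2 fun z hz => ?_
    by_contra hcon
    exact hz (derivComp_eq_zero fun h => hcon (hηO h))
  rwa [h3] at h2

theorem tendsto_eLpNorm_spatialDeriv_comp (hp : 1 ≤ p) (hu : IsLocalSupersolution O p r β u D a)
    (hF : ContDiff ℝ 1 F) (hM : ∀ s, |F s| ≤ M) (hM' : ∀ s, |deriv F s| ≤ M)
    (hη : ContDiff ℝ 1 η) (hηs : HasCompactSupport η) (hηO : tsupport η ⊆ O)
    {v : ℕ → SpaceTime N → ℝ} (hv : ∀ n, ContDiff ℝ 1 (v n))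
    (hvu : ∀ᵐ z ∂volume.restrict O, Tendsto (fun n => v n z) atTop (𝓝 (u z)))
    (hvD : Tendsto (fun n => eLpNorm (fun z => spatialDeriv (v n) z - D z) (ENNReal.ofReal p)
      (volume.restrict O)) atTop (𝓝 0)) :
    Tendsto (fun n => eLpNorm (fun z => spatialDeriv (fun w => F (v n w) * η w) z -
      derivComp F η u D z) (ENNReal.ofReal p) volume) atTop (𝓝 0) := by
  obtain ⟨C, hC0, hC⟩ := exists_bound_of_hasCompactSupport hη.continuous hηs
  obtain ⟨C', hC'0, hC'⟩ := exists_bound_spatialDeriv hη hηs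
  have hM0 : 0 ≤ M := (abs_nonneg _).trans (hM 0)
  have hp0 : 0 < p := by linarith
  have hp1 : 1 ≤ ENNReal.ofReal p := by simpa using hp
  have hdF : Continuous (deriv F) := hF.continuous_deriv (by simp)
  have hfin : IsFiniteMeasure (volume.restrict O) :=
    ⟨by rw [Measure.restrict_apply_univ]; exact hu.volume_ne_top.lt_top⟩
  set μ := volume.restrict O with hμ
  have hum := hu.aestronglyMeasurable
  have hDm := hu.memLp_deriv.1
  have hηm : AEStronglyMeasurable η μ := hη.continuous.aestronglyMeasurable
  have hdηm : AEStronglyMeasurable (spatialDeriv η) μ :=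
    (continuous_spatialDeriv hη).aestronglyMeasurable
  have hvm : ∀ n, AEStronglyMeasurable (v n) μ := fun n => (hv n).continuous.aestronglyMeasurable
  have hdvm : ∀ n, AEStronglyMeasurable (spatialDeriv (v n)) μ := fun n =>
    (continuous_spatialDeriv (hv n)).aestronglyMeasurable
  let g₁ : ℕ → SpaceTime N → EuclideanSpace ℝ (Fin N) →L[ℝ] ℝ := fun n z =>
    (deriv F (v n z) * η z) • (spatialDeriv (v n) z - D z)
  let g₂ : ℕ → SpaceTime N → EuclideanSpace ℝ (Fin N) →L[ℝ] ℝ := fun n z =>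
    ((deriv F (v n z) - deriv F (u z)) * η z) • D z
  let g₃ : ℕ → SpaceTime N → EuclideanSpace ℝ (Fin N) →L[ℝ] ℝ := fun n z =>
    (F (v n z) - F (u z)) • spatialDeriv η z
  have m₁ : ∀ n, AEStronglyMeasurable (g₁ n) μ := fun n =>
    ((hdF.comp_aestronglyMeasurable (hvm n)).mul hηm).smul ((hdvm n).sub hDm)
  have m₂ : ∀ n, AEStronglyMeasurable (g₂ n) μ := fun n =>
    (((hdF.comp_aestronglyMeasurable (hvm n)).sub (hdF.comp_aestronglyMeasurable hum)).mul
      hηm).smul hDm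
  have m₃ : ∀ n, AEStronglyMeasurable (g₃ n) μ := fun n =>
    ((hF.continuous.comp_aestronglyMeasurable (hvm n)).sub
      (hF.continuous.comp_aestronglyMeasurable hum)).smul hdηm
  have t₁ : Tendsto (fun n => eLpNorm (g₁ n) (ENNReal.ofReal p) μ) atTop (𝓝 0) := by
    have h := ENNReal.Tendsto.const_mul (a := ENNReal.ofReal (M * C)) hvD
      (Or.inr ENNReal.ofReal_ne_top)
    rw [mul_zero] at h
    refine tendsto_of_tendsto_of_tendsto_of_le_of_le tendsto_const_nhds h (fun _ => zero_le)
      fun n => ?_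
    refine eLpNorm_le_mul_eLpNorm_of_ae_le_mul (Eventually.of_forall fun z => ?_) _
    rw [norm_smul, norm_mul]
    gcongr
    · exact hM' _
    · exact hC z
  have t₂ : Tendsto (fun n => eLpNorm (g₂ n) (ENNReal.ofReal p) μ) atTop (𝓝 0) := by
    refine tendsto_eLpNorm_zero_of_dominated hp0 m₂ (b := fun z => ((M + M) * C) * ‖D z‖)
      (hu.memLp_deriv.norm.const_mul _) (fun n => Eventually.of_forall fun z => ?_) ?_
    · rw [norm_smul, norm_mul]
      gcongr
      · exact (norm_sub_le _ _).trans (add_le_add (hM' _) (hM' _))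
      · exact hC z
    · filter_upwards [hvu] with z hz
      have h1 : Tendsto (fun n => deriv F (v n z) - deriv F (u z)) atTop (𝓝 0) := by
        have := ((hdF.tendsto _).comp hz).sub_const (deriv F (u z))
        rwa [sub_self] at this
      have := (h1.mul_const (η z)).smul_const (D z)
      simpa using this
  have t₃ : Tendsto (fun n => eLpNorm (g₃ n) (ENNReal.ofReal p) μ) atTop (𝓝 0) := by
    refine tendsto_eLpNorm_zero_of_dominated hp0 m₃ (b := fun z => (M + M) * C')
      (memLp_const _) (fun n => Eventually.of_forall fun z => ?_) ?_
    · rw [norm_smul]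
      gcongr
      · exact (norm_sub_le _ _).trans (add_le_add (hM _) (hM _))
      · exact hC' z
    · filter_upwards [hvu] with z hz
      have h1 : Tendsto (fun n => F (v n z) - F (u z)) atTop (𝓝 0) := by
        have := ((hF.continuous.tendsto _).comp hz).sub_const (F (u z))
        rwa [sub_self] at this
      have := h1.smul_const (spatialDeriv η z)
      simpa using this
  have t := (t₁.add t₂).add t₃
  simp only [add_zero] at t
  refine tendsto_of_tendsto_of_tendsto_of_le_of_le tendsto_const_nhds t (fun _ => zero_le)
    fun n => ?_
  have hsplit : (fun z => spatialDeriv (fun w => F (v n w) * η w) z - derivComp F η u D z) =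
      fun z => g₁ n z + g₂ n z + g₃ n z := by
    funext z
    rw [spatialDeriv_comp_mul hF hη (hv n)]
    ext ξ
    simp [derivComp, g₁, g₂, g₃]
    ring
  have hsupp : Function.support
      (fun z => spatialDeriv (fun w => F (v n w) * η w) z - derivComp F η u D z) ⊆ O := by
    intro z hz
    by_contra hcon
    refine hz ?_
    have hz' : z ∉ tsupport η := fun h => hcon (hηO h)
    simp only
    rw [spatialDeriv_comp_mul hF hη (hv n), derivComp_eq_zero hz', derivComp_eq_zero hz', sub_zero]
  rw [eLpNorm_eq_restrict_of_support_subset hsupp, hsplit]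
  exact eLpNorm_add_add_le hp1 (m₁ n) (m₂ n) (m₃ n)

end DoublyNonlinear

end

noncomputable section

namespace DoublyNonlinear

open scoped ENNReal

variable {N : ℕ}

variable {O : Set (SpaceTime N)} {p : ℝ} {r : ℝ≥0∞} {β : ℝ → ℝ} {u : SpaceTime N → ℝ}
  {D : SpaceTime N → EuclideanSpace ℝ (Fin N) →L[ℝ] ℝ} {a : SpaceTime N → EuclideanSpace ℝ (Fin N)}
  {F : ℝ → ℝ} {η : SpaceTime N → ℝ} {M : ℝ}

/-- The supersolution inequality for the forward time average of a test function `Φ`, whose spatial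
differential is close to `g` along small time shifts. -/
theorem timeAverage_inequality [ENNReal.HolderConjugate (ENNReal.ofReal p) r]
    (hu : IsLocalSupersolution O p r β u D a) (hr : 1 ≤ r)
    {Φ : SpaceTime N → ℝ} (hΦ : ContDiff ℝ 1 Φ) (hΦs : HasCompactSupport Φ) (hΦ0 : ∀ z, 0 ≤ Φ z)
    {h : ℝ} (h0 : 0 < h) {K : Set (SpaceTime N)} (hK : IsCompact K) (hΦK : ∀ z, z ∉ K → Φ z = 0)
    (hKO : Metric.cthickening h K ⊆ O)
    {g : SpaceTime N → EuclideanSpace ℝ (Fin N) →L[ℝ] ℝ} (hg : MemLp g (ENNReal.ofReal p) volume)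
    {ε : ℝ} (hε0 : 0 ≤ ε)
    (hε : ∀ σ ∈ Icc 0 h, eLpNorm (fun z => spatialDeriv Φ (z + timeShift N σ) - g z)
      (ENNReal.ofReal p) volume ≤ ENNReal.ofReal ε) :
    0 ≤ -(∫ z, O.indicator (fun z => β (u z)) z * (Φ (z + timeShift N h) - Φ z)) +
      h * ((∫ z, g z (O.indicator a z)) + ε * (eLpNorm (O.indicator a) r volume).toReal) := by
  have hOm := hu.isOpen.measurableSet
  have hfin : IsFiniteMeasure (volume.restrict O) :=
    ⟨by rw [Measure.restrict_apply_univ]; exact hu.volume_ne_top.lt_top⟩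
  set b := O.indicator (fun z => β (u z)) with hb
  set aO := O.indicator a with haO
  have hbi : Integrable b := hu.integrableOn.integrable_indicator hOm
  have haL : MemLp aO r volume := memLp_indicator_of_restrict hOm hu.memLp_flux
  have hai : Integrable aO := by
    have : IntegrableOn a O := hu.memLp_flux.integrable hr
    exact this.integrable_indicator hOm
  have hts : tsupport (timeAverage h Φ) ⊆ Metric.cthickening h K :=
    tsupport_timeAverage_subset h0.le hΦK
  have hcs : Continuous (timeShift N) := continuous_timeShift
  have hdΦ : Continuous (spatialDeriv Φ) := continuous_spatialDeriv hΦ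
  obtain ⟨C, hC0, hC⟩ := exists_bound_spatialDeriv hΦ hΦs
  obtain ⟨C', hC'0, hC'⟩ := exists_bound_of_hasCompactSupport hΦ.continuous hΦs
  have h1 := hu.supersolution (timeAverage h Φ) (contDiff_timeAverage hΦ hΦs h)
    (hK.cthickening.of_isClosed_subset (isClosed_tsupport _) hts) (hts.trans hKO)
    (timeAverage_nonneg h0.le hΦ0)
  rw [← integral_indicator hOm] at h1
  have h2 : ∀ z, O.indicator (fun z => -(β (u z)) * fderiv ℝ (timeAverage h Φ) z (0, 1) +
      spatialDeriv (timeAverage h Φ) z (a z)) z =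
      -(b z * (Φ (z + timeShift N h) - Φ z)) +
        ∫ σ in Ioc 0 h, spatialDeriv Φ (z + timeShift N σ) (aO z) := by
    intro z
    have h3 : ∫ σ in Ioc 0 h, spatialDeriv Φ (z + timeShift N σ) (aO z) =
        spatialDeriv (timeAverage h Φ) z (aO z) := by
      rw [spatialDeriv_apply, fderiv_timeAverage_apply hΦ hΦs, intervalIntegral.integral_of_le h0.le]
      rfl
    rw [h3]
    by_cases hz : z ∈ O
    · simp only [hb, haO, indicator_of_mem hz]
      rw [fderiv_timeAverage_time hΦ hΦs]
      ring
    · simp only [hb, haO, indicator_of_notMem hz]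
      simp
  simp_rw [h2] at h1
  have hprod : Integrable (fun w : SpaceTime N × ℝ =>
      spatialDeriv Φ (w.1 + timeShift N w.2) (aO w.1))
      ((volume : Measure (SpaceTime N)).prod (volume.restrict (Ioc 0 h))) := by
    have hi : Integrable (fun w : SpaceTime N × ℝ => ‖aO w.1‖ * C)
        ((volume : Measure (SpaceTime N)).prod (volume.restrict (Ioc 0 h))) :=
      hai.norm.mul_prod (integrable_const C)
    refine hi.mono' (aestronglyMeasurable_pairing ?_ ?_) (Eventually.of_forall fun w => ?_)
    · exact (hdΦ.comp (continuous_fst.add (hcs.comp continuous_snd))).aestronglyMeasurable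
    · exact hai.aestronglyMeasurable.comp_fst
    · rw [mul_comm]
      exact ((spatialDeriv Φ _).le_opNorm _).trans (by gcongr; exact hC _)
  have hi1 : Integrable (fun z => b z * (Φ (z + timeShift N h) - Φ z)) := by
    refine hbi.mul_bdd (c := C' + C') ?_ (Eventually.of_forall fun z => ?_)
    · exact ((hΦ.continuous.comp (continuous_id.add continuous_const)).sub
        hΦ.continuous).aestronglyMeasurable
    · exact (norm_sub_le _ _).trans (add_le_add (hC' _) (hC' _))
  rw [integral_add (f := fun z => -(b z * (Φ (z + timeShift N h) - Φ z)))
    (g := fun z => ∫ σ in Ioc 0 h, spatialDeriv Φ (z + timeShift N σ) (aO z))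
    hi1.neg hprod.integral_prod_left, integral_neg,
    integral_integral_swap (f := fun z σ => spatialDeriv Φ (z + timeShift N σ) (aO z)) hprod] at h1
  refine h1.trans (add_le_add_right ?_ _)
  have hslice : ∀ σ ∈ Icc 0 h, ∫ z, spatialDeriv Φ (z + timeShift N σ) (aO z) ≤
      (∫ z, g z (aO z)) + ε * (eLpNorm aO r volume).toReal := by
    intro σ hσ
    have hi2 : Integrable (fun z => g z (aO z)) := integrable_pairing hg haL
    have hm : AEStronglyMeasurable (fun z => spatialDeriv Φ (z + timeShift N σ)) volume :=
      (hdΦ.comp (continuous_id.add continuous_const)).aestronglyMeasurable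
    have hi3 : Integrable (fun z => spatialDeriv Φ (z + timeShift N σ) (aO z)) := by
      refine (hai.norm.const_mul C).mono' (aestronglyMeasurable_pairing hm hai.1)
        (Eventually.of_forall fun z => ?_)
      exact ((spatialDeriv Φ _).le_opNorm _).trans (by gcongr; exact hC _)
    have h4 : ∫ z, (spatialDeriv Φ (z + timeShift N σ) - g z) (aO z) =
        (∫ z, spatialDeriv Φ (z + timeShift N σ) (aO z)) - ∫ z, g z (aO z) := by
      rw [← integral_sub hi3 hi2]
      rfl
    have h5 := enorm_integral_pairing_le (r := ENNReal.ofReal p) (s := r) (hm.sub hg.1) haL.1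
    have h6 : ‖∫ z, (spatialDeriv Φ (z + timeShift N σ) - g z) (aO z)‖ₑ ≤
        ENNReal.ofReal ε * eLpNorm aO r volume := h5.trans (mul_le_mul_left (hε σ hσ) _)
    have h7 := ENNReal.toReal_mono (ENNReal.mul_ne_top ENNReal.ofReal_ne_top haL.2.ne) h6
    rw [ENNReal.toReal_mul, ENNReal.toReal_ofReal hε0, toReal_enorm, h4] at h7
    have := (le_abs_self _).trans h7
    linarith
  calc ∫ σ in Ioc 0 h, ∫ z, spatialDeriv Φ (z + timeShift N σ) (aO z)
      ≤ ∫ σ in Ioc 0 h, ((∫ z, g z (aO z)) + ε * (eLpNorm aO r volume).toReal) := by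
        refine setIntegral_mono_on hprod.integral_prod_right (integrable_const _)
          measurableSet_Ioc fun σ hσ => hslice σ ⟨hσ.1.le, hσ.2⟩
    _ = _ := by simp [h0.le]

theorem energy_inequality_timeShift [ENNReal.HolderConjugate (ENNReal.ofReal p) r] (hp : 1 ≤ p)
    (hu : IsLocalSupersolution O p r β u D a) (hr : 1 ≤ r)
    (hF : ContDiff ℝ 1 F) (hF0 : ∀ s, 0 ≤ F s) (hM : ∀ s, |F s| ≤ M) (hM' : ∀ s, |deriv F s| ≤ M)
    (hη : ContDiff ℝ 1 η) (hηs : HasCompactSupport η) (hη0 : ∀ z, 0 ≤ η z)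
    {h : ℝ} (h0 : 0 < h) (hKO : Metric.cthickening h (tsupport η) ⊆ O)
    {ε : ℝ} (hε0 : 0 ≤ ε)
    (hε : ∀ σ ∈ Icc 0 h, eLpNorm (fun z => derivComp F η u D (z + timeShift N σ) -
      derivComp F η u D z) (ENNReal.ofReal p) volume ≤ ENNReal.ofReal ε) :
    0 ≤ -(∫ z, O.indicator (fun z => β (u z)) z *
        (F (u (z + timeShift N h)) * η (z + timeShift N h) - F (u z) * η z)) +
      h * ((∫ z, derivComp F η u D z (O.indicator a z)) +
        ε * (eLpNorm (O.indicator a) r volume).toReal) := by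
  have hOm := hu.isOpen.measurableSet
  have hηO : tsupport η ⊆ O := (Metric.self_subset_cthickening _).trans hKO
  obtain ⟨v, hv, hvu, hvD⟩ := hu.approx
  have hbi : Integrable (O.indicator (fun z => β (u z))) :=
    hu.integrableOn.integrable_indicator hOm
  have hg := memLp_derivComp hu hF hM hM' hη hηs hηO
  have hlim := tendsto_eLpNorm_spatialDeriv_comp hp hu hF hM hM' hη hηs hηO hv hvu hvD
  obtain ⟨C, hC0, hC⟩ := exists_bound_of_hasCompactSupport hη.continuous hηs
  have hM0 : 0 ≤ M := (abs_nonneg _).trans (hM 0)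
  set A := (eLpNorm (O.indicator a) r volume).toReal with hA
  have hcs : Continuous (timeShift N) := continuous_timeShift
  -- the approximate inequality
  have happrox : ∀ δ : ℝ, 0 < δ → ∀ᶠ n in atTop,
      0 ≤ -(∫ z, O.indicator (fun z => β (u z)) z *
        (F (v n (z + timeShift N h)) * η (z + timeShift N h) - F (v n z) * η z)) +
      h * ((∫ z, derivComp F η u D z (O.indicator a z)) + (δ + ε) * A) := by
    intro δ hδ
    filter_upwards [(ENNReal.tendsto_nhds_zero.1 hlim) (ENNReal.ofReal δ) (by simpa using hδ)]
      with n hn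
    have hΦ : ContDiff ℝ 1 (fun w => F (v n w) * η w) := (hF.comp (hv n)).mul hη
    have hΦs : HasCompactSupport (fun w => F (v n w) * η w) := hηs.mul_left
    refine timeAverage_inequality hu hr hΦ hΦs (fun z => mul_nonneg (hF0 _) (hη0 _)) h0 hηs
      (fun z hz => by rw [image_eq_zero_of_notMem_tsupport hz, mul_zero]) hKO hg (by positivity) ?_
    intro σ hσ
    have hm : AEStronglyMeasurable (fun z => spatialDeriv (fun w => F (v n w) * η w) z -
        derivComp F η u D z) volume :=
      (continuous_spatialDeriv hΦ).aestronglyMeasurable.sub hg.1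
    have hmp := measurePreserving_add_right (volume : Measure (SpaceTime N)) (timeShift N σ)
    have h1 := eLpNorm_comp_measurePreserving (p := ENNReal.ofReal p) hm hmp
    have h2 := eLpNorm_add_le (hm.comp_measurePreserving hmp)
      ((hg.1.comp_measurePreserving hmp).sub hg.1) (p := ENNReal.ofReal p) (by simpa using hp)
    rw [h1] at h2
    have h3 : (fun z => spatialDeriv (fun w => F (v n w) * η w) (z + timeShift N σ) -
        derivComp F η u D z) = ((fun z => spatialDeriv (fun w => F (v n w) * η w) z -
        derivComp F η u D z) ∘ fun z => z + timeShift N σ) +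
        (derivComp F η u D ∘ (fun z => z + timeShift N σ) - derivComp F η u D) := by
      funext z; simp
    rw [h3, ENNReal.ofReal_add hδ.le hε0]
    exact h2.trans (add_le_add hn (hε σ hσ))
  have hconv : Tendsto (fun n => ∫ z, O.indicator (fun z => β (u z)) z *
        (F (v n (z + timeShift N h)) * η (z + timeShift N h) - F (v n z) * η z)) atTop
      (𝓝 (∫ z, O.indicator (fun z => β (u z)) z *
        (F (u (z + timeShift N h)) * η (z + timeShift N h) - F (u z) * η z))) := by
    have hpt : ∀ᵐ z : SpaceTime N, Tendsto (fun n => F (v n z) * η z) atTop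
        (𝓝 (F (u z) * η z)) := by
      filter_upwards [(ae_restrict_iff' hOm).1 hvu] with z hz
      by_cases hzO : z ∈ O
      · exact ((hF.continuous.tendsto _).comp (hz hzO)).mul_const _
      · have : η z = 0 := image_eq_zero_of_notMem_tsupport fun h => hzO (hηO h)
        simp [this]
    have hpt' : ∀ᵐ z : SpaceTime N, Tendsto
        (fun n => F (v n (z + timeShift N h)) * η (z + timeShift N h)) atTop
        (𝓝 (F (u (z + timeShift N h)) * η (z + timeShift N h))) :=
      (measurePreserving_add_right (volume : Measure (SpaceTime N))
        (timeShift N h)).quasiMeasurePreserving.ae hpt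
    refine tendsto_integral_of_dominated_convergence
      (fun z => ‖O.indicator (fun z => β (u z)) z‖ * (M * C + M * C)) (fun n => ?_)
      (hbi.norm.mul_const _) (fun n => Eventually.of_forall fun z => ?_) ?_
    · refine hbi.1.mul (Continuous.aestronglyMeasurable ?_)
      have hvc := (hv n).continuous
      have hFc := hF.continuous
      have hηc := hη.continuous
      fun_prop
    · have hb : ∀ w, ‖F (v n w) * η w‖ ≤ M * C := fun w => by
        rw [norm_mul]
        exact mul_le_mul (hM _) (hC _) (norm_nonneg _) hM0
      rw [norm_mul]
      gcongr
      exact (norm_sub_le _ _).trans (add_le_add (hb _) (hb _))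
    · filter_upwards [hpt, hpt'] with z h1 h2
      exact (h2.sub h1).const_mul _
  have hδ : ∀ δ : ℝ, 0 < δ → 0 ≤ -(∫ z, O.indicator (fun z => β (u z)) z *
        (F (u (z + timeShift N h)) * η (z + timeShift N h) - F (u z) * η z)) +
      h * ((∫ z, derivComp F η u D z (O.indicator a z)) + (δ + ε) * A) := fun δ hδ =>
    ge_of_tendsto (hconv.neg.add_const _) (happrox δ hδ)
  have hlim0 : Tendsto (fun δ : ℝ => -(∫ z, O.indicator (fun z => β (u z)) z *
        (F (u (z + timeShift N h)) * η (z + timeShift N h) - F (u z) * η z)) +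
      h * ((∫ z, derivComp F η u D z (O.indicator a z)) + (δ + ε) * A)) (𝓝[>] 0)
      (𝓝 (-(∫ z, O.indicator (fun z => β (u z)) z *
        (F (u (z + timeShift N h)) * η (z + timeShift N h) - F (u z) * η z)) +
      h * ((∫ z, derivComp F η u D z (O.indicator a z)) + (0 + ε) * A))) := by
    refine Tendsto.mono_left (Continuous.tendsto ?_ 0) nhdsWithin_le_nhds
    fun_prop
  rw [zero_add] at hlim0
  exact ge_of_tendsto hlim0 (by filter_upwards [self_mem_nhdsWithin] with δ h using hδ δ h)

/-- The energy inequality, obtained by testing the supersolution with `F(u) η`. -/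
theorem energy_inequality [ENNReal.HolderConjugate (ENNReal.ofReal p) r] (hp : 1 ≤ p)
    (hu : IsLocalSupersolution O p r β u D a) (hr : 1 ≤ r)
    (hF : ContDiff ℝ 1 F) (hF0 : ∀ s, 0 ≤ F s) (hM : ∀ s, |F s| ≤ M) (hM' : ∀ s, |deriv F s| ≤ M)
    {G : ℝ → ℝ} (hG : ∀ s t, (β t - β s) * F t ≤ G s - G t)
    (hGi : IntegrableOn (fun z => G (u z)) O)
    (hη : ContDiff ℝ 1 η) (hηs : HasCompactSupport η) (hηO : tsupport η ⊆ O)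
    (hη0 : ∀ z, 0 ≤ η z) :
    0 ≤ (∫ z in O, G (u z) * fderiv ℝ η z (0, 1)) + ∫ z in O, derivComp F η u D z (a z) := by
  have hOm := hu.isOpen.measurableSet
  obtain ⟨δ, hδ, hδO⟩ := hηs.isCompact.exists_cthickening_subset_open hu.isOpen hηO
  obtain ⟨C, hC0, hC⟩ := exists_bound_of_hasCompactSupport (hη.continuous_fderiv (by simp))
    (hηs.fderiv ℝ)
  obtain ⟨C', hC'0, hC'⟩ := exists_bound_of_hasCompactSupport hη.continuous hηs
  have hM0 : 0 ≤ M := (abs_nonneg _).trans (hM 0)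
  set b := O.indicator (fun z => β (u z)) with hb
  set γ := O.indicator (fun z => G (u z)) with hγ
  have hbi : Integrable b := hu.integrableOn.integrable_indicator hOm
  have hγi : Integrable γ := hGi.integrable_indicator hOm
  have hg := memLp_derivComp hu hF hM hM' hη hηs hηO
  set A := (eLpNorm (O.indicator a) r volume).toReal with hA
  have hI : ∫ z in O, derivComp F η u D z (a z) =
      ∫ z, derivComp F η u D z (O.indicator a z) := by
    rw [← integral_indicator hOm]
    refine integral_congr_ae (Eventually.of_forall fun z => ?_)
    by_cases hz : z ∈ O <;> simp [hz]
  have hI2 : ∫ z in O, G (u z) * fderiv ℝ η z (0, 1) = ∫ z, γ z * fderiv ℝ η z (0, 1) := by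
    rw [← integral_indicator hOm]
    refine integral_congr_ae (Eventually.of_forall fun z => ?_)
    by_cases hz : z ∈ O <;> simp [hγ, hz]
  rw [hI, hI2]
  set I := ∫ z, derivComp F η u D z (O.indicator a z) with hIdef
  have hΦm : AEStronglyMeasurable (fun z => F (u z) * η z) volume := by
    have h1 : AEStronglyMeasurable (O.indicator fun z => F (u z) * η z) volume :=
      (aestronglyMeasurable_indicator_iff hOm).2
        ((hF.continuous.comp_aestronglyMeasurable hu.aestronglyMeasurable).mul
          hη.continuous.aestronglyMeasurable)
    have h2 : (O.indicator fun z => F (u z) * η z) = fun z => F (u z) * η z := by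
      refine indicator_eq_self.2 fun z hz => ?_
      by_contra hcon
      exact hz (by simp [image_eq_zero_of_notMem_tsupport fun h => hcon (hηO h)])
    rwa [h2] at h1
  have hΦb : ∀ z, ‖F (u z) * η z‖ ≤ M * C' := fun w => by
    rw [norm_mul]
    exact mul_le_mul (hM _) (hC' _) (norm_nonneg _) hM0
  -- the inequality at a fixed small time shift
  have hstep : ∀ ε : ℝ, 0 < ε → ∀ᶠ h in 𝓝[>] (0 : ℝ),
      0 ≤ (∫ z, γ z * ((η (z + timeShift N h) - η z) / h)) + (I + ε * A) := by
    intro ε hε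
    have h1 := (ENNReal.tendsto_nhds_zero.1 (tendsto_eLpNorm_translate_sub (by simpa using hp)
      ENNReal.ofReal_ne_top hg)) (ENNReal.ofReal ε) (by simpa using hε)
    obtain ⟨δ', hδ', hball⟩ := Metric.eventually_nhds_iff.1 h1
    filter_upwards [Ioo_mem_nhdsGT (lt_min hδ hδ')] with h hh
    have h0 : 0 < h := hh.1
    have hhδ : h ≤ δ := hh.2.le.trans (min_le_left _ _)
    have hhδ' : h < δ' := hh.2.trans_le (min_le_right _ _)
    have hKO : Metric.cthickening h (tsupport η) ⊆ O :=
      (Metric.cthickening_mono hhδ _).trans hδO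
    have h2 := energy_inequality_timeShift hp hu hr hF hF0 hM hM' hη hηs hη0 h0 hKO hε.le
      (fun σ hσ => hball (by
        rw [dist_zero_right, norm_timeShift, abs_of_nonneg hσ.1]
        exact hσ.2.trans_lt hhδ'))
    have hmp := measurePreserving_add_right (volume : Measure (SpaceTime N)) (timeShift N h)
    have i1 : Integrable (fun z => b z * (F (u (z + timeShift N h)) * η (z + timeShift N h))) :=
      hbi.mul_bdd (c := M * C') (hΦm.comp_measurePreserving hmp)
        (Eventually.of_forall fun z => hΦb _)
    have i2 : Integrable (fun z => b z * (F (u z) * η z)) :=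
      hbi.mul_bdd (c := M * C') hΦm (Eventually.of_forall fun z => hΦb _)
    have i3 : Integrable (fun z => b (z + timeShift N h) *
        (F (u (z + timeShift N h)) * η (z + timeShift N h))) :=
      hmp.integrable_comp_of_integrable i2
    have i4 : Integrable (fun z => γ z * η z) :=
      hγi.mul_bdd (c := C') hη.continuous.aestronglyMeasurable (Eventually.of_forall fun z => hC' _)
    have i5 : Integrable (fun z => γ z * η (z + timeShift N h)) :=
      hγi.mul_bdd (c := C') (hη.continuous.aestronglyMeasurable.comp_measurePreserving hmp)
        (Eventually.of_forall fun z => hC' _)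
    have i6 : Integrable (fun z => γ (z + timeShift N h) * η (z + timeShift N h)) :=
      hmp.integrable_comp_of_integrable i4
    have e1 : -(∫ z, b z * (F (u (z + timeShift N h)) * η (z + timeShift N h) - F (u z) * η z)) =
        ∫ z, (b (z + timeShift N h) - b z) *
          (F (u (z + timeShift N h)) * η (z + timeShift N h)) := by
      simp_rw [mul_sub, sub_mul]
      rw [integral_sub i1 i2, integral_sub i3 i1,
        integral_add_right_eq_self (fun z => b z * (F (u z) * η z)) (timeShift N h)]
      ring
    have e2 : ∫ z, (γ z - γ (z + timeShift N h)) * η (z + timeShift N h) =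
        ∫ z, γ z * (η (z + timeShift N h) - η z) := by
      simp_rw [mul_sub, sub_mul]
      rw [integral_sub i5 i6, integral_sub i5 i4,
        integral_add_right_eq_self (fun z => γ z * η z) (timeShift N h)]
    have e3 : ∫ z, (b (z + timeShift N h) - b z) *
          (F (u (z + timeShift N h)) * η (z + timeShift N h)) ≤
        ∫ z, (γ z - γ (z + timeShift N h)) * η (z + timeShift N h) := by
      refine integral_mono ?_ ?_ fun z => ?_
      · simp_rw [sub_mul]; exact i3.sub i1
      · simp_rw [sub_mul]; exact i5.sub i6
      · by_cases hz : z + timeShift N h ∈ tsupport η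
        · have hz1 : z + timeShift N h ∈ O := hηO hz
          have hz2 : z ∈ O := by
            refine hKO (Metric.mem_cthickening_of_dist_le z _ h _ hz ?_)
            rw [dist_self_add_right, norm_timeShift, abs_of_pos h0]
          simp only [hb, hγ, indicator_of_mem hz1, indicator_of_mem hz2]
          rw [← mul_assoc]
          exact mul_le_mul_of_nonneg_right (hG _ _) (hη0 _)
        · simp [image_eq_zero_of_notMem_tsupport hz]
    have h3 : 0 ≤ (∫ z, γ z * (η (z + timeShift N h) - η z)) + h * (I + ε * A) := by
      rw [← e2]
      rw [e1] at h2
      linarith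
    have e4 : ∫ z, γ z * ((η (z + timeShift N h) - η z) / h) =
        (∫ z, γ z * (η (z + timeShift N h) - η z)) / h := by
      rw [← integral_div]
      simp_rw [mul_div_assoc]
    rw [e4]
    have h4 := div_nonneg h3 h0.le
    rwa [add_div, mul_div_cancel_left₀ _ h0.ne'] at h4
  have hconv : Tendsto (fun h : ℝ => ∫ z, γ z * ((η (z + timeShift N h) - η z) / h)) (𝓝[>] 0)
      (𝓝 (∫ z, γ z * fderiv ℝ η z (0, 1))) := by
    refine tendsto_integral_filter_of_dominated_convergence (fun z => ‖γ z‖ * C) ?_ ?_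
      (hγi.norm.mul_const _) (Eventually.of_forall fun z => ?_)
    · refine Eventually.of_forall fun h => hγi.1.mul (Continuous.aestronglyMeasurable ?_)
      have hηc := hη.continuous
      fun_prop
    · filter_upwards [self_mem_nhdsWithin] with h hh
      refine Eventually.of_forall fun z => ?_
      rw [norm_mul]
      gcongr
      have h1 := Convex.norm_image_sub_le_of_norm_fderiv_le (𝕜 := ℝ) (f := η) (s := univ) (C := C)
        (fun x _ => hη.differentiable (by simp) x) (fun x _ => hC x) convex_univ
        (mem_univ z) (mem_univ (z + timeShift N h))
      rw [add_sub_cancel_left, norm_timeShift] at h1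
      rw [norm_div, Real.norm_eq_abs h]
      have : 0 < |h| := abs_pos.2 (ne_of_gt hh)
      rwa [div_le_iff₀ this]
    · refine Tendsto.const_mul _ ?_
      have h1 : HasFDerivAt η (fderiv ℝ η z) z := (hη.differentiable (by simp) z).hasFDerivAt
      have h2 : HasDerivAt (fun h : ℝ => z + timeShift N h) (0, 1) 0 := by
        have : HasDerivAt (timeShift N) (0, 1) 0 :=
          (hasDerivAt_const 0 (0 : EuclideanSpace ℝ (Fin N))).prodMk (hasDerivAt_id 0)
        exact this.const_add z
      have h3 : HasDerivAt (fun h : ℝ => η (z + timeShift N h)) (fderiv ℝ η z (0, 1)) 0 := by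
        refine HasFDerivAt.comp_hasDerivAt (0 : ℝ) ?_ h2
        rwa [show timeShift N 0 = 0 from rfl, add_zero]
      have h4 := h3.tendsto_slope_zero_right
      refine h4.congr fun h => ?_
      rw [zero_add, show timeShift N 0 = 0 from rfl, add_zero, smul_eq_mul, div_eq_inv_mul]
  have hε : ∀ ε : ℝ, 0 < ε → 0 ≤ (∫ z, γ z * fderiv ℝ η z (0, 1)) + (I + ε * A) := fun ε hε =>
    ge_of_tendsto (hconv.add_const _) (hstep ε hε)
  have hlim0 : Tendsto (fun ε : ℝ => (∫ z, γ z * fderiv ℝ η z (0, 1)) + (I + ε * A)) (𝓝[>] 0)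
      (𝓝 ((∫ z, γ z * fderiv ℝ η z (0, 1)) + (I + 0 * A))) := by
    refine Tendsto.mono_left (Continuous.tendsto ?_ 0) nhdsWithin_le_nhds
    fun_prop
  rw [zero_mul, add_zero] at hlim0
  exact ge_of_tendsto hlim0 (by filter_upwards [self_mem_nhdsWithin] with ε h using hε ε h)

end DoublyNonlinear

end

noncomputable section

namespace DoublyNonlinear

open scoped ENNReal

variable {N : ℕ}

/-- The space shift by `y`. -/
abbrev spaceShift (y : EuclideanSpace ℝ (Fin N)) : SpaceTime N := (y, 0)

theorem volume_restrict_univ_prod (I : Set ℝ) :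
    (volume : Measure (SpaceTime N)).restrict (univ ×ˢ I) =
      (volume : Measure (EuclideanSpace ℝ (Fin N))).prod (volume.restrict I) := by
  rw [Measure.volume_eq_prod, ← Measure.prod_restrict, Measure.restrict_univ]

theorem measurePreserving_spaceShift {I : Set ℝ} (hI : MeasurableSet I)
    (y : EuclideanSpace ℝ (Fin N)) :
    MeasurePreserving (fun z : SpaceTime N => z + spaceShift y)
      (volume.restrict (univ ×ˢ I)) (volume.restrict (univ ×ˢ I)) := by
  have h := (measurePreserving_add_right (volume : Measure (SpaceTime N))
    (spaceShift y)).restrict_preimage (MeasurableSet.univ.prod hI)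
  have h2 : (fun z : SpaceTime N => z + spaceShift y) ⁻¹' (univ ×ˢ I) = univ ×ˢ I := by
    ext z; simp
  rwa [h2] at h

/-- A function vanishing off `S`, whose time slices have small measure, is controlled by its
spatial increments. -/
theorem lintegral_le_of_slice_le {I : Set ℝ} {v : SpaceTime N → ℝ≥0∞}
    (hv : Measurable v) {S : Set (SpaceTime N)} (hS : MeasurableSet S)
    (hvS : ∀ z, z ∉ S → v z = 0) {σ : ℝ≥0∞}
    (hσ : ∀ᵐ t ∂volume.restrict I, volume {x : EuclideanSpace ℝ (Fin N) | (x, t) ∈ S} ≤ σ)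
    {ρ : ℝ} (hρ : 0 < ρ)
    (hρσ : 2 * σ ≤ volume (Metric.ball (0 : EuclideanSpace ℝ (Fin N)) ρ)) {d : ℝ≥0∞}
    (hd : ∀ y ∈ Metric.ball (0 : EuclideanSpace ℝ (Fin N)) ρ,
      ∫⁻ z in univ ×ˢ I, (v z - v (z + spaceShift y)) ≤ d)
    (hfin : ∫⁻ z in univ ×ˢ I, v z ≠ ∞) :
    ∫⁻ z in univ ×ˢ I, v z ≤ 2 * d := by
  set ν := (volume : Measure (SpaceTime N)).restrict (univ ×ˢ I) with hν
  set B := Metric.ball (0 : EuclideanSpace ℝ (Fin N)) ρ with hB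
  set m := ∫⁻ z, v z ∂ν with hm
  have hB0 : volume B ≠ 0 := (Metric.measure_ball_pos volume 0 hρ).ne'
  have hBt : volume B ≠ ∞ := measure_ball_lt_top.ne
  have hshift : Measurable fun w : SpaceTime N × EuclideanSpace ℝ (Fin N) =>
      w.1 + spaceShift w.2 := by
    unfold spaceShift; fun_prop
  have hvs : ∀ y, Measurable fun z : SpaceTime N => v (z + spaceShift y) := fun y =>
    hv.comp (measurable_id.add_const _)
  have h1 : ∀ y ∈ B, m ≤ d + ∫⁻ z, S.indicator (fun z => v (z + spaceShift y)) z ∂ν := by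
    intro y hy
    calc m ≤ ∫⁻ z, ((v z - v (z + spaceShift y)) +
          S.indicator (fun z => v (z + spaceShift y)) z) ∂ν := by
          refine lintegral_mono fun z => ?_
          by_cases hz : z ∈ S
          · rw [indicator_of_mem hz]; exact le_tsub_add
          · rw [hvS z hz]; exact zero_le
      _ = (∫⁻ z, (v z - v (z + spaceShift y)) ∂ν) +
          ∫⁻ z, S.indicator (fun z => v (z + spaceShift y)) z ∂ν :=
          lintegral_add_left (hv.sub (hvs y)) _
      _ ≤ _ := add_le_add_left (hd y hy) _
  have h2 : volume B * m ≤ volume B * d +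
      ∫⁻ y in B, ∫⁻ z, S.indicator (fun z => v (z + spaceShift y)) z ∂ν := by
    calc volume B * m = ∫⁻ _ in B, m := by rw [setLIntegral_const, mul_comm]
      _ ≤ ∫⁻ y in B, (d + ∫⁻ z, S.indicator (fun z => v (z + spaceShift y)) z ∂ν) :=
          setLIntegral_mono' measurableSet_ball h1
      _ = _ := by rw [lintegral_add_left measurable_const, setLIntegral_const, mul_comm]
  have hmeas2 : Measurable fun w : EuclideanSpace ℝ (Fin N) × SpaceTime N =>
      S.indicator (fun z => v (z + spaceShift w.1)) w.2 := by
    have e : (fun w : EuclideanSpace ℝ (Fin N) × SpaceTime N =>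
        S.indicator (fun z => v (z + spaceShift w.1)) w.2) =
        (Prod.snd ⁻¹' S).indicator (fun w => v (w.2 + spaceShift w.1)) := by
      funext w; by_cases hw : w.2 ∈ S <;> simp [hw]
    rw [e]
    exact (hv.comp (hshift.comp measurable_swap)).indicator (measurable_snd hS)
  have hslice : Measurable fun t => ∫⁻ x : EuclideanSpace ℝ (Fin N), v (x, t) :=
    (hv.comp measurable_swap).lintegral_prod_right'
  have hmf : m = ∫⁻ t in I, ∫⁻ x : EuclideanSpace ℝ (Fin N), v (x, t) := by
    rw [hm, hν, volume_restrict_univ_prod, lintegral_prod_symm' _ hv]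
  have h3 : ∫⁻ y in B, ∫⁻ z, S.indicator (fun z => v (z + spaceShift y)) z ∂ν ≤ σ * m := by
    rw [lintegral_lintegral_swap hmeas2.aemeasurable]
    have h4 : ∀ z : SpaceTime N, ∫⁻ y in B, S.indicator (fun z => v (z + spaceShift y)) z ≤
        S.indicator (fun z => ∫⁻ x : EuclideanSpace ℝ (Fin N), v (x, z.2)) z := by
      intro z
      by_cases hz : z ∈ S
      · simp only [indicator_of_mem hz]
        refine (setLIntegral_le_lintegral _ _).trans (le_of_eq ?_)
        have := lintegral_add_left_eq_self (μ := volume)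
          (fun x : EuclideanSpace ℝ (Fin N) => v (x, z.2)) z.1
        rw [← this]
        refine lintegral_congr fun y => ?_
        congr 1
        simp [spaceShift, Prod.ext_iff]
      · simp [indicator_of_notMem hz]
    refine (lintegral_mono h4).trans ?_
    have hm5 : Measurable (S.indicator
        (fun z : SpaceTime N => ∫⁻ x : EuclideanSpace ℝ (Fin N), v (x, z.2))) :=
      (hslice.comp measurable_snd).indicator hS
    rw [hν, volume_restrict_univ_prod, lintegral_prod_symm' _ hm5, hmf,
      ← lintegral_const_mul _ hslice]
    refine lintegral_mono_ae ?_
    filter_upwards [hσ] with t ht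
    have e : (fun x : EuclideanSpace ℝ (Fin N) => S.indicator
        (fun z : SpaceTime N => ∫⁻ x : EuclideanSpace ℝ (Fin N), v (x, z.2)) (x, t)) =
        {x | (x, t) ∈ S}.indicator fun _ => ∫⁻ x : EuclideanSpace ℝ (Fin N), v (x, t) := by
      funext x
      by_cases hx : (x, t) ∈ S <;> simp [hx]
    have hms : MeasurableSet {x : EuclideanSpace ℝ (Fin N) | (x, t) ∈ S} :=
      measurable_prodMk_right hS
    rw [e, lintegral_indicator_const hms, mul_comm]
    exact mul_le_mul_left ht _
  have h5 : volume B * m ≤ volume B * (d + m / 2) := by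
    refine h2.trans ?_
    rw [mul_add]
    refine add_le_add_right (h3.trans ?_) _
    calc σ * m = (2 * σ) * (m / 2) := by
          rw [mul_comm 2 σ, mul_assoc, ENNReal.mul_div_cancel (by simp) (by simp)]
      _ ≤ _ := mul_le_mul_left hρσ _
  have h6 : m ≤ d + m / 2 := (ENNReal.mul_le_mul_iff_right hB0 hBt).1 h5
  have hm2 : m / 2 ≠ ∞ := ENNReal.div_ne_top hfin (by simp)
  have h7 : m / 2 ≤ d := by
    have : m / 2 + m / 2 ≤ d + m / 2 := by rwa [ENNReal.add_halves]
    exact (ENNReal.add_le_add_iff_right hm2).1 this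
  calc m = 2 * (m / 2) := (ENNReal.mul_div_cancel (by simp) (by simp)).symm
    _ ≤ 2 * d := mul_le_mul_right h7 _

/-- Spatial increments of `C¹` functions are controlled by the spatial differential. -/
theorem lintegral_enorm_increment_le {Φ : SpaceTime N → ℝ} (hΦ : ContDiff ℝ 1 Φ) {I : Set ℝ}
    (hI : MeasurableSet I) (y : EuclideanSpace ℝ (Fin N)) :
    ∫⁻ z in univ ×ˢ I, ‖Φ (z + spaceShift y) - Φ z‖ₑ ≤
      ‖y‖ₑ * ∫⁻ z in univ ×ˢ I, ‖spatialDeriv Φ z‖ₑ := by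
  set ν := (volume : Measure (SpaceTime N)).restrict (univ ×ˢ I) with hν
  have hdc : Continuous (spatialDeriv Φ) := continuous_spatialDeriv hΦ
  have hline : Continuous fun w : SpaceTime N × ℝ => w.1 + spaceShift (w.2 • y) := by
    unfold spaceShift; fun_prop
  have h1 : ∀ z, ‖Φ (z + spaceShift y) - Φ z‖ₑ ≤
      ∫⁻ s in Ioc (0 : ℝ) 1, ‖y‖ₑ * ‖spatialDeriv Φ (z + spaceShift (s • y))‖ₑ := by
    intro z
    have hd : ∀ s : ℝ, HasDerivAt (fun s : ℝ => Φ (z + spaceShift (s • y)))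
        (spatialDeriv Φ (z + spaceShift (s • y)) y) s := by
      intro s
      have h2 : HasFDerivAt Φ (fderiv ℝ Φ (z + spaceShift (s • y))) (z + spaceShift (s • y)) :=
        (hΦ.differentiable (by simp) _).hasFDerivAt
      refine h2.comp_hasDerivAt s (f' := (y, 0)) ?_
      have h3 : HasDerivAt (fun s : ℝ => s • y) y s := by
        simpa using (hasDerivAt_id s).smul_const y
      exact (h3.prodMk (hasDerivAt_const s (0 : ℝ))).const_add z
    have hcl : Continuous fun s : ℝ => spatialDeriv Φ (z + spaceShift (s • y)) y :=
      (hdc.comp (hline.comp (by fun_prop : Continuous fun s : ℝ => (z, s)))).clm_apply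
        continuous_const
    have h4 := intervalIntegral.integral_eq_sub_of_hasDerivAt (a := 0) (b := 1)
      (fun s _ => hd s) (hcl.intervalIntegrable _ _)
    simp only [one_smul, zero_smul] at h4
    rw [show spaceShift (0 : EuclideanSpace ℝ (Fin N)) = 0 from rfl, add_zero] at h4
    rw [← h4, intervalIntegral.integral_of_le zero_le_one]
    refine (enorm_integral_le_lintegral_enorm _).trans (lintegral_mono fun s => ?_)
    rw [mul_comm]
    exact (spatialDeriv Φ _).le_opENorm y
  calc ∫⁻ z, ‖Φ (z + spaceShift y) - Φ z‖ₑ ∂ν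
      ≤ ∫⁻ z, (∫⁻ s in Ioc (0 : ℝ) 1, ‖y‖ₑ * ‖spatialDeriv Φ (z + spaceShift (s • y))‖ₑ) ∂ν :=
        lintegral_mono h1
    _ = ∫⁻ s in Ioc (0 : ℝ) 1, ∫⁻ z, ‖y‖ₑ * ‖spatialDeriv Φ (z + spaceShift (s • y))‖ₑ ∂ν := by
        refine lintegral_lintegral_swap (Measurable.aemeasurable ?_)
        exact measurable_const.mul (hdc.comp hline).enorm.measurable
    _ = ∫⁻ s in Ioc (0 : ℝ) 1, ‖y‖ₑ * ∫⁻ z, ‖spatialDeriv Φ z‖ₑ ∂ν := by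
        refine lintegral_congr fun s => ?_
        rw [lintegral_const_mul]
        · congr 1
          exact (measurePreserving_spaceShift hI (s • y)).lintegral_comp hdc.enorm.measurable
        · exact (hdc.comp (continuous_id.add continuous_const)).enorm.measurable
    _ = _ := by simp

variable {O : Set (SpaceTime N)} {p : ℝ} {r : ℝ≥0∞} {β : ℝ → ℝ} {u : SpaceTime N → ℝ}
  {D : SpaceTime N → EuclideanSpace ℝ (Fin N) →L[ℝ] ℝ} {a : SpaceTime N → EuclideanSpace ℝ (Fin N)}
  {F : ℝ → ℝ} {η : SpaceTime N → ℝ} {M : ℝ}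

/-- Spatial increments of `F(u) η` are controlled by its spatial differential. -/
theorem lintegral_enorm_increment_comp_le (hp : 1 ≤ p) (hu : IsLocalSupersolution O p r β u D a)
    (hF : ContDiff ℝ 1 F) (hM : ∀ s, |F s| ≤ M) (hM' : ∀ s, |deriv F s| ≤ M)
    (hη : ContDiff ℝ 1 η) (hηs : HasCompactSupport η) (hηO : tsupport η ⊆ O)
    {I : Set ℝ} (hI : MeasurableSet I) (y : EuclideanSpace ℝ (Fin N)) :
    ∫⁻ z in univ ×ˢ I, ‖F (u (z + spaceShift y)) * η (z + spaceShift y) - F (u z) * η z‖ₑ ≤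
      ‖y‖ₑ * ∫⁻ z in univ ×ˢ I, ‖derivComp F η u D z‖ₑ := by
  have hOm := hu.isOpen.measurableSet
  have hfin : IsFiniteMeasure (volume.restrict O) :=
    ⟨by rw [Measure.restrict_apply_univ]; exact hu.volume_ne_top.lt_top⟩
  obtain ⟨v, hv, hvu, hvD⟩ := hu.approx
  have hg := memLp_derivComp hu hF hM hM' hη hηs hηO
  have hlim := tendsto_eLpNorm_spatialDeriv_comp hp hu hF hM hM' hη hηs hηO hv hvu hvD
  have hΦ : ∀ n, ContDiff ℝ 1 (fun w => F (v n w) * η w) := fun n => (hF.comp (hv n)).mul hη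
  set ν := (volume : Measure (SpaceTime N)).restrict (univ ×ˢ I) with hν
  have hpt : ∀ᵐ z : SpaceTime N, Tendsto (fun n => F (v n z) * η z) atTop
      (𝓝 (F (u z) * η z)) := by
    filter_upwards [(ae_restrict_iff' hOm).1 hvu] with z hz
    by_cases hzO : z ∈ O
    · exact ((hF.continuous.tendsto _).comp (hz hzO)).mul_const _
    · have : η z = 0 := image_eq_zero_of_notMem_tsupport fun h => hzO (hηO h)
      simp [this]
  have hpt' : ∀ᵐ z : SpaceTime N, Tendsto
      (fun n => F (v n (z + spaceShift y)) * η (z + spaceShift y)) atTop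
      (𝓝 (F (u (z + spaceShift y)) * η (z + spaceShift y))) :=
    (measurePreserving_add_right (volume : Measure (SpaceTime N))
      (spaceShift y)).quasiMeasurePreserving.ae hpt
  set e : ℕ → ℝ≥0∞ := fun n => eLpNorm (fun z => spatialDeriv (fun w => F (v n w) * η w) z -
      derivComp F η u D z) (ENNReal.ofReal p) volume with he
  set c : ℝ≥0∞ := volume.restrict O univ ^ (1 / (1 : ℝ≥0∞).toReal - 1 / (ENNReal.ofReal p).toReal)
    with hc
  have hc_top : c ≠ ∞ := by
    refine ENNReal.rpow_ne_top_of_nonneg ?_ (measure_ne_top _ _)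
    rw [ENNReal.toReal_ofReal (by linarith), ENNReal.toReal_one, div_one, sub_nonneg,
      div_le_one (by linarith)]
    exact hp
  have h1 : ∀ n, ∫⁻ z, ‖spatialDeriv (fun w => F (v n w) * η w) z‖ₑ ∂ν ≤
      (∫⁻ z, ‖derivComp F η u D z‖ₑ ∂ν) + e n * c := by
    intro n
    have hm : AEStronglyMeasurable (fun z => spatialDeriv (fun w => F (v n w) * η w) z -
        derivComp F η u D z) volume :=
      (continuous_spatialDeriv (hΦ n)).aestronglyMeasurable.sub hg.1
    have hsupp : Function.support
        (fun z => spatialDeriv (fun w => F (v n w) * η w) z - derivComp F η u D z) ⊆ O := by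
      intro z hz
      by_contra hcon
      refine hz ?_
      have hz' : z ∉ tsupport η := fun h => hcon (hηO h)
      simp only
      rw [spatialDeriv_comp_mul hF hη (hv n), derivComp_eq_zero hz', derivComp_eq_zero hz', sub_zero]
    calc ∫⁻ z, ‖spatialDeriv (fun w => F (v n w) * η w) z‖ₑ ∂ν
        ≤ ∫⁻ z, (‖derivComp F η u D z‖ₑ + ‖spatialDeriv (fun w => F (v n w) * η w) z -
          derivComp F η u D z‖ₑ) ∂ν := by
          refine lintegral_mono fun z => ?_
          have := enorm_add_le (derivComp F η u D z)
            (spatialDeriv (fun w => F (v n w) * η w) z - derivComp F η u D z)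
          rwa [add_sub_cancel] at this
      _ = (∫⁻ z, ‖derivComp F η u D z‖ₑ ∂ν) + ∫⁻ z, ‖spatialDeriv (fun w => F (v n w) * η w) z -
          derivComp F η u D z‖ₑ ∂ν := lintegral_add_left' hg.1.restrict.enorm _
      _ ≤ _ := by
          refine add_le_add_right ?_ _
          calc ∫⁻ z, ‖spatialDeriv (fun w => F (v n w) * η w) z - derivComp F η u D z‖ₑ ∂ν
              ≤ ∫⁻ z, ‖spatialDeriv (fun w => F (v n w) * η w) z - derivComp F η u D z‖ₑ :=
                setLIntegral_le_lintegral _ _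
            _ = eLpNorm (fun z => spatialDeriv (fun w => F (v n w) * η w) z -
                  derivComp F η u D z) 1 (volume.restrict O) := by
                rw [← eLpNorm_eq_restrict_of_support_subset hsupp, eLpNorm_one_eq_lintegral_enorm]
            _ ≤ eLpNorm (fun z => spatialDeriv (fun w => F (v n w) * η w) z -
                  derivComp F η u D z) (ENNReal.ofReal p) (volume.restrict O) * c :=
                eLpNorm_le_eLpNorm_mul_rpow_measure_univ (by simpa using hp) hm.restrict
            _ = e n * c := by rw [he, ← eLpNorm_eq_restrict_of_support_subset hsupp]
  have h2 : Tendsto (fun n => ‖y‖ₑ * ((∫⁻ z, ‖derivComp F η u D z‖ₑ ∂ν) + e n * c)) atTop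
      (𝓝 (‖y‖ₑ * ((∫⁻ z, ‖derivComp F η u D z‖ₑ ∂ν) + 0 * c))) := by
    refine ENNReal.Tendsto.const_mul ?_ (Or.inr enorm_ne_top)
    exact tendsto_const_nhds.add (ENNReal.Tendsto.mul_const hlim (Or.inr hc_top))
  rw [zero_mul, add_zero] at h2
  calc ∫⁻ z, ‖F (u (z + spaceShift y)) * η (z + spaceShift y) - F (u z) * η z‖ₑ ∂ν
      = ∫⁻ z, liminf (fun n => ‖F (v n (z + spaceShift y)) * η (z + spaceShift y) -
          F (v n z) * η z‖ₑ) atTop ∂ν := by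
        refine lintegral_congr_ae (ae_restrict_of_ae ?_)
        filter_upwards [hpt, hpt'] with z h1 h2
        exact (h2.sub h1).enorm.liminf_eq.symm
    _ ≤ liminf (fun n => ∫⁻ z, ‖F (v n (z + spaceShift y)) * η (z + spaceShift y) -
          F (v n z) * η z‖ₑ ∂ν) atTop := by
        refine lintegral_liminf_le fun n => Continuous.measurable ?_
        have := (hΦ n).continuous
        exact ((this.comp (continuous_id.add continuous_const)).sub this).enorm
    _ ≤ liminf (fun n => ‖y‖ₑ * ((∫⁻ z, ‖derivComp F η u D z‖ₑ ∂ν) + e n * c)) atTop := by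
        refine liminf_le_liminf (Eventually.of_forall fun n => ?_)
        exact (lintegral_enorm_increment_le (hΦ n) hI y).trans (mul_le_mul_right (h1 n) _)
    _ = _ := h2.liminf_eq

end DoublyNonlinear

end

noncomputable section

namespace DoublyNonlinear

section SignedPow

/-- The signed power `|s|^(q-1) s`. -/
def signedPow (q s : ℝ) : ℝ := |s| ^ (q - 1) * s

variable {q : ℝ}

theorem signedPow_of_nonneg (hq : 0 < q) {s : ℝ} (hs : 0 ≤ s) : signedPow q s = s ^ q := by
  rcases hs.eq_or_lt with rfl | hs
  · simp [signedPow, Real.zero_rpow hq.ne']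
  · rw [signedPow, abs_of_pos hs, Real.rpow_sub_one hs.ne', div_mul_cancel₀ _ hs.ne']

theorem signedPow_neg (s : ℝ) : signedPow q (-s) = -signedPow q s := by
  simp [signedPow]

theorem signedPow_eq (hq : 0 < q) (s : ℝ) :
    signedPow q s = (max s 0) ^ q - (max (-s) 0) ^ q := by
  rcases le_total 0 s with hs | hs
  · rw [signedPow_of_nonneg hq hs, max_eq_left hs, max_eq_right (by linarith),
      Real.zero_rpow hq.ne', sub_zero]
  · rw [max_eq_right hs, max_eq_left (by linarith), Real.zero_rpow hq.ne', zero_sub,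
      ← signedPow_of_nonneg hq (by linarith), signedPow_neg, neg_neg]

theorem continuous_signedPow (hq : 0 < q) : Continuous (signedPow q) := by
  have h := Real.continuous_rpow_const hq.le
  have : signedPow q = fun s => (max s 0) ^ q - (max (-s) 0) ^ q := funext (signedPow_eq hq)
  rw [this]
  exact (h.comp (by fun_prop)).sub (h.comp (by fun_prop))

theorem monotone_signedPow (hq : 0 < q) : Monotone (signedPow q) := by
  intro s t hst
  rw [signedPow_eq hq, signedPow_eq hq]
  have h1 : (max s 0) ^ q ≤ (max t 0) ^ q :=
    Real.rpow_le_rpow (le_max_right _ _) (max_le_max_right _ hst) hq.le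
  have h2 : (max (-t) 0) ^ q ≤ (max (-s) 0) ^ q :=
    Real.rpow_le_rpow (le_max_right _ _) (max_le_max_right _ (neg_le_neg hst)) hq.le
  linarith

theorem abs_signedPow (hq : 0 < q) (s : ℝ) : |signedPow q s| = |s| ^ q := by
  rw [signedPow, abs_mul, abs_of_nonneg (Real.rpow_nonneg (abs_nonneg s) _)]
  have := signedPow_of_nonneg hq (abs_nonneg s)
  rwa [signedPow, abs_abs] at this

theorem rpow_sub_rpow_ge (hq : 0 < q) {M b d : ℝ} (hd : 0 < d) (hdb : d ≤ b) (hbM : b ≤ M) :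
    min 1 q / M * d ^ (q + 1) ≤ b ^ q - (b - d) ^ q := by
  have hb : 0 < b := hd.trans_le hdb
  have hM : 0 < M := hb.trans_le hbM
  have hm : 0 < min 1 q := lt_min one_pos hq
  have hx1 : d / b ≤ 1 := (div_le_one hb).2 hdb
  have hx0 : 0 ≤ d / b := by positivity
  have key : (1 - d / b) ^ q ≤ 1 - min 1 q * (d / b) := by
    rcases le_total 1 q with h1 | h1
    · rw [min_eq_left h1, one_mul]
      calc (1 - d / b) ^ q ≤ (1 - d / b) ^ (1 : ℝ) :=
            Real.rpow_le_rpow_of_exponent_ge' (by linarith) (by linarith) zero_le_one h1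
        _ = _ := Real.rpow_one _
    · rw [min_eq_right h1]
      have := rpow_one_add_le_one_add_mul_self (s := -(d / b)) (by linarith) hq.le h1
      calc (1 - d / b) ^ q = (1 + -(d / b)) ^ q := by ring_nf
        _ ≤ 1 + q * -(d / b) := this
        _ = _ := by ring
  have e : (b - d) ^ q = b ^ q * (1 - d / b) ^ q := by
    rw [← Real.mul_rpow hb.le (by linarith)]
    congr 1
    field_simp
  have hbq : d ^ q ≤ b ^ q := Real.rpow_le_rpow hd.le hdb hq.le
  calc min 1 q / M * d ^ (q + 1) = min 1 q * (d ^ q * (d / M)) := by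
        rw [Real.rpow_add_one hd.ne']; ring
    _ ≤ min 1 q * (b ^ q * (d / b)) := by gcongr
    _ = b ^ q - b ^ q * (1 - min 1 q * (d / b)) := by ring
    _ ≤ b ^ q - (b - d) ^ q := by
        rw [e]
        have := mul_le_mul_of_nonneg_left key (Real.rpow_nonneg hb.le q)
        linarith

/-- A quantitative form of strict monotonicity. -/
theorem signedPow_sub_ge (hq : 0 < q) {M a b : ℝ} (hab : a < b) (ha : -M ≤ a) (hb : b ≤ M) :
    min 1 q / M * ((b - a) / 2) ^ (q + 1) ≤ signedPow q b - signedPow q a := by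
  set d := (b - a) / 2 with hd
  have hd0 : 0 < d := by rw [hd]; linarith
  rcases le_total d b with h | h
  · have h1 := rpow_sub_rpow_ge hq hd0 h hb
    have h2 := monotone_signedPow hq (show a ≤ b - d by rw [hd]; linarith)
    rw [← signedPow_of_nonneg hq (hd0.le.trans h), ← signedPow_of_nonneg hq (sub_nonneg.2 h)] at h1
    linarith
  · have h' : d ≤ -a := by linarith
    have h1 := rpow_sub_rpow_ge (M := M) hq hd0 h' (by linarith)
    have h2 := monotone_signedPow hq (show a + d ≤ b by rw [hd]; linarith)
    rw [← signedPow_of_nonneg hq (hd0.le.trans h'), ← signedPow_of_nonneg hq (sub_nonneg.2 h'),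
      signedPow_neg, show -a - d = -(a + d) by ring, signedPow_neg] at h1
    linarith

end SignedPow

section TruncTest

theorem hasDerivAt_sq_max_zero (x : ℝ) :
    HasDerivAt (fun w : ℝ => (max w 0) ^ 2) (2 * max x 0) x := by
  rcases lt_trichotomy x 0 with hx | rfl | hx
  · rw [max_eq_right hx.le, mul_zero]
    refine (hasDerivAt_const x (0 : ℝ)).congr_of_eventuallyEq ?_
    filter_upwards [gt_mem_nhds hx] with w hw
    simp [max_eq_right (le_of_lt hw)]
  · rw [max_self, mul_zero, hasDerivAt_iff_isLittleO_nhds_zero]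
    have h1 : (fun h : ℝ => h ^ 2) =o[𝓝 0] fun h => h := by
      simpa using Asymptotics.isLittleO_pow_id (𝕜 := ℝ) one_lt_two
    refine Asymptotics.IsBigO.trans_isLittleO ?_ h1
    refine Asymptotics.IsBigO.of_bound 1 (Eventually.of_forall fun h => ?_)
    simp only [zero_add, max_self, ne_eq, OfNat.ofNat_ne_zero, not_false_eq_true, zero_pow,
      sub_zero, smul_zero, norm_pow, one_mul]
    gcongr
    rw [Real.norm_eq_abs, Real.norm_eq_abs, abs_of_nonneg (le_max_right _ _)]
    exact max_le (le_abs_self _) (abs_nonneg _)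
  · rw [max_eq_left hx.le]
    have h1 : HasDerivAt (fun w : ℝ => w ^ 2) (2 * x) x := by simpa using hasDerivAt_pow 2 x
    refine h1.congr_of_eventuallyEq ?_
    filter_upwards [lt_mem_nhds hx] with w hw
    simp [max_eq_left (le_of_lt hw)]

/-- The bounded, nonincreasing test function `w² / (1 + w²)`, `w = (k - s)_+`. -/
def truncTest (k s : ℝ) : ℝ := 1 - (1 + (max (k - s) 0) ^ 2)⁻¹

theorem hasDerivAt_truncTest (k s : ℝ) :
    HasDerivAt (truncTest k) (-(2 * max (k - s) 0 / (1 + (max (k - s) 0) ^ 2) ^ 2)) s := by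
  have h1 : HasDerivAt (fun s : ℝ => k - s) (-1) s := by
    simpa using (hasDerivAt_id s).const_sub k
  have h2 : HasDerivAt (fun s : ℝ => (max (k - s) 0) ^ 2) _ s :=
    (hasDerivAt_sq_max_zero (k - s)).comp s h1
  have h3 := ((h2.const_add 1).inv (by positivity)).const_sub 1
  refine h3.congr_deriv ?_
  ring

theorem deriv_truncTest (k s : ℝ) :
    deriv (truncTest k) s = -(2 * max (k - s) 0 / (1 + (max (k - s) 0) ^ 2) ^ 2) :=
  (hasDerivAt_truncTest k s).deriv

theorem contDiff_truncTest (k : ℝ) : ContDiff ℝ 1 (truncTest k) := by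
  rw [contDiff_one_iff_deriv]
  refine ⟨fun s => (hasDerivAt_truncTest k s).differentiableAt, ?_⟩
  rw [funext (deriv_truncTest k)]
  refine Continuous.neg (Continuous.div (by fun_prop) (by fun_prop) fun s => ?_)
  positivity

theorem truncTest_nonneg (k s : ℝ) : 0 ≤ truncTest k s := by
  rw [truncTest, sub_nonneg]
  exact inv_le_one_of_one_le₀ (by nlinarith [sq_nonneg (max (k - s) 0)])

theorem abs_truncTest_le (k s : ℝ) : |truncTest k s| ≤ 1 := by
  rw [abs_of_nonneg (truncTest_nonneg k s), truncTest]
  have : 0 ≤ (1 + (max (k - s) 0) ^ 2)⁻¹ := by positivity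
  linarith

theorem deriv_truncTest_nonpos (k s : ℝ) : deriv (truncTest k) s ≤ 0 := by
  rw [deriv_truncTest, neg_nonpos]
  have : 0 ≤ max (k - s) 0 := le_max_right _ _
  positivity

theorem abs_deriv_truncTest_le (k s : ℝ) : |deriv (truncTest k) s| ≤ 1 := by
  rw [abs_of_nonpos (deriv_truncTest_nonpos k s), deriv_truncTest, neg_neg]
  set w := max (k - s) 0
  rw [div_le_one (by positivity)]
  nlinarith [sq_nonneg (w - 1), sq_nonneg w, sq_nonneg (w ^ 2)]

theorem truncTest_eq_zero {k s : ℝ} (h : k ≤ s) : truncTest k s = 0 := by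
  simp [truncTest, max_eq_right (sub_nonpos.2 h)]

theorem deriv_truncTest_eq_zero {k s : ℝ} (h : k ≤ s) : deriv (truncTest k) s = 0 := by
  simp [deriv_truncTest, max_eq_right (sub_nonpos.2 h)]

theorem truncTest_eq {k s : ℝ} (h : s ≤ k) : truncTest k s = (k - s) ^ 2 / (1 + (k - s) ^ 2) := by
  rw [truncTest, max_eq_left (sub_nonneg.2 h)]
  field_simp
  ring

theorem antitone_truncTest (k : ℝ) : Antitone (truncTest k) :=
  antitone_of_deriv_nonpos (fun s => (hasDerivAt_truncTest k s).differentiableAt)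
    (deriv_truncTest_nonpos k)

theorem truncTest_le_mul_deriv {k s L : ℝ} (hL : k - s ≤ L) (hL0 : 0 ≤ L) :
    truncTest k s ≤ L * (1 + L ^ 2) * -deriv (truncTest k) s := by
  rw [deriv_truncTest, neg_neg, truncTest]
  have hw0 : 0 ≤ max (k - s) 0 := le_max_right _ _
  have hwL : max (k - s) 0 ≤ L := max_le hL hL0
  set w := max (k - s) 0
  have e : 1 - (1 + w ^ 2)⁻¹ = w * (1 + w ^ 2) * (w / (1 + w ^ 2) ^ 2) := by
    field_simp
    ring
  rw [e]
  have h1 : w * (1 + w ^ 2) ≤ L * (1 + L ^ 2) := by gcongr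
  have h2 : 0 ≤ w / (1 + w ^ 2) ^ 2 := by positivity
  have h3 : w / (1 + w ^ 2) ^ 2 ≤ 2 * w / (1 + w ^ 2) ^ 2 := by gcongr; linarith
  exact mul_le_mul h1 h3 h2 (by positivity)

/-- The energy density which belongs to `β` and the test function `truncTest k`. -/
def truncEnergy (β : ℝ → ℝ) (k s : ℝ) : ℝ :=
  ∫ x in s..k, (β x - β s) * -deriv (truncTest k) x

variable {β : ℝ → ℝ} {k : ℝ}

theorem continuous_deriv_truncTest (k : ℝ) : Continuous (deriv (truncTest k)) :=
  (contDiff_truncTest k).continuous_deriv (by simp)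

theorem integral_deriv_truncTest (k s t : ℝ) :
    ∫ x in s..t, -deriv (truncTest k) x = truncTest k s - truncTest k t := by
  rw [intervalIntegral.integral_neg, intervalIntegral.integral_deriv_eq_sub
    (fun x _ => (hasDerivAt_truncTest k x).differentiableAt)
    ((continuous_deriv_truncTest k).intervalIntegrable _ _)]
  ring

theorem truncEnergy_eq (hβc : Continuous β) (s : ℝ) : truncEnergy β k s =
    (∫ x in s..k, β x * -deriv (truncTest k) x) - β s * truncTest k s := by
  have hc := (continuous_deriv_truncTest k).neg
  simp_rw [truncEnergy, sub_mul]
  have i1 : IntervalIntegrable (fun x => β x * -deriv (truncTest k) x) volume s k :=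
    (hβc.mul hc).intervalIntegrable _ _
  have i2 : IntervalIntegrable (fun x => β s * -deriv (truncTest k) x) volume s k :=
    (continuous_const.mul hc).intervalIntegrable _ _
  rw [intervalIntegral.integral_sub i1 i2, intervalIntegral.integral_const_mul,
    integral_deriv_truncTest, truncTest_eq_zero le_rfl, sub_zero]

theorem continuous_truncEnergy (hβc : Continuous β) : Continuous (truncEnergy β k) := by
  rw [funext (truncEnergy_eq hβc)]
  have hc := hβc.mul (continuous_deriv_truncTest k).neg
  have h1 : Continuous fun s => ∫ x in k..s, β x * -deriv (truncTest k) x :=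
    intervalIntegral.continuous_primitive (fun a b => hc.intervalIntegrable a b) k
  have h2 : Continuous fun s => ∫ x in s..k, β x * -deriv (truncTest k) x := by
    simp_rw [fun s => intervalIntegral.integral_symm (f := fun x => β x * -deriv (truncTest k) x)
      (μ := volume) k s]
    exact h1.neg
  exact h2.sub (hβc.mul (contDiff_truncTest k).continuous)

theorem mul_truncTest_le_truncEnergy_sub (hβc : Continuous β) (hβ : Monotone β) (s t : ℝ) :
    (β t - β s) * truncTest k t ≤ truncEnergy β k s - truncEnergy β k t := by
  have hc := (continuous_deriv_truncTest k).neg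
  have hci : ∀ a b, IntervalIntegrable (fun x => β x * -deriv (truncTest k) x) volume a b :=
    fun a b => (hβc.mul hc).intervalIntegrable _ _
  have h1 : ∫ x in s..t, (β x - β s) * -deriv (truncTest k) x =
      (∫ x in s..t, β x * -deriv (truncTest k) x) - β s * (truncTest k s - truncTest k t) := by
    simp_rw [sub_mul]
    have i2 : IntervalIntegrable (fun x => β s * -deriv (truncTest k) x) volume s t :=
      (continuous_const.mul hc).intervalIntegrable _ _
    rw [intervalIntegral.integral_sub (hci _ _) i2, intervalIntegral.integral_const_mul,
      integral_deriv_truncTest]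
  have h2 : 0 ≤ ∫ x in s..t, (β x - β s) * -deriv (truncTest k) x := by
    rcases le_total s t with hst | hst
    · refine intervalIntegral.integral_nonneg hst fun x hx => mul_nonneg ?_ ?_
      · exact sub_nonneg.2 (hβ hx.1)
      · exact neg_nonneg.2 (deriv_truncTest_nonpos k x)
    · rw [intervalIntegral.integral_symm, ← intervalIntegral.integral_neg]
      refine intervalIntegral.integral_nonneg hst fun x hx => ?_
      rw [← neg_mul]
      refine mul_nonneg ?_ (neg_nonneg.2 (deriv_truncTest_nonpos k x))
      linarith [hβ hx.2]
  have h3 := intervalIntegral.integral_add_adjacent_intervals (hci s t) (hci t k)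
  rw [truncEnergy_eq hβc, truncEnergy_eq hβc, ← h3]
  linarith

theorem truncEnergy_eq_zero (hβc : Continuous β) {s : ℝ} (h : k ≤ s) : truncEnergy β k s = 0 := by
  rw [truncEnergy_eq hβc, truncTest_eq_zero h, mul_zero, sub_zero, intervalIntegral.integral_congr
    (g := fun _ => (0 : ℝ))]
  · simp
  · intro x hx
    rw [uIcc_of_ge h] at hx
    simp [deriv_truncTest_eq_zero hx.1]

theorem truncEnergy_nonneg (hβc : Continuous β) (hβ : Monotone β) (s : ℝ) :
    0 ≤ truncEnergy β k s := by
  have h := mul_truncTest_le_truncEnergy_sub (k := k) hβc hβ s k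
  rwa [truncTest_eq_zero le_rfl, mul_zero, truncEnergy_eq_zero hβc le_rfl, sub_zero] at h

theorem truncEnergy_le (hβc : Continuous β) (hβ : Monotone β) (s : ℝ) :
    truncEnergy β k s ≤ |β k| + |β s| := by
  rcases le_total k s with h | h
  · rw [truncEnergy_eq_zero hβc h]; positivity
  · have h1 := mul_truncTest_le_truncEnergy_sub (k := k) hβc hβ k s
    rw [truncEnergy_eq_zero hβc le_rfl, zero_sub] at h1
    have h2 := (abs_le.1 (abs_truncTest_le k s)).2
    have h3 := truncTest_nonneg k s
    have h4 : 0 ≤ β k - β s := sub_nonneg.2 (hβ h)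
    have h5 : (β k - β s) * truncTest k s ≤ (β k - β s) * 1 := mul_le_mul_of_nonneg_left h2 h4
    linarith [le_abs_self (β k), neg_abs_le (β s)]

theorem le_truncEnergy (hβc : Continuous β) (hβ : Monotone β) {s k' k'' : ℝ} (hs : s ≤ k') :
    (β k'' - β k') * truncTest k k'' ≤ truncEnergy β k s := by
  have h1 := mul_truncTest_le_truncEnergy_sub (k := k) hβc hβ s k''
  have h2 := truncEnergy_nonneg (k := k) hβc hβ k''
  have h3 : (β k'' - β k') * truncTest k k'' ≤ (β k'' - β s) * truncTest k k'' :=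
    mul_le_mul_of_nonneg_right (by linarith [hβ hs]) (truncTest_nonneg _ _)
  linarith

end TruncTest

end DoublyNonlinear

end

noncomputable section

namespace DoublyNonlinear

open scoped ENNReal

section Cutoff

theorem exists_abs_deriv_smoothTransition_le :
    ∃ c : ℝ, 0 < c ∧ ∀ t, |deriv Real.smoothTransition t| ≤ c := by
  have hc : Continuous (deriv Real.smoothTransition) :=
    (Real.smoothTransition.contDiff (n := 1)).continuous_deriv (by simp)
  obtain ⟨c, hc⟩ := (isCompact_Icc (a := (0 : ℝ)) (b := 1)).exists_bound_of_continuousOn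
    hc.continuousOn
  refine ⟨max c 1, by positivity, fun t => ?_⟩
  by_cases ht : t ∈ Icc (0 : ℝ) 1
  · exact (hc t ht).trans (le_max_left _ _)
  · have h0 : deriv Real.smoothTransition t = 0 := by
      rw [mem_Icc, not_and_or, not_le, not_le] at ht
      rcases ht with ht | ht
      · have : Real.smoothTransition =ᶠ[𝓝 t] fun _ => 0 := by
          filter_upwards [gt_mem_nhds ht] with s hs
          exact Real.smoothTransition.zero_of_nonpos hs.le
        rw [this.deriv_eq, deriv_const]
      · have : Real.smoothTransition =ᶠ[𝓝 t] fun _ => 1 := by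
          filter_upwards [lt_mem_nhds ht] with s hs
          exact Real.smoothTransition.one_of_one_le hs.le
        rw [this.deriv_eq, deriv_const]
    rw [h0, abs_zero]
    positivity

/-- Cutoff functions between concentric balls. -/
theorem exists_spaceCutoff (N : ℕ) : ∃ c : ℝ, 0 < c ∧
    ∀ (x₀ : EuclideanSpace ℝ (Fin N)) (R₁ R₀ : ℝ), 0 < R₁ → R₁ < R₀ →
    ∃ ζ : EuclideanSpace ℝ (Fin N) → ℝ, ContDiff ℝ 1 ζ ∧ (∀ x, 0 ≤ ζ x) ∧ (∀ x, ζ x ≤ 1) ∧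
      (∀ x ∈ Metric.ball x₀ R₁, ζ x = 1) ∧
      (∀ x, x ∉ Metric.closedBall x₀ ((R₀ + R₁) / 2) → ζ x = 0) ∧
      ∀ x, ‖fderiv ℝ ζ x‖ ≤ c / (R₀ - R₁) := by
  obtain ⟨c, hc0, hc⟩ := exists_abs_deriv_smoothTransition_le
  refine ⟨4 * c, by positivity, fun x₀ R₁ R₀ hR₁ hR => ?_⟩
  set R := (R₀ + R₁) / 2 with hRdef
  have hR1 : R₁ < R := by rw [hRdef]; linarith
  have hden : 0 < R ^ 2 - R₁ ^ 2 := by nlinarith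
  set f : EuclideanSpace ℝ (Fin N) → ℝ := fun x => (R ^ 2 - ‖x - x₀‖ ^ 2) / (R ^ 2 - R₁ ^ 2) with hf
  have hfd : ∀ x, HasFDerivAt f
      ((R ^ 2 - R₁ ^ 2)⁻¹ • -((2 : ℕ) •
        (innerSL ℝ (x - x₀) : EuclideanSpace ℝ (Fin N) →L[ℝ] ℝ))) x := by
    intro x
    have h1 : HasFDerivAt (fun x : EuclideanSpace ℝ (Fin N) => x - x₀)
        (ContinuousLinearMap.id ℝ _) x := (hasFDerivAt_id x).sub_const x₀
    have h2 := (h1.norm_sq.const_sub (R ^ 2)).const_mul (R ^ 2 - R₁ ^ 2)⁻¹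
    rw [ContinuousLinearMap.comp_id] at h2
    refine h2.congr_of_eventuallyEq (Eventually.of_forall fun y => ?_)
    simp only [hf]
    rw [div_eq_inv_mul]
  have hfs : ContDiff ℝ 1 f :=
    (contDiff_const.sub ((contDiff_id.sub contDiff_const).norm_sq ℝ)).div_const _
  have hzero : ∀ x, x ∉ Metric.closedBall x₀ R → Real.smoothTransition (f x) = 0 := by
    intro x hx
    rw [Metric.mem_closedBall, dist_eq_norm, not_le] at hx
    apply Real.smoothTransition.zero_of_nonpos
    refine div_nonpos_of_nonpos_of_nonneg ?_ hden.le
    nlinarith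
  refine ⟨fun x => Real.smoothTransition (f x), Real.smoothTransition.contDiff.comp hfs,
    fun x => Real.smoothTransition.nonneg _, fun x => Real.smoothTransition.le_one _, ?_, hzero, ?_⟩
  · intro x hx
    rw [Metric.mem_ball, dist_eq_norm] at hx
    apply Real.smoothTransition.one_of_one_le
    rw [le_div_iff₀ hden]
    nlinarith [norm_nonneg (x - x₀)]
  · intro x
    by_cases hx : x ∈ Metric.closedBall x₀ R
    · rw [Metric.mem_closedBall, dist_eq_norm] at hx
      have h1 : HasDerivAt Real.smoothTransition (deriv Real.smoothTransition (f x)) (f x) :=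
        ((Real.smoothTransition.contDiff (n := 1)).differentiable (by simp) _).hasDerivAt
      have h2 : HasFDerivAt (fun x => Real.smoothTransition (f x)) _ x :=
        h1.comp_hasFDerivAt x (hfd x)
      rw [h2.fderiv, norm_smul, norm_smul, norm_neg, ← Nat.cast_smul_eq_nsmul ℝ, norm_smul,
        innerSL_apply_norm, norm_inv, Real.norm_of_nonneg hden.le]
      simp only [Nat.cast_ofNat, Real.norm_ofNat]
      have h3 : (R ^ 2 - R₁ ^ 2)⁻¹ * (2 * ‖x - x₀‖) ≤ 4 / (R₀ - R₁) := by
        rw [inv_mul_le_iff₀ hden, mul_div_assoc', le_div_iff₀ (by linarith)]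
        have e1 : R₀ - R₁ = 2 * (R - R₁) := by rw [hRdef]; ring
        rw [e1]
        have : ‖x - x₀‖ * (R - R₁) ≤ R * (R - R₁) := by gcongr
        nlinarith
      calc _ ≤ c * (4 / (R₀ - R₁)) := by
            gcongr
            exact hc _
        _ = _ := by ring
    · have : (fun x => Real.smoothTransition (f x)) =ᶠ[𝓝 x] fun _ => 0 := by
        filter_upwards [Metric.isClosed_closedBall.isOpen_compl.mem_nhds hx] with y hy
        exact hzero y hy
      rw [this.fderiv_eq]
      simp only [fderiv_fun_const, Pi.zero_apply, norm_zero]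
      have : 0 < R₀ - R₁ := by linarith
      positivity

/-- A primitive of a probability density on `ℝ`. -/
theorem primitive_density {ω : ℝ → ℝ} (hω0 : ∀ t, 0 ≤ ω t) {s a b : ℝ}
    (hsa : s ≤ a) (hab : a ≤ b) (hωs : ∀ t, t ∉ Ioo a b → ω t = 0) (hω1 : ∫ t, ω t = 1) :
    (∀ t, 0 ≤ ∫ x in s..t, ω x) ∧ (∀ t, ∫ x in s..t, ω x ≤ 1) ∧
      (∀ t ≤ a, ∫ x in s..t, ω x = 0) ∧ (∀ t, b ≤ t → ∫ x in s..t, ω x = 1) := by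
  have hint : Integrable ω := by
    by_contra h
    rw [integral_undef h] at hω1
    exact zero_ne_one hω1
  have hlow : ∀ t ≤ a, ∫ x in s..t, ω x = 0 := by
    intro t ht
    rw [intervalIntegral.integral_congr (g := fun _ => (0 : ℝ))]
    · simp
    · intro x hx
      refine hωs x fun h => ?_
      have := hx.2
      rcases le_max_iff.1 this with h' | h' <;> linarith [h.1]
  have hhigh : ∀ t, b ≤ t → ∫ x in s..t, ω x = 1 := by
    intro t ht
    rw [intervalIntegral.integral_of_le (by linarith), ← hω1,
      setIntegral_eq_integral_of_forall_compl_eq_zero]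
    intro x hx
    refine hωs x fun h => hx ⟨by linarith [h.1], by linarith [h.2]⟩
  refine ⟨fun t => ?_, fun t => ?_, hlow, hhigh⟩
  · rcases le_total s t with h | h
    · exact intervalIntegral.integral_nonneg h fun x _ => hω0 x
    · rw [hlow t (h.trans hsa)]
  · rcases le_total s t with h | h
    · rw [intervalIntegral.integral_of_le h, ← hω1]
      exact setIntegral_le_integral hint (Eventually.of_forall hω0)
    · rw [hlow t (h.trans hsa)]
      exact zero_le_one

/-- A time cutoff, which rises in `(s₀, s₁)` and then falls with derivative `-ψ`. -/
theorem exists_timeCutoff {s₀ s₁ c d : ℝ} (h₁ : s₀ < s₁) (h₂ : s₁ ≤ c) (h₃ : c ≤ d) {ψ : ℝ → ℝ}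
    (hψ : Continuous ψ) (hψ0 : ∀ t, 0 ≤ ψ t) (hψs : ∀ t, t ∉ Ioo c d → ψ t = 0)
    (hψ1 : ∫ t, ψ t = 1) :
    ∃ χ : ℝ → ℝ, ContDiff ℝ 1 χ ∧ (∀ t, 0 ≤ χ t) ∧ (∀ t, χ t ≤ 1) ∧
      (∀ t, t ∉ Icc ((3 * s₀ + s₁) / 4) d → χ t = 0) ∧ (∀ t ∈ Icc s₁ c, χ t = 1) ∧
      ∀ t, s₁ ≤ t → deriv χ t = -ψ t := by
  let φ : ContDiffBump ((s₀ + s₁) / 2) :=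
    ⟨(s₁ - s₀) / 8, (s₁ - s₀) / 4, by linarith, by linarith⟩
  set ω : ℝ → ℝ := φ.normed volume with hω
  have hωc : Continuous ω := φ.continuous_normed
  have hω0 : ∀ t, 0 ≤ ω t := fun t => φ.nonneg_normed t
  have hωs : ∀ t, t ∉ Ioo ((3 * s₀ + s₁) / 4) ((s₀ + 3 * s₁) / 4) → ω t = 0 := by
    intro t ht
    rw [← Function.notMem_support, hω, φ.support_normed_eq, Real.ball_eq_Ioo]
    convert ht using 2
    simp only [φ]
    congr 1 <;> ring
  obtain ⟨w0, w1, wl, wh⟩ := primitive_density (s := s₀) hω0 (by linarith) (by linarith) hωs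
    φ.integral_normed
  obtain ⟨p0, p1, pl, ph⟩ := primitive_density (s := s₀) hψ0 (by linarith) h₃ hψs hψ1
  have hder : ∀ t, HasDerivAt (fun t => (∫ x in s₀..t, ω x) - ∫ x in s₀..t, ψ x)
      (ω t - ψ t) t := fun t =>
    (hωc.integral_hasStrictDerivAt s₀ t).hasDerivAt.sub
      (hψ.integral_hasStrictDerivAt s₀ t).hasDerivAt
  refine ⟨fun t => (∫ x in s₀..t, ω x) - ∫ x in s₀..t, ψ x, ?_, ?_, ?_, ?_, ?_, ?_⟩
  · rw [contDiff_one_iff_deriv]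
    refine ⟨fun t => (hder t).differentiableAt, ?_⟩
    rw [funext fun t => (hder t).deriv]
    exact hωc.sub hψ
  · intro t
    beta_reduce
    rcases le_total t s₁ with h | h
    · rw [pl t (h.trans h₂), sub_zero]; exact w0 t
    · rw [wh t (by linarith)]; linarith [p1 t]
  · intro t
    beta_reduce
    linarith [w1 t, p0 t]
  · intro t ht
    beta_reduce
    rw [mem_Icc, not_and_or, not_le, not_le] at ht
    rcases ht with h | h
    · rw [wl t h.le, pl t (by linarith), sub_zero]
    · rw [wh t (by linarith), ph t h.le, sub_self]
  · intro t ht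
    beta_reduce
    rw [wh t (by linarith [ht.1]), pl t ht.2, sub_zero]
  · intro t ht
    rw [(hder t).deriv, hωs t (fun h => by linarith [h.2]), zero_sub]

end Cutoff

/-- The elementary form of Young's inequality. -/
theorem mul_rpow_le_young {p C₀ B X : ℝ} (hp : 1 < p) (hC₀ : 0 < C₀) (hB : 0 ≤ B) (hX : 0 ≤ X) :
    B * X ^ (p - 1) ≤ C₀ / 2 * X ^ p + (2 / C₀) ^ (p - 1) * B ^ p := by
  have hpow : ∀ Y : ℝ, 0 ≤ Y → Y ^ p = Y * Y ^ (p - 1) := by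
    intro Y hY
    rcases hY.eq_or_lt with rfl | hY
    · rw [Real.zero_rpow (by linarith), zero_mul]
    · rw [Real.rpow_sub_one hY.ne', mul_div_cancel₀ _ hY.ne']
  have h1 : 0 ≤ C₀ / 2 * X ^ p := by positivity
  have h2 : 0 ≤ (2 / C₀) ^ (p - 1) * B ^ p := by positivity
  rcases le_total B (C₀ / 2 * X) with h | h
  · calc B * X ^ (p - 1) ≤ (C₀ / 2 * X) * X ^ (p - 1) := by gcongr
      _ = C₀ / 2 * X ^ p := by rw [hpow X hX]; ring
      _ ≤ _ := by linarith
  · have h3 : X ≤ 2 / C₀ * B := by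
      rw [div_mul_eq_mul_div, le_div_iff₀ hC₀]; linarith
    calc B * X ^ (p - 1) ≤ B * (2 / C₀ * B) ^ (p - 1) := by
          gcongr
      _ = (2 / C₀) ^ (p - 1) * B ^ p := by
          rw [Real.mul_rpow (by positivity) hB, hpow B hB]; ring
      _ ≤ _ := by linarith

end DoublyNonlinear

end

noncomputable section

namespace DoublyNonlinear

open scoped ENNReal

variable {N : ℕ}

/-- A local supersolution with the structure conditions of order `p`, bounded below by `m`. -/
structure IsCoerciveSupersolution (O : Set (SpaceTime N)) (p : ℝ) (r : ℝ≥0∞) (β : ℝ → ℝ)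
    (u : SpaceTime N → ℝ) (D : SpaceTime N → EuclideanSpace ℝ (Fin N) →L[ℝ] ℝ)
    (a : SpaceTime N → EuclideanSpace ℝ (Fin N)) (C₀ C₁ m : ℝ) : Prop
    extends IsLocalSupersolution O p r β u D a where
  measurable : Measurable u
  continuous_beta : Continuous β
  monotone_beta : Monotone β
  coercive : ∀ᵐ z ∂volume.restrict O, C₀ * ‖D z‖ ^ p ≤ D z (a z)
  growth : ∀ᵐ z ∂volume.restrict O, ‖a z‖ ≤ C₁ * ‖D z‖ ^ (p - 1)
  lower : ∀ᵐ z ∂volume.restrict O, m ≤ u z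

/-- The product cutoff `ζ(x)^p χ(t)`. -/
def prodCutoff (p : ℝ) (ζ : EuclideanSpace ℝ (Fin N) → ℝ) (χ : ℝ → ℝ) (z : SpaceTime N) : ℝ :=
  ζ z.1 ^ p * χ z.2

section ProdCutoff

variable {p : ℝ} {ζ : EuclideanSpace ℝ (Fin N) → ℝ} {χ : ℝ → ℝ}

theorem contDiff_prodCutoff (hp : 1 < p) (hζ : ContDiff ℝ 1 ζ) (hχ : ContDiff ℝ 1 χ) :
    ContDiff ℝ 1 (prodCutoff p ζ χ) := by
  have h1 : ContDiff ℝ 1 fun x => ζ x ^ p := hζ.rpow_const_of_le (by simpa using hp.le)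
  exact (h1.comp contDiff_fst).mul (hχ.comp contDiff_snd)

theorem hasFDerivAt_prodCutoff (hp : 1 < p) (hζ : ContDiff ℝ 1 ζ) (hχ : ContDiff ℝ 1 χ)
    (z : SpaceTime N) (ξ : EuclideanSpace ℝ (Fin N)) (τ : ℝ) :
    fderiv ℝ (prodCutoff p ζ χ) z (ξ, τ) =
      χ z.2 * (p * ζ z.1 ^ (p - 1) * fderiv ℝ ζ z.1 ξ) + ζ z.1 ^ p * (deriv χ z.2 * τ) := by
  have h1 : HasFDerivAt ζ (fderiv ℝ ζ z.1) z.1 := (hζ.differentiable (by simp) _).hasFDerivAt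
  have h2 : HasFDerivAt (fun x => ζ x ^ p) _ z.1 :=
    (Real.hasDerivAt_rpow_const (Or.inr hp.le)).comp_hasFDerivAt z.1 h1
  have h3 : HasFDerivAt (fun w : SpaceTime N => ζ w.1 ^ p) _ z := h2.comp z hasFDerivAt_fst
  have h4 : HasDerivAt χ (deriv χ z.2) z.2 := (hχ.differentiable (by simp) _).hasDerivAt
  have h7 : HasFDerivAt (fun w : SpaceTime N => w.2)
      (ContinuousLinearMap.snd ℝ (EuclideanSpace ℝ (Fin N)) ℝ) z := hasFDerivAt_snd
  have h5 : HasFDerivAt (fun w : SpaceTime N => χ w.2) _ z := h4.comp_hasFDerivAt z h7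
  have h6 : HasFDerivAt (prodCutoff p ζ χ) _ z := h3.mul h5
  rw [h6.fderiv]
  simp
  ring

theorem tsupport_prodCutoff_subset (hp : 1 < p) {K : Set (EuclideanSpace ℝ (Fin N))} {J : Set ℝ}
    (hK : IsClosed K) (hJ : IsClosed J) (hζK : ∀ x, x ∉ K → ζ x = 0)
    (hχJ : ∀ t, t ∉ J → χ t = 0) : tsupport (prodCutoff p ζ χ) ⊆ K ×ˢ J := by
  refine closure_minimal (fun z hz => ?_) (hK.prod hJ)
  by_contra hcon
  apply hz
  rw [mem_prod, not_and_or] at hcon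
  rcases hcon with h | h
  · rw [prodCutoff, hζK _ h, Real.zero_rpow (by linarith), zero_mul]
  · rw [prodCutoff, hχJ _ h, mul_zero]

end ProdCutoff

variable {O : Set (SpaceTime N)} {p : ℝ} {r : ℝ≥0∞} {β : ℝ → ℝ} {u : SpaceTime N → ℝ}
  {D : SpaceTime N → EuclideanSpace ℝ (Fin N) →L[ℝ] ℝ} {a : SpaceTime N → EuclideanSpace ℝ (Fin N)}
  {C₀ C₁ m : ℝ}

theorem IsCoerciveSupersolution.integrableOn_truncEnergy
    (hu : IsCoerciveSupersolution O p r β u D a C₀ C₁ m) (k : ℝ) :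
    IntegrableOn (fun z => truncEnergy β k (u z)) O := by
  have hfin : IsFiniteMeasure (volume.restrict O) :=
    ⟨by rw [Measure.restrict_apply_univ]; exact hu.volume_ne_top.lt_top⟩
  have h1 : Integrable (fun z => |β k| + |β (u z)|) (volume.restrict O) :=
    (integrable_const _).add hu.integrableOn.abs
  refine h1.mono' ?_ (Eventually.of_forall fun z => ?_)
  · exact ((continuous_truncEnergy hu.continuous_beta).measurable.comp
      hu.measurable).aestronglyMeasurable
  · rw [Real.norm_of_nonneg (truncEnergy_nonneg hu.continuous_beta hu.monotone_beta _)]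
    exact truncEnergy_le hu.continuous_beta hu.monotone_beta _

theorem IsCoerciveSupersolution.integrableOn_deriv_truncTest_mul
    (hu : IsCoerciveSupersolution O p r β u D a C₀ C₁ m) (hp0 : 0 < p) (k : ℝ)
    {ζ : EuclideanSpace ℝ (Fin N) → ℝ} (hζ : Continuous ζ) (hζ0 : ∀ x, 0 ≤ ζ x)
    (hζ1 : ∀ x, ζ x ≤ 1) :
    IntegrableOn (fun z => -deriv (truncTest k) (u z) * (ζ z.1 * ‖D z‖) ^ p) O := by
  have hDp : Integrable (fun z => ‖D z‖ ^ p) (volume.restrict O) := by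
    have := hu.memLp_deriv.integrable_norm_rpow (by simpa using hp0) ENNReal.ofReal_ne_top
    rwa [ENNReal.toReal_ofReal hp0.le] at this
  have hζm : Measurable fun z : SpaceTime N => ζ z.1 := hζ.measurable.comp measurable_fst
  have hdm : Measurable fun z => -deriv (truncTest k) (u z) :=
    ((continuous_deriv_truncTest k).measurable.comp hu.measurable).neg
  refine hDp.mono' ?_ (Eventually.of_forall fun z => ?_)
  · refine hdm.aestronglyMeasurable.mul ?_
    exact ((hζm.aemeasurable.mul hu.memLp_deriv.1.norm.aemeasurable).pow_const
      p).aestronglyMeasurable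
  · have h1 : 0 ≤ -deriv (truncTest k) (u z) := neg_nonneg.2 (deriv_truncTest_nonpos _ _)
    have h2 : -deriv (truncTest k) (u z) ≤ 1 :=
      (neg_le_abs _).trans (abs_deriv_truncTest_le k (u z))
    have h3 : 0 ≤ ζ z.1 * ‖D z‖ := mul_nonneg (hζ0 _) (norm_nonneg _)
    rw [Real.norm_of_nonneg (mul_nonneg h1 (Real.rpow_nonneg h3 _))]
    calc _ ≤ 1 * ‖D z‖ ^ p := by
          gcongr
          exact mul_le_of_le_one_left (norm_nonneg _) (hζ1 _)
      _ = _ := one_mul _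

/-- The pointwise bound for the flux part of the energy inequality. -/
theorem derivComp_prodCutoff_le (hp : 1 < p) (hC₀ : 0 < C₀) (hC₁ : 0 ≤ C₁) {k Λ μ : ℝ} (hΛ : 0 ≤ Λ)
    (hμ : 0 ≤ μ) {ζ : EuclideanSpace ℝ (Fin N) → ℝ} (hζ : ContDiff ℝ 1 ζ) (hζ0 : ∀ x, 0 ≤ ζ x)
    (hζμ : ∀ x, ‖fderiv ℝ ζ x‖ ≤ μ) {χ : ℝ → ℝ} (hχ : ContDiff ℝ 1 χ)
    (hχ0 : ∀ t, 0 ≤ χ t) {z : SpaceTime N}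
    (hF : truncTest k (u z) ≤ Λ * -deriv (truncTest k) (u z))
    (hco : C₀ * ‖D z‖ ^ p ≤ D z (a z)) (hgr : ‖a z‖ ≤ C₁ * ‖D z‖ ^ (p - 1)) :
    derivComp (truncTest k) (prodCutoff p ζ χ) u D z (a z) ≤
      χ z.2 * -deriv (truncTest k) (u z) *
        (-(C₀ / 2 * (ζ z.1 * ‖D z‖) ^ p) + (2 / C₀) ^ (p - 1) * (Λ * p * C₁ * μ) ^ p) := by
  set f' := -deriv (truncTest k) (u z) with hf'
  have hf'0 : 0 ≤ f' := neg_nonneg.2 (deriv_truncTest_nonpos _ _)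
  have hf0 := truncTest_nonneg k (u z)
  set X := ζ z.1 * ‖D z‖ with hX
  have hX0 : 0 ≤ X := mul_nonneg (hζ0 _) (norm_nonneg _)
  have hp0 : 0 < p := by linarith
  have e : derivComp (truncTest k) (prodCutoff p ζ χ) u D z (a z) =
      χ z.2 * (-(f' * (ζ z.1 ^ p * D z (a z))) +
        truncTest k (u z) * (p * ζ z.1 ^ (p - 1) * fderiv ℝ ζ z.1 (a z))) := by
    have h1 : spatialDeriv (prodCutoff p ζ χ) z (a z) = _ :=
      hasFDerivAt_prodCutoff hp hζ hχ z (a z) 0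
    simp only [derivComp, _root_.add_apply, _root_.smul_apply,
      smul_eq_mul, h1, prodCutoff, hf']
    ring
  rw [e, mul_assoc (χ z.2) f']
  refine mul_le_mul_of_nonneg_left ?_ (hχ0 _)
  have h2 : C₀ * X ^ p ≤ ζ z.1 ^ p * D z (a z) := by
    rw [hX, Real.mul_rpow (hζ0 _) (norm_nonneg _)]
    have := mul_le_mul_of_nonneg_left hco (Real.rpow_nonneg (hζ0 z.1) p)
    linarith
  have h3 : ζ z.1 ^ (p - 1) * fderiv ℝ ζ z.1 (a z) ≤ μ * (C₁ * X ^ (p - 1)) := by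
    rw [hX, Real.mul_rpow (hζ0 _) (norm_nonneg _)]
    have h4 : fderiv ℝ ζ z.1 (a z) ≤ μ * (C₁ * ‖D z‖ ^ (p - 1)) :=
      (le_abs_self _).trans (((fderiv ℝ ζ z.1).le_opNorm (a z)).trans
        (mul_le_mul (hζμ _) hgr (norm_nonneg _) hμ))
    have := mul_le_mul_of_nonneg_left h4 (Real.rpow_nonneg (hζ0 z.1) (p - 1))
    linarith
  have h5 : truncTest k (u z) * (p * ζ z.1 ^ (p - 1) * fderiv ℝ ζ z.1 (a z)) ≤
      f' * ((Λ * p * C₁ * μ) * X ^ (p - 1)) := by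
    calc truncTest k (u z) * (p * ζ z.1 ^ (p - 1) * fderiv ℝ ζ z.1 (a z))
        = truncTest k (u z) * p * (ζ z.1 ^ (p - 1) * fderiv ℝ ζ z.1 (a z)) := by ring
      _ ≤ truncTest k (u z) * p * (μ * (C₁ * X ^ (p - 1))) :=
          mul_le_mul_of_nonneg_left h3 (by positivity)
      _ ≤ Λ * f' * p * (μ * (C₁ * X ^ (p - 1))) := by gcongr
      _ = _ := by ring
  have h6 := mul_rpow_le_young hp hC₀ (B := Λ * p * C₁ * μ) (by positivity) hX0
  have h7 := mul_le_mul_of_nonneg_left h6 hf'0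
  have h8 := mul_le_mul_of_nonneg_left h2 hf'0
  linarith

/-- The energy estimate on a cylinder, for levels which the supersolution exceeds at earlier
times. -/
theorem caccioppoli [ENNReal.HolderConjugate (ENNReal.ofReal p) r] (hp : 1 < p) (hr : 1 ≤ r)
    (hu : IsCoerciveSupersolution O p r β u D a C₀ C₁ m) (hC₀ : 0 < C₀) (hC₁ : 0 ≤ C₁)
    {k Λ μ : ℝ} (hΛ : 0 ≤ Λ) (hμ : 0 ≤ μ)
    (hF : ∀ s, m ≤ s → truncTest k s ≤ Λ * -deriv (truncTest k) s)
    {x₀ : EuclideanSpace ℝ (Fin N)} {R' R₀ s₀ s₁ c d T₀ : ℝ} (hR : R' < R₀) (hs : s₀ < s₁)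
    (hsc : s₁ ≤ c) (hcd : c ≤ d) (hdT : d < T₀)
    (hO : Metric.ball x₀ R₀ ×ˢ Ioo s₀ T₀ ⊆ O)
    (hpast : ∀ᵐ z ∂volume.restrict O, z ∈ Metric.ball x₀ R₀ ×ˢ Ioo s₀ s₁ → k ≤ u z)
    {ζ : EuclideanSpace ℝ (Fin N) → ℝ} (hζ : ContDiff ℝ 1 ζ) (hζ0 : ∀ x, 0 ≤ ζ x)
    (hζ1 : ∀ x, ζ x ≤ 1) (hζs : ∀ x, x ∉ Metric.closedBall x₀ R' → ζ x = 0)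
    (hζμ : ∀ x, ‖fderiv ℝ ζ x‖ ≤ μ) {ψ : ℝ → ℝ} (hψ : Continuous ψ) (hψ0 : ∀ t, 0 ≤ ψ t)
    (hψs : ∀ t, t ∉ Ioo c d → ψ t = 0) (hψ1 : ∫ t, ψ t = 1) :
    C₀ / 2 * (∫ z in Metric.ball x₀ R₀ ×ˢ Ico s₁ c,
        -deriv (truncTest k) (u z) * (ζ z.1 * ‖D z‖) ^ p) +
      ∫ z in Metric.ball x₀ R₀ ×ˢ Ico s₁ T₀, truncEnergy β k (u z) * ζ z.1 ^ p * ψ z.2 ≤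
    (2 / C₀) ^ (p - 1) * (Λ * p * C₁ * μ) ^ p *
      volume.real ((Metric.ball x₀ R₀ ×ˢ Ico s₁ T₀) ∩ {z | u z < k}) := by
  have hOm := hu.isOpen.measurableSet
  have hp0 : 0 < p := by linarith
  have hfin : IsFiniteMeasure (volume.restrict O) :=
    ⟨by rw [Measure.restrict_apply_univ]; exact hu.volume_ne_top.lt_top⟩
  obtain ⟨χ, hχ, hχ0, hχ1, hχs, hχone, hχd⟩ := exists_timeCutoff hs hsc hcd hψ hψ0 hψs hψ1
  set η := prodCutoff p ζ χ with hη
  have hηc : ContDiff ℝ 1 η := contDiff_prodCutoff hp hζ hχ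
  have hts : tsupport η ⊆ Metric.closedBall x₀ R' ×ˢ Icc ((3 * s₀ + s₁) / 4) d :=
    tsupport_prodCutoff_subset hp Metric.isClosed_closedBall isClosed_Icc hζs hχs
  have hηs : HasCompactSupport η :=
    ((isCompact_closedBall x₀ R').prod isCompact_Icc).of_isClosed_subset (isClosed_tsupport _) hts
  have hsub : Metric.closedBall x₀ R' ×ˢ Icc ((3 * s₀ + s₁) / 4) d ⊆
      Metric.ball x₀ R₀ ×ˢ Ioo s₀ T₀ :=
    prod_mono (Metric.closedBall_subset_ball hR) fun t ht =>
      ⟨by linarith [ht.1], by linarith [ht.2]⟩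
  have hηO : tsupport η ⊆ O := hts.trans (hsub.trans hO)
  have hη0 : ∀ z, 0 ≤ η z := fun z => mul_nonneg (Real.rpow_nonneg (hζ0 _) _) (hχ0 _)
  have hGi := hu.integrableOn_truncEnergy k
  have hEI := energy_inequality hp.le hu.toIsLocalSupersolution hr (contDiff_truncTest k)
    (truncTest_nonneg k) (abs_truncTest_le k) (abs_deriv_truncTest_le k)
    (mul_truncTest_le_truncEnergy_sub hu.continuous_beta hu.monotone_beta) hGi hηc hηs hηO hη0
  set Q := Metric.ball x₀ R₀ ×ˢ Ico s₁ T₀ with hQ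
  set Qc := Metric.ball x₀ R₀ ×ˢ Ico s₁ c with hQc
  have hQm : MeasurableSet Q := measurableSet_ball.prod measurableSet_Ico
  have hQcm : MeasurableSet Qc := measurableSet_ball.prod measurableSet_Ico
  have hQO : Q ⊆ O := (Set.prod_mono Subset.rfl
    (fun t ht => ⟨by linarith [ht.1], ht.2⟩ : Ico s₁ T₀ ⊆ Ioo s₀ T₀)).trans hO
  have hQcQ : Qc ⊆ Q := prod_mono Subset.rfl (Ico_subset_Ico_right (by linarith))
  have hAm : MeasurableSet (Q ∩ {z | u z < k}) :=
    hQm.inter (measurableSet_lt hu.measurable measurable_const)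
  set K := (2 / C₀) ^ (p - 1) * (Λ * p * C₁ * μ) ^ p with hK
  have hK0 : 0 ≤ K := by positivity
  -- integrability
  obtain ⟨M₁, hM₁0, hM₁⟩ := exists_bound_of_hasCompactSupport
    (hηc.continuous_fderiv (by simp)) (hηs.fderiv ℝ)
  have i1 : Integrable (fun z => truncEnergy β k (u z) * fderiv ℝ η z (0, 1))
      (volume.restrict O) := by
    refine hGi.mul_bdd (c := M₁) ?_ (Eventually.of_forall fun z => ?_)
    · exact ((hηc.continuous_fderiv (by simp)).clm_apply continuous_const).aestronglyMeasurable
    · refine ((fderiv ℝ η z).le_opNorm _).trans ?_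
      have : ‖((0, 1) : SpaceTime N)‖ = 1 := by simp [Prod.norm_def]
      rw [this, mul_one]
      exact hM₁ z
  have i2 : Integrable (fun z => derivComp (truncTest k) η u D z (a z)) (volume.restrict O) :=
    integrable_pairing (r := ENNReal.ofReal p) (s := r)
      ((memLp_derivComp hu.toIsLocalSupersolution (contDiff_truncTest k) (abs_truncTest_le k)
        (abs_deriv_truncTest_le k) hηc hηs hηO).restrict O) hu.memLp_flux
  have hζm : Measurable fun z : SpaceTime N => ζ z.1 :=
    hζ.continuous.measurable.comp measurable_fst
  have i3 := hu.integrableOn_deriv_truncTest_mul hp0 k hζ.continuous hζ0 hζ1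
  obtain ⟨M₂, hM₂⟩ : ∃ M₂, ∀ t, ‖ψ t‖ ≤ M₂ := by
    have : HasCompactSupport ψ := by
      refine HasCompactSupport.intro (isCompact_Icc (a := c) (b := d)) fun t ht => ?_
      exact hψs t fun h => ht (Ioo_subset_Icc_self h)
    exact this.exists_bound_of_continuous hψ
  have i4 : Integrable (fun z => truncEnergy β k (u z) * ζ z.1 ^ p * ψ z.2)
      (volume.restrict O) := by
    simp_rw [mul_assoc]
    refine hGi.mul_bdd (c := 1 * M₂) ?_ (Eventually.of_forall fun z => ?_)
    · exact ((hζm.pow_const p).mul (hψ.measurable.comp measurable_snd)).aestronglyMeasurable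
    · rw [norm_mul, Real.norm_of_nonneg (Real.rpow_nonneg (hζ0 _) _)]
      exact mul_le_mul (Real.rpow_le_one (hζ0 _) (hζ1 _) hp0.le) (hM₂ _) (norm_nonneg _) zero_le_one
  have i3' := i3.indicator hQcm
  have i4' := i4.indicator hQm
  have i5 : Integrable ((Q ∩ {z | u z < k}).indicator fun _ => K) (volume.restrict O) :=
    (integrable_const K).indicator hAm
  rw [← integral_add i1 i2] at hEI
  have hmono : ∫ z in O, (truncEnergy β k (u z) * fderiv ℝ η z (0, 1) +
      derivComp (truncTest k) η u D z (a z)) ≤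
      ∫ z in O, ((Q ∩ {z | u z < k}).indicator (fun _ => K) z - (C₀ / 2 *
        Qc.indicator (fun z => -deriv (truncTest k) (u z) * (ζ z.1 * ‖D z‖) ^ p) z +
        Q.indicator (fun z => truncEnergy β k (u z) * ζ z.1 ^ p * ψ z.2) z)) := by
    refine integral_mono_ae (i1.add i2) (i5.sub ((i3'.const_mul _).add i4')) ?_
    filter_upwards [hu.coercive, hu.growth, hu.lower, hpast] with z hco hgr hlow hpz
    by_cases hz1 : z.1 ∈ Metric.closedBall x₀ R'
    · have hzb : z.1 ∈ Metric.ball x₀ R₀ := Metric.closedBall_subset_ball hR hz1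
      by_cases hzQ : z ∈ Q
      · have ht : s₁ ≤ z.2 := hzQ.2.1
        rw [indicator_of_mem hzQ]
        have h1 : fderiv ℝ η z (0, 1) = -(ζ z.1 ^ p * ψ z.2) := by
          rw [hη, hasFDerivAt_prodCutoff hp hζ hχ, hχd _ ht]
          simp
        have h2 := derivComp_prodCutoff_le (k := k) hp hC₀ hC₁ hΛ hμ hζ hζ0 hζμ hχ hχ0 (hF _ hlow)
          hco hgr
        rw [← hK, ← hη] at h2
        have hd0 : 0 ≤ -deriv (truncTest k) (u z) := neg_nonneg.2 (deriv_truncTest_nonpos _ _)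
        have hd1 : -deriv (truncTest k) (u z) ≤ 1 :=
          (neg_le_abs _).trans (abs_deriv_truncTest_le k (u z))
        have hX0 : 0 ≤ (ζ z.1 * ‖D z‖) ^ p :=
          Real.rpow_nonneg (mul_nonneg (hζ0 _) (norm_nonneg _)) _
        have h3 : χ z.2 * -deriv (truncTest k) (u z) * K ≤
            (Q ∩ {z | u z < k}).indicator (fun _ => K) z := by
          by_cases hk : u z < k
          · rw [indicator_of_mem (show z ∈ Q ∩ {z | u z < k} from ⟨hzQ, hk⟩)]
            have : χ z.2 * -deriv (truncTest k) (u z) ≤ 1 :=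
              mul_le_one₀ (hχ1 _) hd0 hd1
            nlinarith
          · rw [indicator_of_notMem (fun h => hk h.2), deriv_truncTest_eq_zero (not_lt.1 hk)]
            simp
        have h4 : C₀ / 2 * Qc.indicator
            (fun z => -deriv (truncTest k) (u z) * (ζ z.1 * ‖D z‖) ^ p) z ≤
            χ z.2 * -deriv (truncTest k) (u z) * (C₀ / 2 * (ζ z.1 * ‖D z‖) ^ p) := by
          by_cases hzc : z ∈ Qc
          · rw [indicator_of_mem hzc, hχone z.2 ⟨hzc.2.1, hzc.2.2.le⟩]
            linarith
          · rw [indicator_of_notMem hzc, mul_zero]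
            have := hχ0 z.2
            positivity
        simp only [h1]
        linarith
      · have hzc : z ∉ Qc := fun h => hzQ (hQcQ h)
        have hzA : z ∉ Q ∩ {z | u z < k} := fun h => hzQ h.1
        simp only [indicator_of_notMem hzQ, indicator_of_notMem hzc, indicator_of_notMem hzA]
        by_cases ht : z.2 ∈ Ioo s₀ s₁
        · have hk := hpz ⟨hzb, ht⟩
          rw [truncEnergy_eq_zero hu.continuous_beta hk, derivComp, truncTest_eq_zero hk,
            deriv_truncTest_eq_zero hk]
          simp
        · have hzt : z ∉ tsupport η := by
            intro h
            have h5 := (hsub (hts h)).2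
            rcases lt_or_ge z.2 s₁ with h6 | h6
            · exact ht ⟨h5.1, h6⟩
            · exact hzQ ⟨hzb, h6, h5.2⟩
          rw [derivComp_eq_zero hzt, fderiv_of_notMem_tsupport ℝ hzt]
          simp
    · have hzt : z ∉ tsupport η := fun h => hz1 (hts h).1
      rw [derivComp_eq_zero hzt, fderiv_of_notMem_tsupport ℝ hzt]
      have h1 : Qc.indicator (fun z => -deriv (truncTest k) (u z) * (ζ z.1 * ‖D z‖) ^ p) z = 0 := by
        rw [indicator_apply_eq_zero]
        intro _
        rw [hζs _ hz1, zero_mul, Real.zero_rpow hp0.ne', mul_zero]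
      have h2 : Q.indicator (fun z => truncEnergy β k (u z) * ζ z.1 ^ p * ψ z.2) z = 0 := by
        rw [indicator_apply_eq_zero]
        intro _
        rw [hζs _ hz1, Real.zero_rpow hp0.ne', mul_zero, zero_mul]
      rw [h1, h2]
      simp only [_root_.zero_apply, mul_zero, add_zero, sub_zero]
      exact indicator_nonneg (fun _ _ => hK0) _
  have hfinal := hEI.trans hmono
  have i6 : Integrable (fun z => C₀ / 2 *
      Qc.indicator (fun z => -deriv (truncTest k) (u z) * (ζ z.1 * ‖D z‖) ^ p) z +
      Q.indicator (fun z => truncEnergy β k (u z) * ζ z.1 ^ p * ψ z.2) z) (volume.restrict O) :=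
    (i3'.const_mul _).add i4'
  rw [integral_sub i5 i6, integral_add (i3'.const_mul _) i4',
    integral_const_mul, setIntegral_indicator hQcm, setIntegral_indicator hQm,
    integral_indicator_const _ hAm, inter_eq_self_of_subset_right (hQcQ.trans hQO),
    inter_eq_self_of_subset_right hQO, measureReal_restrict_apply hAm,
    inter_eq_self_of_subset_left (inter_subset_left.trans hQO), smul_eq_mul] at hfinal
  linarith

end DoublyNonlinear

end

noncomputable section

namespace DoublyNonlinear

open scoped ENNReal Convolution

variable {N : ℕ}

variable {O : Set (SpaceTime N)} {p : ℝ} {r : ℝ≥0∞} {β : ℝ → ℝ} {u : SpaceTime N → ℝ}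
  {D : SpaceTime N → EuclideanSpace ℝ (Fin N) →L[ℝ] ℝ} {a : SpaceTime N → EuclideanSpace ℝ (Fin N)}
  {C₀ C₁ m : ℝ}

/-- The bound for the energy on almost every time slice. -/
theorem slice_energy_le [ENNReal.HolderConjugate (ENNReal.ofReal p) r] (hp : 1 < p) (hr : 1 ≤ r)
    (hu : IsCoerciveSupersolution O p r β u D a C₀ C₁ m) (hC₀ : 0 < C₀) (hC₁ : 0 ≤ C₁)
    {k Λ μ : ℝ} (hΛ : 0 ≤ Λ) (hμ : 0 ≤ μ)
    (hF : ∀ s, m ≤ s → truncTest k s ≤ Λ * -deriv (truncTest k) s)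
    {x₀ : EuclideanSpace ℝ (Fin N)} {R' R₀ s₀ s₁ T₀ : ℝ} (hR : R' < R₀) (hs : s₀ < s₁)
    (hO : Metric.ball x₀ R₀ ×ˢ Ioo s₀ T₀ ⊆ O)
    (hpast : ∀ᵐ z ∂volume.restrict O, z ∈ Metric.ball x₀ R₀ ×ˢ Ioo s₀ s₁ → k ≤ u z)
    {ζ : EuclideanSpace ℝ (Fin N) → ℝ} (hζ : ContDiff ℝ 1 ζ) (hζ0 : ∀ x, 0 ≤ ζ x)
    (hζ1 : ∀ x, ζ x ≤ 1) (hζs : ∀ x, x ∉ Metric.closedBall x₀ R' → ζ x = 0)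
    (hζμ : ∀ x, ‖fderiv ℝ ζ x‖ ≤ μ) :
    ∀ᵐ τ : ℝ, τ ∈ Ioo s₁ T₀ →
      Integrable (fun x => (Metric.ball x₀ R₀).indicator
        (fun x => truncEnergy β k (u (x, τ)) * ζ x ^ p) x) ∧
      ∫ x, (Metric.ball x₀ R₀).indicator (fun x => truncEnergy β k (u (x, τ)) * ζ x ^ p) x ≤
      (2 / C₀) ^ (p - 1) * (Λ * p * C₁ * μ) ^ p *
      volume.real ((Metric.ball x₀ R₀ ×ˢ Ico s₁ T₀) ∩ {z | u z < k}) := by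
  have hp0 : 0 < p := by linarith
  set Q := Metric.ball x₀ R₀ ×ˢ Ico s₁ T₀ with hQ
  set K := (2 / C₀) ^ (p - 1) * (Λ * p * C₁ * μ) ^ p * volume.real (Q ∩ {z | u z < k}) with hK
  have hQm : MeasurableSet Q := measurableSet_ball.prod measurableSet_Ico
  have hQO : Q ⊆ O := (Set.prod_mono Subset.rfl
    (fun t ht => ⟨by linarith [ht.1], ht.2⟩ : Ico s₁ T₀ ⊆ Ioo s₀ T₀)).trans hO
  have hGi := hu.integrableOn_truncEnergy k
  have hζm : Measurable fun z : SpaceTime N => ζ z.1 :=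
    hζ.continuous.measurable.comp measurable_fst
  set f : SpaceTime N → ℝ := Q.indicator (fun z => truncEnergy β k (u z) * ζ z.1 ^ p) with hf
  have hfi : Integrable f := by
    have h1 : IntegrableOn (fun z => truncEnergy β k (u z) * ζ z.1 ^ p) Q := by
      refine (hGi.mono_set hQO).mul_bdd (c := 1) (hζm.pow_const p).aestronglyMeasurable
        (Eventually.of_forall fun z => ?_)
      rw [Real.norm_of_nonneg (Real.rpow_nonneg (hζ0 _) _)]
      exact Real.rpow_le_one (hζ0 _) (hζ1 _) hp0.le
    exact h1.integrable_indicator hQm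
  have hfi' : Integrable f ((volume : Measure (EuclideanSpace ℝ (Fin N))).prod volume) := hfi
  set g : ℝ → ℝ := fun t => ∫ x, f (x, t) with hg
  have hgi : Integrable g := hfi'.integral_prod_right
  have hslice : ∀ τ ∈ Ioo s₁ T₀, (fun x => f (x, τ)) = fun x => (Metric.ball x₀ R₀).indicator
      (fun x => truncEnergy β k (u (x, τ)) * ζ x ^ p) x := by
    intro τ hτ
    funext x
    by_cases hx : x ∈ Metric.ball x₀ R₀
    · rw [indicator_of_mem hx, hf, indicator_of_mem (show (x, τ) ∈ Q from ⟨hx, hτ.1.le, hτ.2⟩)]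
    · rw [indicator_of_notMem hx, hf, indicator_of_notMem fun h => hx h.1]
  let φ : ℕ → ContDiffBump (0 : ℝ) := fun n =>
    ⟨1 / ((n : ℝ) + 1) / 2, 1 / ((n : ℝ) + 1), by positivity, half_lt_self (by positivity)⟩
  have hφ : Tendsto (fun n => (φ n).rOut) atTop (𝓝 0) := tendsto_one_div_add_atTop_nhds_zero_nat
  have hconv := ContDiffBump.ae_convolution_tendsto_right_of_locallyIntegrable (K := 2) hφ
      (Eventually.of_forall fun n => by simp only [φ]; linarith) hgi.locallyIntegrable
  filter_upwards [hconv, hfi'.prod_left_ae] with τ hτ hτi hmem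
  rw [← hslice τ hmem]
  refine ⟨hτi, ?_⟩
  refine le_of_tendsto hτ ?_
  have hε : 0 < min (τ - s₁) (T₀ - τ) := lt_min (by linarith [hmem.1]) (by linarith [hmem.2])
  filter_upwards [hφ.eventually (gt_mem_nhds hε)] with n hn
  set ρ := (φ n).rOut with hρ
  have hρ1 : ρ < τ - s₁ := hn.trans_le (min_le_left _ _)
  have hρ2 : ρ < T₀ - τ := hn.trans_le (min_le_right _ _)
  have hρ0 : 0 < ρ := (φ n).rOut_pos
  set ψ : ℝ → ℝ := fun t => (φ n).normed volume (τ - t) with hψ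
  have hψc : Continuous ψ := (φ n).continuous_normed.comp (continuous_const.sub continuous_id)
  have hψ0 : ∀ t, 0 ≤ ψ t := fun t => (φ n).nonneg_normed _
  have hψs : ∀ t, t ∉ Ioo (τ - ρ) (τ + ρ) → ψ t = 0 := by
    intro t ht
    rw [hψ]
    refine Function.notMem_support.1 ?_
    rw [(φ n).support_normed_eq, mem_ball_zero_iff, Real.norm_eq_abs, abs_lt]
    rintro ⟨h1, h2⟩
    exact ht ⟨by linarith, by linarith⟩
  have hψ1 : ∫ t, ψ t = 1 := by
    rw [hψ, integral_sub_left_eq_self (fun t => (φ n).normed volume t) volume τ]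
    exact (φ n).integral_normed
  have hcac := caccioppoli hp hr hu hC₀ hC₁ hΛ hμ hF hR hs (c := τ - ρ) (d := τ + ρ) (T₀ := T₀)
    (by linarith) (by linarith) (by linarith) hO hpast hζ hζ0 hζ1 hζs hζμ hψc hψ0 hψs hψ1
  rw [← hQ, ← hK] at hcac
  have h1 : 0 ≤ C₀ / 2 * (∫ z in Metric.ball x₀ R₀ ×ˢ Ico s₁ (τ - ρ),
        -deriv (truncTest k) (u z) * (ζ z.1 * ‖D z‖) ^ p) := by
    refine mul_nonneg (by positivity) (integral_nonneg fun z => mul_nonneg ?_ ?_)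
    · exact neg_nonneg.2 (deriv_truncTest_nonpos _ _)
    · exact Real.rpow_nonneg (mul_nonneg (hζ0 _) (norm_nonneg _)) _
  have h2 : ((φ n).normed volume ⋆[ContinuousLinearMap.lsmul ℝ ℝ, volume] g) τ =
      ∫ z in Q, truncEnergy β k (u z) * ζ z.1 ^ p * ψ z.2 := by
    rw [convolution_eq_swap, ← integral_indicator hQm]
    have h3 : (Q.indicator fun z => truncEnergy β k (u z) * ζ z.1 ^ p * ψ z.2) =
        fun z => f z * ψ z.2 := by
      funext z
      by_cases hz : z ∈ Q <;> simp [hf, hz]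
    obtain ⟨M₂, hM₂⟩ : ∃ M₂, ∀ t, ‖ψ t‖ ≤ M₂ := by
      have : HasCompactSupport ψ := by
        refine HasCompactSupport.intro (isCompact_Icc (a := τ - ρ) (b := τ + ρ)) fun t ht => ?_
        exact hψs t fun h => ht (Ioo_subset_Icc_self h)
      exact this.exists_bound_of_continuous hψc
    have h4 : Integrable (fun z : SpaceTime N => f z * ψ z.2)
        ((volume : Measure (EuclideanSpace ℝ (Fin N))).prod volume) :=
      hfi'.mul_bdd (c := M₂) (hψc.measurable.comp measurable_snd).aestronglyMeasurable
        (Eventually.of_forall fun z => hM₂ _)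
    rw [h3, Measure.volume_eq_prod, integral_prod_symm _ h4]
    refine integral_congr_ae (Eventually.of_forall fun t => ?_)
    simp only [ContinuousLinearMap.lsmul_apply, smul_eq_mul, hg, hψ]
    rw [integral_mul_const, mul_comm]
  rw [h2]
  linarith

/-- The bound for the gradient. -/
theorem gradient_energy_le [ENNReal.HolderConjugate (ENNReal.ofReal p) r] (hp : 1 < p) (hr : 1 ≤ r)
    (hu : IsCoerciveSupersolution O p r β u D a C₀ C₁ m) (hC₀ : 0 < C₀) (hC₁ : 0 ≤ C₁)
    {k Λ μ : ℝ} (hΛ : 0 ≤ Λ) (hμ : 0 ≤ μ)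
    (hF : ∀ s, m ≤ s → truncTest k s ≤ Λ * -deriv (truncTest k) s)
    {x₀ : EuclideanSpace ℝ (Fin N)} {R' R₀ s₀ s₁ T₁ T₀ : ℝ} (hR : R' < R₀) (hs : s₀ < s₁)
    (hsT : s₁ ≤ T₁) (hT : T₁ < T₀)
    (hO : Metric.ball x₀ R₀ ×ˢ Ioo s₀ T₀ ⊆ O)
    (hpast : ∀ᵐ z ∂volume.restrict O, z ∈ Metric.ball x₀ R₀ ×ˢ Ioo s₀ s₁ → k ≤ u z)
    {ζ : EuclideanSpace ℝ (Fin N) → ℝ} (hζ : ContDiff ℝ 1 ζ) (hζ0 : ∀ x, 0 ≤ ζ x)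
    (hζ1 : ∀ x, ζ x ≤ 1) (hζs : ∀ x, x ∉ Metric.closedBall x₀ R' → ζ x = 0)
    (hζμ : ∀ x, ‖fderiv ℝ ζ x‖ ≤ μ) :
    C₀ / 2 * (∫ z in Metric.ball x₀ R₀ ×ˢ Ico s₁ T₁,
        -deriv (truncTest k) (u z) * (ζ z.1 * ‖D z‖) ^ p) ≤
      (2 / C₀) ^ (p - 1) * (Λ * p * C₁ * μ) ^ p *
      volume.real ((Metric.ball x₀ R₀ ×ˢ Ico s₁ T₀) ∩ {z | u z < k}) := by
  let φ : ContDiffBump (T₁ + (T₀ - T₁) / 4) :=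
    ⟨(T₀ - T₁) / 8, (T₀ - T₁) / 4, by linarith, by linarith⟩
  have hψs : ∀ t, t ∉ Ioo T₁ (T₁ + (T₀ - T₁) / 2) → φ.normed volume t = 0 := by
    intro t ht
    refine Function.notMem_support.1 ?_
    rw [φ.support_normed_eq, Real.ball_eq_Ioo]
    rintro ⟨h1, h2⟩
    simp only [φ] at h1 h2
    exact ht ⟨by linarith, by linarith⟩
  have hcac := caccioppoli hp hr hu hC₀ hC₁ hΛ hμ hF hR hs (c := T₁) (d := T₁ + (T₀ - T₁) / 2)
    (T₀ := T₀) hsT (by linarith) (by linarith) hO hpast hζ hζ0 hζ1 hζs hζμ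
    φ.continuous_normed (fun t => φ.nonneg_normed t) hψs φ.integral_normed
  have h1 : 0 ≤ ∫ z in Metric.ball x₀ R₀ ×ˢ Ico s₁ T₀,
      truncEnergy β k (u z) * ζ z.1 ^ p * φ.normed volume z.2 :=
    integral_nonneg fun z => mul_nonneg (mul_nonneg
      (truncEnergy_nonneg hu.continuous_beta hu.monotone_beta _)
      (Real.rpow_nonneg (hζ0 _) _)) (φ.nonneg_normed _)
  linarith

end DoublyNonlinear

end

noncomputable section

namespace DoublyNonlinear

open scoped ENNReal

variable {N : ℕ}

variable {O : Set (SpaceTime N)} {p : ℝ} {r : ℝ≥0∞} {β : ℝ → ℝ} {u : SpaceTime N → ℝ}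
  {D : SpaceTime N → EuclideanSpace ℝ (Fin N) →L[ℝ] ℝ} {a : SpaceTime N → EuclideanSpace ℝ (Fin N)}
  {C₀ C₁ m : ℝ}

/-- The measure of the sublevel sets on almost every time slice. -/
theorem slice_measure_le [ENNReal.HolderConjugate (ENNReal.ofReal p) r] (hp : 1 < p) (hr : 1 ≤ r)
    (hu : IsCoerciveSupersolution O p r β u D a C₀ C₁ m) (hC₀ : 0 < C₀) (hC₁ : 0 ≤ C₁)
    {k k' k'' Λ μ : ℝ} (hΛ : 0 ≤ Λ) (hμ : 0 ≤ μ)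
    (hF : ∀ s, m ≤ s → truncTest k s ≤ Λ * -deriv (truncTest k) s)
    (hk : 0 < (β k'' - β k') * truncTest k k'')
    {x₀ : EuclideanSpace ℝ (Fin N)} {R₁ R' R₀ s₀ s₁ T₀ : ℝ} (hR₁ : R₁ ≤ R₀) (hR : R' < R₀)
    (hs : s₀ < s₁) (hO : Metric.ball x₀ R₀ ×ˢ Ioo s₀ T₀ ⊆ O)
    (hpast : ∀ᵐ z ∂volume.restrict O, z ∈ Metric.ball x₀ R₀ ×ˢ Ioo s₀ s₁ → k ≤ u z)
    {ζ : EuclideanSpace ℝ (Fin N) → ℝ} (hζ : ContDiff ℝ 1 ζ) (hζ0 : ∀ x, 0 ≤ ζ x)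
    (hζ1 : ∀ x, ζ x ≤ 1) (hζone : ∀ x ∈ Metric.ball x₀ R₁, ζ x = 1)
    (hζs : ∀ x, x ∉ Metric.closedBall x₀ R' → ζ x = 0) (hζμ : ∀ x, ‖fderiv ℝ ζ x‖ ≤ μ) :
    ∀ᵐ τ : ℝ, τ ∈ Ioo s₁ T₀ →
      volume (Metric.ball x₀ R₁ ∩ {x | u (x, τ) < k'}) ≤
      ENNReal.ofReal ((2 / C₀) ^ (p - 1) * (Λ * p * C₁ * μ) ^ p *
        volume.real ((Metric.ball x₀ R₀ ×ˢ Ico s₁ T₀) ∩ {z | u z < k}) /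
        ((β k'' - β k') * truncTest k k'')) := by
  filter_upwards [slice_energy_le hp hr hu hC₀ hC₁ hΛ hμ hF hR hs hO hpast hζ hζ0 hζ1 hζs hζμ]
    with τ hτ hmem
  obtain ⟨hi, hle⟩ := hτ hmem
  set g := (β k'' - β k') * truncTest k k'' with hg
  set B := Metric.ball x₀ R₁ ∩ {x | u (x, τ) < k'} with hB
  have hBm : MeasurableSet B := measurableSet_ball.inter
    (measurableSet_lt (hu.measurable.comp measurable_prodMk_right) measurable_const)
  have hBfin : volume B ≠ ∞ :=
    ((measure_mono inter_subset_left).trans_lt measure_ball_lt_top).ne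
  rw [← ENNReal.ofReal_toReal hBfin]
  refine ENNReal.ofReal_le_ofReal ?_
  rw [le_div_iff₀ hk]
  refine le_trans ?_ hle
  have h1 : (volume B).toReal * g = ∫ x, B.indicator (fun _ => g) x := by
    rw [integral_indicator_const _ hBm]; rfl
  rw [h1]
  refine integral_mono ((integrable_indicator_iff hBm).2 (integrableOn_const hBfin)) hi fun x => ?_
  beta_reduce
  have hnn : ∀ x, 0 ≤ truncEnergy β k (u (x, τ)) * ζ x ^ p := fun x =>
    mul_nonneg (truncEnergy_nonneg hu.continuous_beta hu.monotone_beta _)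
      (Real.rpow_nonneg (hζ0 _) _)
  by_cases hx : x ∈ B
  · rw [indicator_of_mem hx, indicator_of_mem (Metric.ball_subset_ball hR₁ hx.1), hζone _ hx.1,
      Real.one_rpow, mul_one]
    exact le_truncEnergy hu.continuous_beta hu.monotone_beta (le_of_lt hx.2)
  · rw [indicator_of_notMem hx]
    exact indicator_nonneg (fun x _ => hnn x) x

theorem le_rpow_mul_add {p μ X : ℝ} (hp : 1 < p) (hμ : 0 < μ) (hX : 0 ≤ X) :
    X ≤ μ ^ (1 - p) * X ^ p + μ := by
  rcases le_or_gt X μ with h | h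
  · have : 0 ≤ μ ^ (1 - p) * X ^ p := by positivity
    linarith
  · have hX0 : 0 < X := hμ.trans h
    have h1 : μ ^ (p - 1) ≤ X ^ (p - 1) := Real.rpow_le_rpow hμ.le h.le (by linarith)
    have h2 : X ^ p = X ^ (p - 1) * X := by
      rw [← Real.rpow_add_one hX0.ne']; ring_nf
    have h3 : μ ^ (1 - p) * μ ^ (p - 1) = 1 := by
      rw [← Real.rpow_add hμ]; simp
    have h4 : (0 : ℝ) < μ ^ (1 - p) := by positivity
    have h5 : 1 * X ≤ (μ ^ (1 - p) * X ^ (p - 1)) * X := by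
      refine mul_le_mul_of_nonneg_right ?_ hX
      exact h3.symm.le.trans (mul_le_mul_of_nonneg_left h1 h4.le)
    rw [h2]
    nlinarith

/-- The pointwise bound for the gradient of the truncation times the cutoff. -/
theorem norm_derivComp_prodCutoff_le (hp : 1 < p) {k Λ μ : ℝ} (hμ : 0 < μ)
    {ζ : EuclideanSpace ℝ (Fin N) → ℝ} (hζ : ContDiff ℝ 1 ζ) (hζ0 : ∀ x, 0 ≤ ζ x)
    (hζ1 : ∀ x, ζ x ≤ 1) (hζμ : ∀ x, ‖fderiv ℝ ζ x‖ ≤ μ) {χ : ℝ → ℝ} (hχ : ContDiff ℝ 1 χ)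
    (hχ0 : ∀ t, 0 ≤ χ t) (hχ1 : ∀ t, χ t ≤ 1) {z : SpaceTime N}
    (hF : truncTest k (u z) ≤ Λ * -deriv (truncTest k) (u z)) :
    ‖derivComp (truncTest k) (prodCutoff p ζ χ) u D z‖ ≤
      μ ^ (1 - p) * (-deriv (truncTest k) (u z) * (ζ z.1 * ‖D z‖) ^ p) +
        μ * (1 + Λ * p) * -deriv (truncTest k) (u z) := by
  set f' := -deriv (truncTest k) (u z) with hf'
  have hf'0 : 0 ≤ f' := neg_nonneg.2 (deriv_truncTest_nonpos _ _)
  have hf0 := truncTest_nonneg k (u z)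
  have hp0 : 0 < p := by linarith
  have hζp : ζ z.1 ^ p ≤ ζ z.1 := by
    have := Real.rpow_le_rpow_of_exponent_ge_of_imp (hζ0 z.1) (hζ1 z.1) hp.le (by simp [hp0.ne'])
    simpa using this
  have hη0 : 0 ≤ prodCutoff p ζ χ z := mul_nonneg (Real.rpow_nonneg (hζ0 _) _) (hχ0 _)
  have hη1 : prodCutoff p ζ χ z ≤ ζ z.1 :=
    (mul_le_of_le_one_right (Real.rpow_nonneg (hζ0 _) _) (hχ1 _)).trans hζp
  have h1 : ‖(deriv (truncTest k) (u z) * prodCutoff p ζ χ z) • D z‖ ≤ f' * (ζ z.1 * ‖D z‖) := by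
    rw [norm_smul, norm_mul, Real.norm_of_nonpos (deriv_truncTest_nonpos _ _), ← hf',
      Real.norm_of_nonneg hη0, mul_assoc]
    gcongr
  have h2 : ‖spatialDeriv (prodCutoff p ζ χ) z‖ ≤ p * μ := by
    refine ContinuousLinearMap.opNorm_le_bound _ (by positivity) fun ξ => ?_
    have h3 : spatialDeriv (prodCutoff p ζ χ) z ξ = _ :=
      hasFDerivAt_prodCutoff hp hζ hχ z ξ 0
    rw [h3, mul_zero, mul_zero, add_zero, norm_mul, norm_mul, norm_mul,
      Real.norm_of_nonneg (hχ0 _), Real.norm_of_nonneg hp0.le,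
      Real.norm_of_nonneg (Real.rpow_nonneg (hζ0 _) _)]
    have h4 : ‖fderiv ℝ ζ z.1 ξ‖ ≤ μ * ‖ξ‖ := ((fderiv ℝ ζ z.1).le_opNorm ξ).trans (by
      gcongr; exact hζμ _)
    have h5 : ζ z.1 ^ (p - 1) ≤ 1 := Real.rpow_le_one (hζ0 _) (hζ1 _) (by linarith)
    calc χ z.2 * (p * ζ z.1 ^ (p - 1) * ‖fderiv ℝ ζ z.1 ξ‖)
        ≤ 1 * (p * 1 * (μ * ‖ξ‖)) := by
          have := Real.rpow_nonneg (hζ0 z.1) (p - 1)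
          gcongr
          exact hχ1 _
      _ = p * μ * ‖ξ‖ := by ring
  have h6 : ‖truncTest k (u z) • spatialDeriv (prodCutoff p ζ χ) z‖ ≤ Λ * f' * (p * μ) := by
    rw [norm_smul, Real.norm_of_nonneg hf0]
    exact mul_le_mul hF h2 (norm_nonneg _) (hf0.trans hF)
  have h7 := mul_le_mul_of_nonneg_left
    (le_rpow_mul_add hp hμ (mul_nonneg (hζ0 z.1) (norm_nonneg (D z)))) hf'0
  calc ‖derivComp (truncTest k) (prodCutoff p ζ χ) u D z‖
      ≤ ‖(deriv (truncTest k) (u z) * prodCutoff p ζ χ z) • D z‖ +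
        ‖truncTest k (u z) • spatialDeriv (prodCutoff p ζ χ) z‖ := norm_add_le _ _
    _ ≤ _ := by linarith

/-- The Faber–Krahn step: the passage to a smaller cylinder and a lower level, given a bound for the
measure of the sublevel sets on the time slices. -/
theorem measure_sublevel_le [ENNReal.HolderConjugate (ENNReal.ofReal p) r] (hp : 1 < p)
    (hr : 1 ≤ r) (hu : IsCoerciveSupersolution O p r β u D a C₀ C₁ m) (hC₀ : 0 < C₀) (hC₁ : 0 ≤ C₁)
    {k k' Λ μ : ℝ} (hΛ : 0 ≤ Λ) (hμ : 0 < μ)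
    (hF : ∀ s, m ≤ s → truncTest k s ≤ Λ * -deriv (truncTest k) s)
    {x₀ : EuclideanSpace ℝ (Fin N)} {R₁ R' R₀ s₀ s₁ T₁ T₀ : ℝ} (hR₁ : R₁ ≤ R₀) (hR : R' < R₀)
    (hs : s₀ < s₁) (hsT : s₁ ≤ T₁) (hT : T₁ < T₀) (hO : Metric.ball x₀ R₀ ×ˢ Ioo s₀ T₀ ⊆ O)
    (hpast : ∀ᵐ z ∂volume.restrict O, z ∈ Metric.ball x₀ R₀ ×ˢ Ioo s₀ s₁ → k ≤ u z)
    {ζ : EuclideanSpace ℝ (Fin N) → ℝ} (hζ : ContDiff ℝ 1 ζ) (hζ0 : ∀ x, 0 ≤ ζ x)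
    (hζ1 : ∀ x, ζ x ≤ 1) (hζone : ∀ x ∈ Metric.ball x₀ R₁, ζ x = 1)
    (hζs : ∀ x, x ∉ Metric.closedBall x₀ R' → ζ x = 0) (hζμ : ∀ x, ‖fderiv ℝ ζ x‖ ≤ μ)
    {σ : ℝ≥0∞} (hσ : ∀ᵐ τ : ℝ, τ ∈ Ioo s₁ T₀ →
      volume (Metric.ball x₀ R₀ ∩ {x | u (x, τ) < k}) ≤ σ) {ρ : ℝ} (hρ : 0 < ρ)
    (hρσ : 2 * σ ≤ volume (Metric.ball (0 : EuclideanSpace ℝ (Fin N)) ρ)) :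
    truncTest k k' * volume.real ((Metric.ball x₀ R₁ ×ˢ Ico s₁ T₁) ∩ {z | u z < k'}) ≤
      2 * ρ * (μ * (2 / C₀ * ((2 / C₀) ^ (p - 1) * (Λ * p * C₁) ^ p) + (1 + Λ * p))) *
      volume.real ((Metric.ball x₀ R₀ ×ˢ Ico s₁ T₀) ∩ {z | u z < k}) := by
  have hp0 : 0 < p := by linarith
  set I := Ico s₁ T₁ with hI
  have hIm : MeasurableSet I := measurableSet_Ico
  set Q := Metric.ball x₀ R₀ ×ˢ I with hQ
  have hQm : MeasurableSet Q := measurableSet_ball.prod hIm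
  set A₀ := (Metric.ball x₀ R₀ ×ˢ Ico s₁ T₀) ∩ {z | u z < k} with hA₀
  set A₁ := (Metric.ball x₀ R₁ ×ˢ I) ∩ {z | u z < k'} with hA₁
  have hIT : I ⊆ Ico s₁ T₀ := Ico_subset_Ico_right hT.le
  have hQO : Q ⊆ O := (Set.prod_mono Subset.rfl
    (fun t ht => ⟨by linarith [ht.1], by linarith [ht.2]⟩ : Ico s₁ T₁ ⊆ Ioo s₀ T₀)).trans hO
  have hQO' : Metric.ball x₀ R₀ ×ˢ Ico s₁ T₀ ⊆ O := (Set.prod_mono Subset.rfl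
    (fun t ht => ⟨by linarith [ht.1], by linarith [ht.2]⟩ : Ico s₁ T₀ ⊆ Ioo s₀ T₀)).trans hO
  have hOfin : volume O ≠ ∞ := hu.volume_ne_top
  have hA₀fin : volume A₀ ≠ ∞ :=
    ((measure_mono (inter_subset_left.trans hQO')).trans_lt hOfin.lt_top).ne
  have hA₁m : MeasurableSet A₁ := (measurableSet_ball.prod hIm).inter
    (measurableSet_lt hu.measurable measurable_const)
  have hkm : MeasurableSet {z | u z < k} := measurableSet_lt hu.measurable measurable_const
  -- the cutoff
  let φ : ContDiffBump (T₁ + (T₀ - T₁) / 4) :=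
    ⟨(T₀ - T₁) / 8, (T₀ - T₁) / 4, by linarith, by linarith⟩
  have hψs : ∀ t, t ∉ Ioo T₁ (T₁ + (T₀ - T₁) / 2) → φ.normed volume t = 0 := by
    intro t ht
    refine Function.notMem_support.1 ?_
    rw [φ.support_normed_eq, Real.ball_eq_Ioo]
    rintro ⟨h1, h2⟩
    simp only [φ] at h1 h2
    exact ht ⟨by linarith, by linarith⟩
  obtain ⟨χ, hχ, hχ0, hχ1, hχs, hχone, -⟩ := exists_timeCutoff hs hsT (by linarith)
    φ.continuous_normed (fun t => φ.nonneg_normed t) hψs φ.integral_normed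
  set η := prodCutoff p ζ χ with hη
  have hηc : ContDiff ℝ 1 η := contDiff_prodCutoff hp hζ hχ
  have hts : tsupport η ⊆ Metric.closedBall x₀ R' ×ˢ
      Icc ((3 * s₀ + s₁) / 4) (T₁ + (T₀ - T₁) / 2) :=
    tsupport_prodCutoff_subset hp Metric.isClosed_closedBall isClosed_Icc hζs hχs
  have hηs : HasCompactSupport η :=
    ((isCompact_closedBall x₀ R').prod isCompact_Icc).of_isClosed_subset (isClosed_tsupport _) hts
  have hηO : tsupport η ⊆ O := hts.trans ((Set.prod_mono (Metric.closedBall_subset_ball hR)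
    (fun t ht => ⟨by linarith [ht.1], by linarith [ht.2]⟩ :
      Icc ((3 * s₀ + s₁) / 4) (T₁ + (T₀ - T₁) / 2) ⊆ Ioo s₀ T₀)).trans hO)
  -- the gradient
  have hf'm : Measurable fun z => -deriv (truncTest k) (u z) :=
    ((continuous_deriv_truncTest k).measurable.comp hu.measurable).neg
  have hf'0 : ∀ z, 0 ≤ -deriv (truncTest k) (u z) := fun z =>
    neg_nonneg.2 (deriv_truncTest_nonpos _ _)
  have hf'1 : ∀ z, -deriv (truncTest k) (u z) ≤ 1 := fun z =>
    (neg_le_abs _).trans (abs_deriv_truncTest_le k (u z))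
  have i1 : IntegrableOn (fun z => -deriv (truncTest k) (u z) * (ζ z.1 * ‖D z‖) ^ p) Q :=
    (hu.integrableOn_deriv_truncTest_mul hp0 k hζ.continuous hζ0 hζ1).mono_set hQO
  have hfinQ : IsFiniteMeasure (volume.restrict Q) :=
    ⟨by rw [Measure.restrict_apply_univ]
        exact (measure_mono hQO).trans_lt hOfin.lt_top⟩
  have i2 : IntegrableOn (fun z => -deriv (truncTest k) (u z)) Q :=
    (integrable_const (1 : ℝ)).mono' hf'm.aestronglyMeasurable (Eventually.of_forall fun z => by
      rw [Real.norm_of_nonneg (hf'0 z)]; exact hf'1 z)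
  have i3 : IntegrableOn (fun z => μ ^ (1 - p) *
      (-deriv (truncTest k) (u z) * (ζ z.1 * ‖D z‖) ^ p) +
        μ * (1 + Λ * p) * -deriv (truncTest k) (u z)) Q :=
    (i1.const_mul _).add (i2.const_mul _)
  have hgrad := gradient_energy_le hp hr hu hC₀ hC₁ hΛ hμ.le hF hR hs hsT hT hO hpast hζ hζ0 hζ1 hζs
    hζμ
  rw [← hI, ← hQ, ← hA₀] at hgrad
  have hint2 : ∫ z in Q, -deriv (truncTest k) (u z) ≤ volume.real A₀ := by
    calc ∫ z in Q, -deriv (truncTest k) (u z)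
        ≤ ∫ z in Q, {z | u z < k}.indicator (fun _ => (1 : ℝ)) z := by
          refine integral_mono i2 ((integrable_const (1 : ℝ)).indicator hkm) fun z => ?_
          beta_reduce
          by_cases hz : u z < k
          · rw [indicator_of_mem (show z ∈ {z | u z < k} from hz)]
            exact hf'1 z
          · rw [indicator_of_notMem (show z ∉ {z | u z < k} from hz),
              deriv_truncTest_eq_zero (not_lt.1 hz), neg_zero]
      _ = volume.real ({z | u z < k} ∩ Q) := by
          rw [integral_indicator_const _ hkm, measureReal_restrict_apply hkm, smul_eq_mul, mul_one]
      _ ≤ volume.real A₀ := by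
          refine measureReal_mono (fun z hz => ⟨⟨hz.2.1, hIT hz.2.2⟩, hz.1⟩) hA₀fin
  set C₂ := 2 / C₀ * ((2 / C₀) ^ (p - 1) * (Λ * p * C₁) ^ p) + (1 + Λ * p) with hC₂
  have hW : ∫⁻ z in univ ×ˢ I, ‖derivComp (truncTest k) η u D z‖ₑ ≤
      ENNReal.ofReal (μ * C₂ * volume.real A₀) := by
    calc ∫⁻ z in univ ×ˢ I, ‖derivComp (truncTest k) η u D z‖ₑ
        ≤ ∫⁻ z, Q.indicator (fun z => ENNReal.ofReal (μ ^ (1 - p) *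
            (-deriv (truncTest k) (u z) * (ζ z.1 * ‖D z‖) ^ p) +
            μ * (1 + Λ * p) * -deriv (truncTest k) (u z))) z := by
          rw [← lintegral_indicator (MeasurableSet.univ.prod hIm)]
          refine lintegral_mono_ae ?_
          filter_upwards [(ae_restrict_iff' hu.isOpen.measurableSet).1 hu.lower] with z hz
          by_cases hzI : z ∈ univ ×ˢ I
          · rw [indicator_of_mem hzI]
            by_cases hz1 : z.1 ∈ Metric.closedBall x₀ R'
            · have hzQ : z ∈ Q := ⟨Metric.closedBall_subset_ball hR hz1, hzI.2⟩
              rw [indicator_of_mem hzQ, ← ofReal_norm]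
              exact ENNReal.ofReal_le_ofReal (norm_derivComp_prodCutoff_le hp hμ hζ hζ0 hζ1 hζμ hχ
                hχ0 hχ1 (hF _ (hz (hQO hzQ))))
            · rw [derivComp_eq_zero fun h => hz1 (hts h).1, ← ofReal_norm, norm_zero,
                ENNReal.ofReal_zero]
              exact bot_le
          · rw [indicator_of_notMem hzI]
            exact bot_le
      _ = ENNReal.ofReal (∫ z in Q, (μ ^ (1 - p) *
            (-deriv (truncTest k) (u z) * (ζ z.1 * ‖D z‖) ^ p) +
            μ * (1 + Λ * p) * -deriv (truncTest k) (u z))) := by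
          rw [lintegral_indicator hQm, ofReal_integral_eq_lintegral_ofReal i3]
          refine Eventually.of_forall fun z => ?_
          have h1 := hf'0 z
          have h2 : 0 ≤ (ζ z.1 * ‖D z‖) ^ p :=
            Real.rpow_nonneg (mul_nonneg (hζ0 _) (norm_nonneg _)) _
          simp only [Pi.zero_apply]
          positivity
      _ ≤ _ := by
          refine ENNReal.ofReal_le_ofReal ?_
          rw [integral_add (i1.const_mul _) (i2.const_mul _), integral_const_mul,
            integral_const_mul]
          have h1 : (∫ z in Q, -deriv (truncTest k) (u z) * (ζ z.1 * ‖D z‖) ^ p) ≤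
              2 / C₀ * ((2 / C₀) ^ (p - 1) * (Λ * p * C₁ * μ) ^ p * volume.real A₀) := by
            have := mul_le_mul_of_nonneg_left hgrad (show 0 ≤ 2 / C₀ by positivity)
            rw [← mul_assoc] at this
            have e : 2 / C₀ * (C₀ / 2) = 1 := by field_simp
            rwa [e, one_mul] at this
          have h2 := mul_le_mul_of_nonneg_left h1 (show 0 ≤ μ ^ (1 - p) by positivity)
          have h3 := mul_le_mul_of_nonneg_left hint2 (show 0 ≤ μ * (1 + Λ * p) by positivity)
          have h4 : μ ^ (1 - p) * (Λ * p * C₁ * μ) ^ p = μ * (Λ * p * C₁) ^ p := by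
            rw [Real.mul_rpow (by positivity) hμ.le, mul_left_comm, ← Real.rpow_add hμ]
            simp [mul_comm]
          calc _ ≤ _ := add_le_add h2 h3
            _ = (2 / C₀ * (2 / C₀) ^ (p - 1)) * (μ ^ (1 - p) * (Λ * p * C₁ * μ) ^ p) *
                volume.real A₀ + μ * (1 + Λ * p) * volume.real A₀ := by ring
            _ = _ := by rw [h4, hC₂]; ring
  -- the Faber–Krahn inequality
  set v : SpaceTime N → ℝ≥0∞ := fun z => ‖truncTest k (u z) * η z‖ₑ with hv
  have hvm : Measurable v :=
    ((((contDiff_truncTest k).continuous.measurable.comp hu.measurable).mul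
      hηc.continuous.measurable)).enorm
  set S : Set (SpaceTime N) := (Metric.ball x₀ R₀ ×ˢ univ) ∩ {z | u z < k} with hS
  have hSm : MeasurableSet S := (measurableSet_ball.prod MeasurableSet.univ).inter hkm
  have hvS : ∀ z, z ∉ S → v z = 0 := by
    intro z hz
    by_cases hzk : u z < k
    · have : z ∉ tsupport η := fun h =>
        hz ⟨⟨Metric.closedBall_subset_ball hR (hts h).1, mem_univ _⟩, hzk⟩
      simp [hv, image_eq_zero_of_notMem_tsupport this]
    · simp [hv, truncTest_eq_zero (not_lt.1 hzk)]
  have hσ' : ∀ᵐ t ∂volume.restrict I, volume {x : EuclideanSpace ℝ (Fin N) | (x, t) ∈ S} ≤ σ := by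
    rw [Measure.restrict_congr_set (Ioo_ae_eq_Ico' (by simp) : Ioo s₁ T₁ =ᵐ[volume] Ico s₁ T₁).symm,
      ae_restrict_iff' measurableSet_Ioo]
    filter_upwards [hσ] with τ hτ hmem
    refine le_trans (measure_mono ?_) (hτ ⟨hmem.1, hmem.2.trans hT⟩)
    intro x hx
    exact ⟨hx.1.1, hx.2⟩
  have hd : ∀ y ∈ Metric.ball (0 : EuclideanSpace ℝ (Fin N)) ρ,
      ∫⁻ z in univ ×ˢ I, (v z - v (z + spaceShift y)) ≤
        ENNReal.ofReal (ρ * (μ * C₂ * volume.real A₀)) := by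
    intro y hy
    rw [ENNReal.ofReal_mul hρ.le]
    refine le_trans (lintegral_mono fun z => ?_) ((lintegral_enorm_increment_comp_le hp.le
      hu.toIsLocalSupersolution (contDiff_truncTest k) (abs_truncTest_le k)
      (abs_deriv_truncTest_le k) hηc hηs hηO hIm y).trans (mul_le_mul' ?_ hW))
    · rw [tsub_le_iff_right]
      set b := truncTest k (u (z + spaceShift y)) * η (z + spaceShift y) with hb
      have h1 : truncTest k (u z) * η z = b - (b - truncTest k (u z) * η z) := by ring
      have h2 : v z ≤ ‖b‖ₑ + ‖b - truncTest k (u z) * η z‖ₑ :=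
        le_of_eq_of_le (congrArg enorm h1) enorm_sub_le
      rwa [add_comm] at h2
    · rw [← ofReal_norm]
      exact ENNReal.ofReal_le_ofReal (mem_ball_zero_iff.1 hy).le
  have hη1 : ∀ z, ‖η z‖ ≤ 1 := fun z => by
    rw [hη, prodCutoff, Real.norm_of_nonneg (mul_nonneg (Real.rpow_nonneg (hζ0 _) _) (hχ0 _))]
    exact mul_le_one₀ (Real.rpow_le_one (hζ0 _) (hζ1 _) hp0.le) (hχ0 _) (hχ1 _)
  have hfin : ∫⁻ z in univ ×ˢ I, v z ≠ ∞ := by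
    refine ((setLIntegral_le_lintegral _ _).trans_lt ?_).ne
    calc ∫⁻ z, v z ≤ ∫⁻ z, O.indicator (fun _ => 1) z := by
          refine lintegral_mono fun z => ?_
          by_cases hz : z ∈ O
          · rw [indicator_of_mem hz, hv]
            beta_reduce
            rw [← ofReal_norm, ← ENNReal.ofReal_one]
            refine ENNReal.ofReal_le_ofReal ?_
            rw [norm_mul]
            exact mul_le_one₀ (abs_truncTest_le _ _) (norm_nonneg _) (hη1 z)
          · have : z ∉ tsupport η := fun h => hz (hηO h)
            simp [hv, image_eq_zero_of_notMem_tsupport this]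
      _ = volume O := by rw [lintegral_indicator hu.isOpen.measurableSet]; simp
      _ < ∞ := hOfin.lt_top
  have hFK := lintegral_le_of_slice_le hvm hSm hvS hσ' hρ hρσ hd hfin
  have hA₁fin : volume A₁ ≠ ∞ := by
    refine ((measure_mono (inter_subset_left.trans ?_)).trans_lt hOfin.lt_top).ne
    exact (Set.prod_mono (Metric.ball_subset_ball hR₁) Subset.rfl).trans hQO
  have hlow : ENNReal.ofReal (truncTest k k' * volume.real A₁) ≤ ∫⁻ z in univ ×ˢ I, v z := by
    rw [ENNReal.ofReal_mul (truncTest_nonneg _ _), measureReal_def, ENNReal.ofReal_toReal hA₁fin]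
    calc ENNReal.ofReal (truncTest k k') * volume A₁
        = ∫⁻ z in A₁, ENNReal.ofReal (truncTest k k') := by
          rw [setLIntegral_const]
      _ ≤ ∫⁻ z in A₁, v z := by
          refine setLIntegral_mono hvm fun z hz => ?_
          have : η z = 1 := by
            rw [hη, prodCutoff, hζone _ hz.1.1, hχone _ ⟨hz.1.2.1, hz.1.2.2.le⟩]; simp
          rw [hv]
          beta_reduce
          rw [this, mul_one, ← ofReal_norm, Real.norm_of_nonneg (truncTest_nonneg _ _)]
          exact ENNReal.ofReal_le_ofReal (antitone_truncTest k (le_of_lt hz.2))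
      _ ≤ _ := lintegral_mono_set (fun z hz => ⟨mem_univ _, hz.1.2⟩ : A₁ ⊆ univ ×ˢ I)
  have hfinal := hlow.trans hFK
  have h2 : ∀ x : ℝ, 2 * ENNReal.ofReal x = ENNReal.ofReal (2 * x) := fun x => by
    rw [ENNReal.ofReal_mul (by norm_num), ENNReal.ofReal_ofNat]
  have hC₂0 : 0 ≤ C₂ := by positivity
  rw [h2, ENNReal.ofReal_le_ofReal_iff (by positivity)]
    at hfinal
  linarith

end DoublyNonlinear

end

noncomputable section

namespace DoublyNonlinear

open scoped ENNReal

variable {N : ℕ}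

variable {O : Set (SpaceTime N)} {p : ℝ} {r : ℝ≥0∞} {β : ℝ → ℝ} {u : SpaceTime N → ℝ}
  {D : SpaceTime N → EuclideanSpace ℝ (Fin N) →L[ℝ] ℝ} {a : SpaceTime N → EuclideanSpace ℝ (Fin N)}
  {C₀ C₁ m : ℝ}

theorem sq_div_two_le_truncTest {k t : ℝ} (ht : 0 ≤ t) (ht1 : t ≤ 1) :
    t ^ 2 / 2 ≤ truncTest k (k - t) := by
  rw [truncTest_eq (by linarith), sub_sub_cancel]
  exact div_le_div_of_nonneg_left (sq_nonneg t) (by positivity) (by nlinarith)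

/-- The measure of the sublevel set of level `k` in the cylinder `B_R(x₀) × [s, T)`. -/
def sublevelMeasure (u : SpaceTime N → ℝ) (x₀ : EuclideanSpace ℝ (Fin N)) (R s T k : ℝ) : ℝ :=
  volume.real ((Metric.ball x₀ R ×ˢ Ico s T) ∩ {z | u z < k})

theorem sublevelMeasure_nonneg (u : SpaceTime N → ℝ) (x₀ : EuclideanSpace ℝ (Fin N))
    (R s T k : ℝ) : 0 ≤ sublevelMeasure u x₀ R s T k := measureReal_nonneg

theorem volume_cylinder_ne_top (x₀ : EuclideanSpace ℝ (Fin N)) (R s T : ℝ) :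
    volume (Metric.ball x₀ R ×ˢ Ico s T) ≠ ∞ := by
  rw [Measure.volume_eq_prod, Measure.prod_prod]
  exact ENNReal.mul_ne_top measure_ball_lt_top.ne (by simp)

theorem sublevelMeasure_mono (u : SpaceTime N → ℝ) (x₀ : EuclideanSpace ℝ (Fin N))
    {R R' s T T' k k' : ℝ} (hR : R ≤ R') (hT : T ≤ T') (hk : k ≤ k') :
    sublevelMeasure u x₀ R s T k ≤ sublevelMeasure u x₀ R' s T' k' :=
  measureReal_mono (inter_subset_inter (Set.prod_mono (Metric.ball_subset_ball hR)
      (Ico_subset_Ico_right hT)) fun _ hz => lt_of_lt_of_le hz hk)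
    ((measure_mono inter_subset_left).trans_lt (volume_cylinder_ne_top _ _ _ _).lt_top).ne

theorem volume_ball_rpow (hN : 1 ≤ N) {t : ℝ} (ht : 0 ≤ t) :
    volume (Metric.ball (0 : EuclideanSpace ℝ (Fin N)) (t ^ (1 / (N : ℝ)))) =
      ENNReal.ofReal (t * volume.real (Metric.ball (0 : EuclideanSpace ℝ (Fin N)) 1)) := by
  have hN0 : (N : ℝ) ≠ 0 := by positivity
  have : Nonempty (Fin N) := ⟨⟨0, hN⟩⟩
  rw [Measure.addHaar_ball _ _ (Real.rpow_nonneg ht _), finrank_euclideanSpace_fin,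
    ← Real.rpow_natCast, ← Real.rpow_mul ht, one_div_mul_cancel hN0, Real.rpow_one,
    ENNReal.ofReal_mul ht, measureReal_def, ENNReal.ofReal_toReal measure_ball_lt_top.ne]

/-- One step of the De Giorgi iteration. -/
theorem exists_sublevelMeasure_le [ENNReal.HolderConjugate (ENNReal.ofReal p) r] (hN : 1 ≤ N)
    (hp : 1 < p) (hr : 1 ≤ r) (hu : IsCoerciveSupersolution O p r β u D a C₀ C₁ m) (hC₀ : 0 < C₀)
    (hC₁ : 0 ≤ C₁) {κ M γ s : ℝ} (hγ : 0 < γ)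
    (hβ : ∀ b c, -M ≤ b → b < c → c ≤ M → γ * (c - b) ^ s ≤ β c - β b) :
    ∃ C : ℝ, 0 < C ∧ ∀ (x₀ : EuclideanSpace ℝ (Fin N)) (R₁ R₀ s₀ s₁ T₁ T₀ k d : ℝ), 0 < R₁ →
      R₁ < R₀ → s₀ < s₁ → s₁ ≤ T₁ → T₁ < T₀ → 0 < d → d ≤ 1 → k ≤ κ → k ≤ M → -M ≤ k - d →
      Metric.ball x₀ R₀ ×ˢ Ioo s₀ T₀ ⊆ O →
      (∀ᵐ z ∂volume.restrict O, z ∈ Metric.ball x₀ R₀ ×ˢ Ioo s₀ s₁ → k ≤ u z) →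
      sublevelMeasure u x₀ R₁ s₁ T₁ (k - d) ≤
        C * (R₀ - R₁) ^ (-(1 + p / N)) * d ^ (-(2 + (s + 2) / N)) *
          sublevelMeasure u x₀ R₀ s₁ T₀ k ^ (1 + 1 / (N : ℝ)) := by
  obtain ⟨c, hc, hcut⟩ := exists_spaceCutoff N
  have hp0 : 0 < p := by linarith
  have hN0 : (0 : ℝ) < N := by exact_mod_cast hN
  set ω := volume.real (Metric.ball (0 : EuclideanSpace ℝ (Fin N)) 1) with hω
  have hω0 : 0 < ω := ENNReal.toReal_pos (Metric.measure_ball_pos _ _ one_pos).ne'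
    measure_ball_lt_top.ne
  set L := max (κ - m) 0 + 1 with hL
  have hL0 : 0 < L := by positivity
  set Λ := L * (1 + L ^ 2) with hΛ
  have hΛ0 : 0 < Λ := by positivity
  set K := (2 / C₀) ^ (p - 1) * (Λ * p * C₁) ^ p + 1 with hK
  have hK0 : 0 < K := by positivity
  set C₂ := 2 / C₀ * ((2 / C₀) ^ (p - 1) * (Λ * p * C₁) ^ p) + (1 + Λ * p) with hC₂
  have hC₂0 : 0 < C₂ := by positivity
  set H := 2 * (K * (2 * c) ^ p) / (γ / 3 ^ s / 18) / ω with hH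
  have hH0 : 0 < H := by positivity
  refine ⟨18 * (2 * H ^ (1 / (N : ℝ)) * (2 * c * C₂)), by positivity, ?_⟩
  intro x₀ R₁ R₀ s₀ s₁ T₁ T₀ k d hR₁ hR hs₀ hsT hT hd hd1 hkκ hkM hkd hO hpast
  have hδ : 0 < R₀ - R₁ := by linarith
  set δ := R₀ - R₁ with hδdef
  set Rm := (R₀ + R₁) / 2 with hRm
  have hFk : ∀ l, l ≤ k → ∀ s, m ≤ s → truncTest l s ≤ Λ * -deriv (truncTest l) s := by
    intro l hl s hs
    refine truncTest_le_mul_deriv ?_ hL0.le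
    have := le_max_left (κ - m) 0
    linarith
  set μ := 2 * c / δ with hμ
  have hμ0 : 0 < μ := by positivity
  obtain ⟨ζ, hζ, hζ0, hζ1, hζone, hζs, hζμ⟩ := hcut x₀ Rm R₀ (by linarith) (by linarith)
  obtain ⟨ξ, hξ, hξ0, hξ1, hξone, hξs, hξμ⟩ := hcut x₀ R₁ Rm hR₁ (by linarith)
  have e1 : c / (R₀ - Rm) = μ := by rw [hμ, hδdef, hRm]; field_simp; ring_nf
  have e2 : c / (Rm - R₁) = μ := by rw [hμ, hδdef, hRm]; field_simp; ring_nf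
  rw [e1] at hζμ
  rw [e2] at hξμ
  set Y := sublevelMeasure u x₀ R₀ s₁ T₀ k with hY
  have hY0 : 0 ≤ Y := sublevelMeasure_nonneg _ _ _ _ _ _
  set k' := k - d / 3 - d / 3 with hk'
  set g := (β (k - d / 3) - β k') * truncTest k (k - d / 3) with hg
  have hgl : γ / 3 ^ s / 18 * d ^ (s + 2) ≤ g := by
    have h1 := hβ k' (k - d / 3) (by linarith) (by linarith) (by linarith)
    have h2 := sq_div_two_le_truncTest (k := k) (t := d / 3) (by linarith) (by linarith)
    have h3 : (k - d / 3) - k' = d / 3 := by rw [hk']; ring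
    rw [h3] at h1
    calc γ / 3 ^ s / 18 * d ^ (s + 2) = γ * (d / 3) ^ s * ((d / 3) ^ 2 / 2) := by
          rw [Real.rpow_add hd, Real.div_rpow hd.le (by norm_num), Real.rpow_two]
          ring
      _ ≤ g := mul_le_mul h1 h2 (by positivity) (le_trans (by positivity) h1)
  have hg0 : 0 < g := lt_of_lt_of_le (by positivity) hgl
  have hslice := slice_measure_le hp hr hu hC₀ hC₁ hΛ0.le hμ0.le (hFk k le_rfl) hg0
    (R₁ := Rm) (by linarith) (by linarith) hs₀ hO hpast hζ hζ0 hζ1 hζone hζs hζμ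
  rw [← hg] at hslice
  set σ := (2 / C₀) ^ (p - 1) * (Λ * p * C₁ * μ) ^ p * Y / g with hσ
  have hσle : 2 * σ ≤ H * (δ ^ (-p) * d ^ (-(s + 2)) * Y) * ω := by
    have h1 : (2 / C₀) ^ (p - 1) * (Λ * p * C₁ * μ) ^ p ≤ K * (2 * c) ^ p * δ ^ (-p) := by
      have e : μ ^ p = (2 * c) ^ p * δ ^ (-p) := by
        rw [hμ, Real.div_rpow (by positivity) hδ.le, Real.rpow_neg hδ.le, div_eq_mul_inv]
      rw [Real.mul_rpow (by positivity) hμ0.le, e, ← mul_assoc, ← mul_assoc]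
      gcongr
      rw [hK]; linarith
    calc 2 * σ ≤ 2 * (K * (2 * c) ^ p * δ ^ (-p) * Y / (γ / 3 ^ s / 18 * d ^ (s + 2))) := by
          rw [hσ]; gcongr
      _ = _ := by
          rw [hH, Real.rpow_neg hd.le]
          field_simp
  rcases eq_or_lt_of_le hY0 with hY00 | hYpos
  · rw [← hY00, Real.zero_rpow (by positivity), mul_zero, hY00]
    exact sublevelMeasure_mono u x₀ hR.le hT.le (by linarith)
  set t := H * (δ ^ (-p) * d ^ (-(s + 2)) * Y) with ht
  have ht0 : 0 < t := by positivity
  have hFK := measure_sublevel_le (k' := k - d) hp hr hu hC₀ hC₁ hΛ0.le hμ0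
    (hFk k' (by linarith)) (R₁ := R₁) (R₀ := Rm) (T₁ := T₁) (T₀ := T₀) (by linarith) (by linarith)
    hs₀ hsT hT ((Set.prod_mono (Metric.ball_subset_ball (by linarith)) Subset.rfl).trans hO)
    (by
      filter_upwards [hpast] with z hz hmem
      have := hz ⟨Metric.ball_subset_ball (by linarith) hmem.1, hmem.2⟩
      linarith) hξ hξ0 hξ1 hξone hξs hξμ hslice (ρ := t ^ (1 / (N : ℝ))) (by positivity) (by
      rw [volume_ball_rpow hN ht0.le, ← hω]
      refine le_trans (le_of_eq ?_) (ENNReal.ofReal_le_ofReal hσle)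
      rw [ENNReal.ofReal_mul (by norm_num), ENNReal.ofReal_ofNat]
      rfl)
  rw [← hC₂] at hFK
  have h1 : d ^ 2 / 18 ≤ truncTest k' (k - d) := by
    have := sq_div_two_le_truncTest (k := k') (t := d / 3) (by linarith) (by linarith)
    have e : k' - d / 3 = k - d := by rw [hk']; ring
    rw [e] at this
    linarith
  have h2 : sublevelMeasure u x₀ Rm s₁ T₀ k' ≤ Y :=
    sublevelMeasure_mono u x₀ (by linarith) le_rfl (by linarith)
  have h3 : d ^ 2 / 18 * sublevelMeasure u x₀ R₁ s₁ T₁ (k - d) ≤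
      2 * t ^ (1 / (N : ℝ)) * (μ * C₂) * Y := by
    refine le_trans (mul_le_mul_of_nonneg_right h1 (sublevelMeasure_nonneg _ _ _ _ _ _))
      (hFK.trans ?_)
    exact mul_le_mul_of_nonneg_left h2 (by positivity)
  have e3 : t ^ (1 / (N : ℝ)) = H ^ (1 / (N : ℝ)) * (δ ^ (-(p / N)) * d ^ (-((s + 2) / N)) *
      Y ^ (1 / (N : ℝ))) := by
    rw [ht, Real.mul_rpow hH0.le (by positivity), Real.mul_rpow (by positivity) hY0,
      Real.mul_rpow (by positivity) (by positivity), ← Real.rpow_mul hδ.le, ← Real.rpow_mul hd.le]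
    congr 4 <;> ring
  have e4 : δ ^ (-(1 + p / (N : ℝ))) = δ⁻¹ * δ ^ (-(p / (N : ℝ))) := by
    rw [neg_add, Real.rpow_add hδ, Real.rpow_neg_one]
  have e5 : d ^ (-(2 + (s + 2) / (N : ℝ))) = (d ^ 2)⁻¹ * d ^ (-((s + 2) / (N : ℝ))) := by
    rw [neg_add, Real.rpow_add hd, Real.rpow_neg hd.le, Real.rpow_two]
  have e6 : Y ^ (1 + 1 / (N : ℝ)) = Y * Y ^ (1 / (N : ℝ)) := by
    rw [Real.rpow_add hYpos, Real.rpow_one]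
  rw [e3] at h3
  rw [e4, e5, e6]
  have h4 := mul_le_mul_of_nonneg_left h3 (show 0 ≤ 18 * (d ^ 2)⁻¹ by positivity)
  calc sublevelMeasure u x₀ R₁ s₁ T₁ (k - d)
      = 18 * (d ^ 2)⁻¹ * (d ^ 2 / 18 * sublevelMeasure u x₀ R₁ s₁ T₁ (k - d)) := by
        field_simp
    _ ≤ _ := h4
    _ = _ := by rw [hμ]; field_simp

/-- Fast geometric convergence. -/
theorem le_mul_pow_of_fast_geometric {Y : ℕ → ℝ} {K b α : ℝ} (hα : 0 < α) (hK : 0 ≤ K) (hb : 1 < b)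
    (hY0 : ∀ n, 0 ≤ Y n) (hY : ∀ n, Y (n + 1) ≤ K * b ^ n * Y n ^ (1 + α))
    (h0 : K * b ^ (1 / α) * Y 0 ^ α ≤ 1) (n : ℕ) :
    Y n ≤ Y 0 * (b ^ (-(1 / α))) ^ n := by
  have hb0 : 0 < b := by linarith
  induction n with
  | zero => simp
  | succ n ih =>
    set c := b ^ (-(1 / α)) with hc
    have hc0 : 0 < c := by positivity
    have hcα : c ^ α = b⁻¹ := by
      rw [hc, ← Real.rpow_mul hb0.le, neg_mul, one_div_mul_cancel hα.ne', Real.rpow_neg_one]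
    have h1 : (Y 0 * c ^ n) ^ (1 + α) = Y 0 * c ^ n * (Y 0 ^ α * (b⁻¹) ^ n) := by
      rw [Real.rpow_add_of_nonneg (mul_nonneg (hY0 0) (by positivity)) zero_le_one hα.le,
        Real.rpow_one, Real.mul_rpow (hY0 0) (by positivity), ← Real.rpow_natCast_mul hc0.le,
        mul_comm (n : ℝ) α, Real.rpow_mul hc0.le, hcα, Real.rpow_natCast]
    have h2 : K * Y 0 ^ α ≤ c := by
      rw [hc, Real.rpow_neg hb0.le, ← one_div, le_div_iff₀ (by positivity)]
      linarith
    calc Y (n + 1) ≤ K * b ^ n * Y n ^ (1 + α) := hY n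
      _ ≤ K * b ^ n * (Y 0 * c ^ n) ^ (1 + α) := by
          have := hY0 n
          gcongr
      _ = (K * Y 0 ^ α) * (Y 0 * c ^ n) := by
          rw [h1, inv_pow]
          field_simp
      _ ≤ c * (Y 0 * c ^ n) := mul_le_mul_of_nonneg_right h2 (mul_nonneg (hY0 0) (by positivity))
      _ = _ := by ring

end DoublyNonlinear

end

noncomputable section

namespace DoublyNonlinear

open scoped ENNReal

variable {N : ℕ}

variable {O : Set (SpaceTime N)} {p : ℝ} {r : ℝ≥0∞} {β : ℝ → ℝ} {u : SpaceTime N → ℝ}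
  {D : SpaceTime N → EuclideanSpace ℝ (Fin N) →L[ℝ] ℝ} {a : SpaceTime N → EuclideanSpace ℝ (Fin N)}
  {C₀ C₁ m : ℝ}

theorem div_mul_two_pow_rpow_neg {x c e : ℝ} (hx : 0 < x) (hc : 0 < c) (n : ℕ) :
    (x / (c * 2 ^ n)) ^ (-e) = x ^ (-e) * c ^ e * ((2 : ℝ) ^ e) ^ n := by
  rw [Real.rpow_neg (by positivity), Real.div_rpow hx.le (by positivity), inv_div,
    Real.mul_rpow hc.le (by positivity), Real.rpow_neg hx.le, Real.rpow_pow_comm (by norm_num)]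
  field_simp

/-- If the supersolution exceeds `κ` at earlier times, then it exceeds `κ - ε` for a time of order
`ρ^p`, in a ball of half the radius. -/
theorem exists_lower_bound [ENNReal.HolderConjugate (ENNReal.ofReal p) r] (hN : 1 ≤ N)
    (hp : 1 < p) (hr : 1 ≤ r) (hu : IsCoerciveSupersolution O p r β u D a C₀ C₁ m) (hC₀ : 0 < C₀)
    (hC₁ : 0 ≤ C₁) {κ ε M γ s : ℝ} (hγ : 0 < γ)
    (hβ : ∀ b c, -M ≤ b → b < c → c ≤ M → γ * (c - b) ^ s ≤ β c - β b) (hε : 0 < ε) (hε1 : ε ≤ 1)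
    (hκ : κ ≤ M) (hκε : -M ≤ κ - ε) :
    ∃ θ : ℝ, 0 < θ ∧ ∀ (x₀ : EuclideanSpace ℝ (Fin N)) (ρ s₀ s₁ : ℝ), 0 < ρ → s₀ < s₁ →
      Metric.ball x₀ ρ ×ˢ Ioo s₀ (s₁ + 2 * (θ * ρ ^ p)) ⊆ O →
      (∀ᵐ z ∂volume.restrict O, z ∈ Metric.ball x₀ ρ ×ˢ Ioo s₀ s₁ → κ ≤ u z) →
      ∀ᵐ z ∂volume.restrict (Metric.ball x₀ (ρ / 2) ×ˢ Ico s₁ (s₁ + θ * ρ ^ p)), κ - ε ≤ u z := by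
  obtain ⟨C, hC, hstep⟩ := exists_sublevelMeasure_le (κ := κ) hN hp hr hu hC₀ hC₁ hγ hβ
  have hp0 : 0 < p := by linarith
  have hN0 : (0 : ℝ) < N := by exact_mod_cast hN
  set ω := volume.real (Metric.ball (0 : EuclideanSpace ℝ (Fin N)) 1) with hω
  have hω0 : 0 < ω := ENNReal.toReal_pos (Metric.measure_ball_pos _ _ one_pos).ne'
    measure_ball_lt_top.ne
  set e₁ := 1 + p / (N : ℝ) with he₁
  have he₁0 : 0 < e₁ := by positivity
  set e₂ := max (2 + (s + 2) / (N : ℝ)) 0 with he₂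
  set b := (2 : ℝ) ^ e₁ * 2 ^ e₂ with hb
  have hb1 : 1 < b := by
    have h1 : (1 : ℝ) < 2 ^ e₁ := Real.one_lt_rpow (by norm_num) he₁0
    have h2 : (1 : ℝ) ≤ 2 ^ e₂ := Real.one_le_rpow (by norm_num) (le_max_right _ _)
    nlinarith
  have hb0 : 0 < b := by linarith
  set G := C * 4 ^ e₁ * (ε ^ (-e₂) * 2 ^ e₂) with hG
  have hG0 : 0 < G := by positivity
  set P := G * b ^ (N : ℝ) with hP
  have hP0 : 0 < P := by positivity
  set θ := P ^ (-(N : ℝ)) / (2 * ω) with hθ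
  have hθ0 : 0 < θ := by positivity
  refine ⟨θ, hθ0, fun x₀ ρ s₀ s₁ hρ hs hO hpast => ?_⟩
  set h := θ * ρ ^ p with hh
  have hh0 : 0 < h := by positivity
  set R : ℕ → ℝ := fun n => ρ / 2 + ρ / (2 * 2 ^ n) with hR
  set T : ℕ → ℝ := fun n => s₁ + h + h / 2 ^ n with hT
  set k : ℕ → ℝ := fun n => κ - ε + ε / 2 ^ n with hk
  set Y : ℕ → ℝ := fun n => sublevelMeasure u x₀ (R n) s₁ (T n) (k n) with hY
  have h2 : ∀ n : ℕ, (1 : ℝ) ≤ 2 ^ n := fun n => one_le_pow₀ (by norm_num)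
  have hRρ : ∀ n, R n ≤ ρ := fun n => by
    have : ρ / (2 * 2 ^ n) ≤ ρ / 2 :=
      div_le_div_of_nonneg_left hρ.le (by norm_num) (by linarith [h2 n])
    simp only [hR]; linarith
  have hTle : ∀ n, T n ≤ s₁ + 2 * h := fun n => by
    have : h / 2 ^ n ≤ h := div_le_self hh0.le (h2 n)
    simp only [hT]; linarith
  have hkle : ∀ n, k n ≤ κ := fun n => by
    have : ε / 2 ^ n ≤ ε := div_le_self hε.le (h2 n)
    simp only [hk]; linarith
  have hkge : ∀ n, κ - ε ≤ k n := fun n => by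
    have : 0 < ε / 2 ^ n := by positivity
    simp only [hk]; linarith
  have hY0 : ∀ n, 0 ≤ Y n := fun n => sublevelMeasure_nonneg _ _ _ _ _ _
  have hYstep : ∀ n, Y (n + 1) ≤ (G * ρ ^ (-e₁)) * b ^ n * Y n ^ (1 + 1 / (N : ℝ)) := by
    intro n
    have hRd : R n - R (n + 1) = ρ / (4 * 2 ^ n) := by
      simp only [hR, pow_succ]; field_simp; ring
    have hkd : k (n + 1) = k n - ε / (2 * 2 ^ n) := by
      simp only [hk, pow_succ]; field_simp; ring
    have hRn : 0 < R (n + 1) := by simp only [hR]; positivity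
    have hTd : T (n + 1) < T n := by
      have : h / 2 ^ (n + 1) < h / 2 ^ n :=
        div_lt_div_of_pos_left hh0 (by positivity) (pow_lt_pow_right₀ (by norm_num) n.lt_succ_self)
      simp only [hT]; linarith
    have hd0 : 0 < ε / (2 * 2 ^ n) := by positivity
    have hd1 : ε / (2 * 2 ^ n) ≤ 1 := (div_le_self hε.le (by linarith [h2 n])).trans hε1
    have hδ0 : 0 < ρ / (4 * 2 ^ n) := by positivity
    have := hstep x₀ (R (n + 1)) (R n) s₀ s₁ (T (n + 1)) (T n) (k n) (ε / (2 * 2 ^ n)) hRn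
      (by linarith) hs (by simp only [hT]; have : 0 < h / 2 ^ (n + 1) := by positivity
                           linarith) hTd hd0 hd1 (hkle n) ((hkle n).trans hκ)
      (by rw [← hkd]; exact hκε.trans (hkge _))
      ((Set.prod_mono (Metric.ball_subset_ball (hRρ n)) (Ioo_subset_Ioo_right (hTle n))).trans hO)
      (by
        filter_upwards [hpast] with z hz hmem
        exact (hkle n).trans (hz ⟨Metric.ball_subset_ball (hRρ n) hmem.1, hmem.2⟩))
    rw [← hkd, hRd] at this
    refine this.trans ?_
    have hmono : (ε / (2 * 2 ^ n)) ^ (-(2 + (s + 2) / (N : ℝ))) ≤ (ε / (2 * 2 ^ n)) ^ (-e₂) :=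
      Real.rpow_le_rpow_of_exponent_ge hd0 hd1 (neg_le_neg (le_max_left _ _))
    calc _ ≤ C * (ρ / (4 * 2 ^ n)) ^ (-e₁) * (ε / (2 * 2 ^ n)) ^ (-e₂) *
          Y n ^ (1 + 1 / (N : ℝ)) := by
          refine mul_le_mul_of_nonneg_right ?_ (Real.rpow_nonneg (hY0 n) _)
          exact mul_le_mul_of_nonneg_left hmono (by positivity)
      _ = _ := by
          rw [div_mul_two_pow_rpow_neg hρ (by norm_num), div_mul_two_pow_rpow_neg hε (by norm_num),
            hG, hb, mul_pow]
          ring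
  have hYinit : Y 0 ≤ P ^ (-(N : ℝ)) * (ρ ^ e₁) ^ (N : ℝ) := by
    have h3 : Y 0 ≤ volume.real (Metric.ball x₀ ρ ×ˢ Ico s₁ (s₁ + 2 * h)) := by
      refine measureReal_mono ?_ (volume_cylinder_ne_top _ _ _ _)
      exact inter_subset_left.trans (Set.prod_mono (Metric.ball_subset_ball (hRρ 0))
        (Ico_subset_Ico_right (hTle 0)))
    refine h3.trans (le_of_eq ?_)
    have : Nonempty (Fin N) := ⟨⟨0, hN⟩⟩
    rw [measureReal_def, Measure.volume_eq_prod, Measure.prod_prod, ENNReal.toReal_mul,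
      Measure.addHaar_ball _ _ hρ.le, finrank_euclideanSpace_fin, ENNReal.toReal_mul,
      ENNReal.toReal_ofReal (by positivity), Real.volume_Ico, ENNReal.toReal_ofReal (by linarith),
      ← measureReal_def, ← hω, ← Real.rpow_mul hρ.le, he₁, add_mul, one_mul,
      div_mul_cancel₀ _ hN0.ne', Real.rpow_add hρ, Real.rpow_natCast, hh, hθ]
    field_simp
    ring
  have hYlim : ∀ n, Y n ≤ Y 0 * (b ^ (-(1 / (1 / (N : ℝ))))) ^ n := by
    refine le_mul_pow_of_fast_geometric (by positivity) (by positivity) hb1 hY0 hYstep ?_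
    have h4 : Y 0 ^ (1 / (N : ℝ)) ≤ P⁻¹ * ρ ^ e₁ := by
      calc Y 0 ^ (1 / (N : ℝ)) ≤ (P ^ (-(N : ℝ)) * (ρ ^ e₁) ^ (N : ℝ)) ^ (1 / (N : ℝ)) :=
            Real.rpow_le_rpow (hY0 0) hYinit (by positivity)
        _ = _ := by
            rw [Real.mul_rpow (by positivity) (by positivity), ← Real.rpow_mul hP0.le,
              ← Real.rpow_mul (by positivity : (0 : ℝ) ≤ ρ ^ e₁), neg_mul,
              mul_one_div_cancel hN0.ne', Real.rpow_neg_one, Real.rpow_one]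
    calc G * ρ ^ (-e₁) * b ^ (1 / (1 / (N : ℝ))) * Y 0 ^ (1 / (N : ℝ))
        ≤ G * ρ ^ (-e₁) * b ^ (1 / (1 / (N : ℝ))) * (P⁻¹ * ρ ^ e₁) :=
          mul_le_mul_of_nonneg_left h4 (by positivity)
      _ = 1 := by
          rw [one_div_one_div, Real.rpow_neg hρ.le, hP]
          field_simp
  have hlim : Tendsto (fun n => Y 0 * (b ^ (-(1 / (1 / (N : ℝ))))) ^ n) atTop (𝓝 0) := by
    rw [← mul_zero (Y 0)]
    refine (tendsto_pow_atTop_nhds_zero_of_lt_one (by positivity) ?_).const_mul _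
    rw [one_div_one_div]
    exact Real.rpow_lt_one_of_one_lt_of_neg hb1 (by linarith)
  have hle : sublevelMeasure u x₀ (ρ / 2) s₁ (s₁ + h) (κ - ε) ≤ 0 := by
    refine ge_of_tendsto' hlim fun n => le_trans ?_ (hYlim n)
    refine sublevelMeasure_mono u x₀ ?_ ?_ (hkge n)
    · have : 0 < ρ / (2 * 2 ^ n) := by positivity
      simp only [hR]; linarith
    · have : 0 < h / 2 ^ n := by positivity
      simp only [hT]; linarith
  have hzero : volume ((Metric.ball x₀ (ρ / 2) ×ˢ Ico s₁ (s₁ + h)) ∩ {z | u z < κ - ε}) = 0 := by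
    have h5 := le_antisymm hle (sublevelMeasure_nonneg _ _ _ _ _ _)
    rw [sublevelMeasure, measureReal_eq_zero_iff
      ((measure_mono inter_subset_left).trans_lt (volume_cylinder_ne_top _ _ _ _).lt_top).ne] at h5
    exact h5
  rw [ae_restrict_iff' (measurableSet_ball.prod measurableSet_Ico), ae_iff]
  convert hzero using 2
  ext z
  simp only [Set.mem_ofPred_eq, mem_inter_iff, Classical.not_imp, not_le]

end DoublyNonlinear

end

noncomputable section

namespace DoublyNonlinear

open scoped ENNReal

variable {N : ℕ}

/-- The composition of a Carathéodory function with a measurable function is measurable. -/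
theorem aemeasurable_comp_of_caratheodory {α W F : Type*} [MeasurableSpace α] {μ : Measure α}
    [TopologicalSpace W] [TopologicalSpace.PseudoMetrizableSpace W] [SecondCountableTopology W]
    [MeasurableSpace W] [BorelSpace W] [TopologicalSpace F]
    [TopologicalSpace.PseudoMetrizableSpace F] [MeasurableSpace F] [BorelSpace F]
    {A : α → W → F}
    (hA : ∀ w, AEMeasurable (fun z => A z w) μ) (hc : ∀ᵐ z ∂μ, Continuous (A z)) {f : α → W}
    (hf : AEMeasurable f μ) : AEMeasurable (fun z => A z (f z)) μ := by
  obtain ⟨g, hg, hfg⟩ := hf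
  have hg' : StronglyMeasurable g := hg.stronglyMeasurable
  refine AEMeasurable.congr (f := fun z => A z (g z)) ?_ (by
    filter_upwards [hfg] with z hz
    rw [hz])
  refine aemeasurable_of_tendsto_metrizable_ae atTop (f := fun n z => A z (hg'.approx n z))
    (fun n => ?_) ?_
  · have hcover : (⋃ w : (hg'.approx n).range, (hg'.approx n) ⁻¹' {(w : W)}) = univ := by
      ext z
      simp
    rw [← Measure.restrict_univ (μ := μ), ← hcover, aemeasurable_iUnion_iff]
    intro w
    refine ((hA w).mono_measure Measure.restrict_le_self).congr ?_
    refine ae_restrict_of_forall_mem ((hg'.approx n).measurableSet_preimage _) fun z hz => ?_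
    rw [mem_preimage, mem_singleton_iff] at hz
    beta_reduce
    rw [hz]
  · filter_upwards [hc] with z hz
    exact (hz.tendsto _).comp (hg'.tendsto_approx z)

theorem isOpen_spaceTimeCylinder {E : Set (EuclideanSpace ℝ (Fin N))} (hE : IsOpen E) (T : ℝ) :
    IsOpen (spaceTimeCylinder E T) := hE.prod isOpen_Ioo

/-- A weak supersolution is, on small cylinders, a coercive supersolution. -/
theorem exists_isCoerciveSupersolution {E : Set (EuclideanSpace ℝ (Fin N))} (hE : IsOpen E)
    {T p q C₀ C₁ : ℝ} (hp : 1 < p) (hq : 0 < q)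
    {A : SpaceTime N → ℝ → EuclideanSpace ℝ (Fin N) → EuclideanSpace ℝ (Fin N)}
    (hA : IsAdmissibleField E T p C₀ C₁ A) {u : SpaceTime N → ℝ}
    (hu : IsWeakSupersolution E T p q A u) (hbdd : LocEssBddBelow u (spaceTimeCylinder E T))
    {x₀ : EuclideanSpace ℝ (Fin N)} {R t₁ t₂ : ℝ} (ht : t₁ < t₂)
    (hR : Metric.closedBall x₀ R ⊆ E) (hI : Icc t₁ t₂ ⊆ Ioo 0 T) :
    ∃ (v : SpaceTime N → ℝ) (D : SpaceTime N → EuclideanSpace ℝ (Fin N) →L[ℝ] ℝ)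
      (a : SpaceTime N → EuclideanSpace ℝ (Fin N)) (m : ℝ),
      IsCoerciveSupersolution (Metric.ball x₀ R ×ˢ Ioo t₁ t₂) p (ENNReal.ofReal (p / (p - 1)))
        (signedPow q) v D a C₀ C₁ m ∧
      ∀ᵐ z ∂volume.restrict (Metric.ball x₀ R ×ˢ Ioo t₁ t₂), u z = v z := by
  obtain ⟨huq, hup, Du, hgrad, hDu, hsuper⟩ := hu
  set Q : Set (SpaceTime N) := Metric.closedBall x₀ R ×ˢ Icc t₁ t₂ with hQ
  set O : Set (SpaceTime N) := Metric.ball x₀ R ×ˢ Ioo t₁ t₂ with hO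
  have hQc : IsCompact Q := (isCompact_closedBall _ _).prod isCompact_Icc
  have hQE : Q ⊆ spaceTimeCylinder E T := Set.prod_mono hR hI
  have hOQ : O ⊆ Q := Set.prod_mono Metric.ball_subset_closedBall Ioo_subset_Icc_self
  have hOE : O ⊆ spaceTimeCylinder E T := hOQ.trans hQE
  have hOo : IsOpen O := Metric.isOpen_ball.prod isOpen_Ioo
  have hμ : volume.restrict O ≤ volume.restrict Q := Measure.restrict_mono_set _ hOQ
  have hμE : volume.restrict O ≤ volume.restrict (spaceTimeCylinder E T) :=
    Measure.restrict_mono_set _ hOE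
  have huQ := (hup Q hQc hQE).1
  obtain ⟨m, hm⟩ := hbdd Q hQc hQE
  set v := huQ.mk u with hv
  have hvm : Measurable v := huQ.stronglyMeasurable_mk.measurable
  have huv : ∀ᵐ z ∂volume.restrict O, u z = v z := ae_mono hμ huQ.ae_eq_mk
  have hDuO : MemLp Du (ENNReal.ofReal p) (volume.restrict O) :=
    (hDu Q hQc hQE).mono_measure hμ
  set a : SpaceTime N → EuclideanSpace ℝ (Fin N) := fun z => A z (u z) (Du z) with ha
  have ham : AEStronglyMeasurable a (volume.restrict O) := by
    have h1 : ∀ w : ℝ × EuclideanSpace ℝ (Fin N),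
        AEMeasurable (fun z => A z w.1 w.2) (volume.restrict O) :=
      fun w => (hA.measurable w.1 w.2).mono_measure hμE
    have h2 := ae_mono hμE hA.continuous
    exact (aemeasurable_comp_of_caratheodory (A := fun z (w : ℝ × EuclideanSpace ℝ (Fin N)) =>
      A z w.1 w.2) h1 h2 ((huQ.mono_measure hμ).aemeasurable.prodMk
        hDuO.1.aemeasurable)).aestronglyMeasurable
  have hgrowth : ∀ᵐ z ∂volume.restrict O, ‖a z‖ ≤ C₁ * ‖Du z‖ ^ (p - 1) := by
    filter_upwards [ae_mono hμE hA.growth] with z hz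
    exact hz _ _
  refine ⟨v, fun z => innerSL ℝ (Du z), a, m, ⟨⟨hOo, ?_, ?_, ?_, ?_, ?_, ?_, ?_⟩, hvm,
    continuous_signedPow hq, monotone_signedPow hq, ?_, ?_, ?_⟩, huv⟩
  · exact ((measure_mono hOQ).trans_lt hQc.measure_lt_top).ne
  · exact hvm.aestronglyMeasurable
  · exact hDuO.of_le ((innerSL ℝ).continuous.comp_aestronglyMeasurable hDuO.1)
      (Eventually.of_forall fun z => (innerSL_apply_norm ℝ (Du z)).le)
  · have h1 := hDuO.norm_rpow_div (ENNReal.ofReal (p - 1))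
    rw [ENNReal.toReal_ofReal (by linarith), ← ENNReal.ofReal_div_of_pos (by linarith)] at h1
    refine h1.of_le_mul (c := C₁) ham ?_
    filter_upwards [hgrowth] with z hz
    rwa [Real.norm_of_nonneg (by positivity)]
  · have h1 := ((huq Q hQc hQE).mono_measure hμ).integrable_norm_rpow (by simpa using hq)
      ENNReal.ofReal_ne_top
    rw [ENNReal.toReal_ofReal hq.le] at h1
    refine h1.mono' ((continuous_signedPow hq).measurable.comp hvm).aestronglyMeasurable ?_
    filter_upwards [huv] with z hz
    rw [Real.norm_eq_abs, abs_signedPow hq, ← hz, Real.norm_eq_abs]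
  · obtain ⟨w, hw, hwu, hwD⟩ := exists_smooth_approx hp.le (isOpen_spaceTimeCylinder hE T) hQc hQE
      hup hDu hgrad
    refine ⟨w, fun n => (hw n).of_le (by exact_mod_cast le_top), ?_, ?_⟩
    · filter_upwards [ae_mono hμ hwu, huv] with z h1 h2
      rwa [← h2]
    · exact tendsto_of_tendsto_of_tendsto_of_le_of_le tendsto_const_nhds hwD
        (fun n => bot_le) (fun n => eLpNorm_mono_measure _ hμ)
  · intro ζ hζ hζs hζO hζ0
    have h1 := hsuper (Metric.closedBall x₀ R) (isCompact_closedBall _ _) hR t₁ t₂ ht hI ζ hζ hζs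
      (hζO.trans (Set.prod_mono Metric.ball_subset_closedBall Subset.rfl)) hζ0
    have h0 : ∀ z, z ∉ O → -(|u z| ^ (q - 1) * u z) * fderiv ℝ ζ z (0, 1) +
        fderiv ℝ ζ z (A z (u z) (Du z), 0) = 0 := by
      intro z hz
      rw [fderiv_of_notMem_tsupport ℝ fun h => hz (hζO h)]
      simp
    have hOK : O ⊆ Metric.closedBall x₀ R ×ˢ Ioo t₁ t₂ :=
      Set.prod_mono Metric.ball_subset_closedBall Subset.rfl
    rw [setIntegral_eq_integral_of_forall_compl_eq_zero fun z hz => h0 z fun h => hz (hOK h),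
      ← setIntegral_eq_integral_of_forall_compl_eq_zero h0] at h1
    refine h1.trans_eq (integral_congr_ae ?_)
    filter_upwards [huv] with z hz
    rw [← hz]
    rfl
  · filter_upwards [ae_mono hμE hA.coercive] with z hz
    rw [innerSL_apply_norm, innerSL_apply_apply, real_inner_comm]
    exact hz _ _
  · filter_upwards [hgrowth] with z hz
    rwa [innerSL_apply_norm]
  · filter_upwards [ae_mono hμ hm, huv] with z h1 h2
    rwa [← h2]

theorem ball_subset_cube (x : EuclideanSpace ℝ (Fin N)) (ρ : ℝ) : Metric.ball x ρ ⊆ cube x ρ := by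
  intro y hy i
  rw [mem_ball_iff_norm] at hy
  exact (PiLp.norm_apply_le (y - x) i).trans_lt hy

/-- A lower bound in the past cylinders yields a slightly smaller one near the vertex. -/
theorem exists_nhds_lower_bound (hN : 1 ≤ N) {E : Set (EuclideanSpace ℝ (Fin N))} (hE : IsOpen E)
    {T p q C₀ C₁ : ℝ} (hp : 1 < p) (hq : 0 < q) (hC₀ : 0 < C₀) (hC₁ : 0 < C₁)
    {A : SpaceTime N → ℝ → EuclideanSpace ℝ (Fin N) → EuclideanSpace ℝ (Fin N)}
    (hA : IsAdmissibleField E T p C₀ C₁ A) {u : SpaceTime N → ℝ}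
    (hu : IsWeakSupersolution E T p q A u) (hbdd : LocEssBddBelow u (spaceTimeCylinder E T))
    {z : SpaceTime N} (hz : z ∈ spaceTimeCylinder E T) {c κ : ℝ} (hc : c < κ) :
    ∃ θ : ℝ, 0 < θ ∧ ∃ ρ₀ : ℝ, 0 < ρ₀ ∧ ∀ ρ, 0 < ρ → ρ < ρ₀ →
      (∀ᵐ w ∂volume.restrict (pastCyl p θ z ρ), κ ≤ u w) →
      ∃ V ∈ 𝓝 z, ∀ᵐ w ∂volume.restrict V, c ≤ u w := by
  have hp0 : 0 < p := by linarith
  obtain ⟨hz1, hz2⟩ := hz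
  obtain ⟨R, hR0, hR⟩ := Metric.nhds_basis_closedBall.mem_iff.1 (hE.mem_nhds hz1)
  obtain ⟨τ, hτ0, hτ⟩ := Metric.nhds_basis_closedBall.mem_iff.1 (isOpen_Ioo.mem_nhds hz2)
  rw [Real.closedBall_eq_Icc] at hτ
  obtain ⟨v, D, a, m, hv, huv⟩ := exists_isCoerciveSupersolution hE hp hq hA hu hbdd
    (by linarith : z.2 - τ < z.2 + τ) hR hτ
  have hconj : Real.HolderConjugate p (p / (p - 1)) := Real.HolderConjugate.conjExponent hp
  have := hconj.ennrealOfReal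
  have hr : 1 ≤ ENNReal.ofReal (p / (p - 1)) := by
    rw [ENNReal.one_le_ofReal]
    exact hconj.symm.lt.le
  set ε := min (κ - c) 1 with hε
  have hε0 : 0 < ε := lt_min (by linarith) one_pos
  set M := |κ| + 1 with hM
  have hM0 : 0 < M := by positivity
  have hβ : ∀ b c, -M ≤ b → b < c → c ≤ M →
      min 1 q / M / 2 ^ (q + 1) * (c - b) ^ (q + 1) ≤ signedPow q c - signedPow q b := by
    intro b c h1 h2 h3
    refine le_trans (le_of_eq ?_) (signedPow_sub_ge hq h2 h1 h3)
    rw [Real.div_rpow (by linarith) (by norm_num)]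
    ring
  have hγ : 0 < min 1 q / M / 2 ^ (q + 1) := by
    have : 0 < min 1 q := lt_min one_pos hq
    positivity
  obtain ⟨θ', hθ', hmain⟩ := exists_lower_bound (κ := κ) (ε := ε) hN hp hr hv hC₀ hC₁.le hγ hβ hε0
    (min_le_right _ _) ((le_abs_self κ).trans (by linarith))
    (by linarith [neg_abs_le κ, min_le_right (κ - c) 1])
  set θ := θ' / 2 with hθ
  have hθ0 : 0 < θ := by positivity
  refine ⟨θ, hθ0, min R ((τ / (3 * θ)) ^ (1 / p)), by positivity, fun ρ hρ hρ₀ hpast => ?_⟩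
  have hρR : ρ < R := hρ₀.trans_le (min_le_left _ _)
  have hρτ : 3 * (θ * ρ ^ p) < τ := by
    have h1 : ρ ^ p < ((τ / (3 * θ)) ^ (1 / p)) ^ p :=
      Real.rpow_lt_rpow hρ.le (hρ₀.trans_le (min_le_right _ _)) hp0
    rw [← Real.rpow_mul (by positivity), one_div_mul_cancel hp0.ne', Real.rpow_one,
      lt_div_iff₀ (by positivity)] at h1
    linarith
  set h := θ * ρ ^ p with hh
  have hh0 : 0 < h := by positivity
  have hθ'h : θ' * ρ ^ p = 2 * h := by rw [hh, hθ]; ring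
  have hsub : pastCyl p θ z ρ = cube z.1 ρ ×ˢ Ioo (z.2 - 2 * h) (z.2 - h) := by
    rw [pastCyl, hh, mul_assoc]
  have hres := hmain z.1 ρ (z.2 - 2 * h) (z.2 - h) hρ (by linarith)
    (Set.prod_mono (Metric.ball_subset_ball hρR.le)
      (Ioo_subset_Ioo (by linarith) (by rw [hθ'h]; linarith)))
    (by
      rw [hsub, ae_restrict_iff' ((isOpen_cube_and_mem _ hρ).1.measurableSet.prod
        measurableSet_Ioo)] at hpast
      filter_upwards [ae_restrict_of_ae hpast, huv] with w h1 h2 hmem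
      rw [← h2]
      exact h1 ⟨ball_subset_cube _ _ hmem.1, hmem.2⟩)
  rw [hθ'h] at hres
  refine ⟨Metric.ball z.1 (ρ / 2) ×ˢ Ioo (z.2 - h) (z.2 + h), ?_, ?_⟩
  · exact (Metric.isOpen_ball.prod isOpen_Ioo).mem_nhds
      ⟨Metric.mem_ball_self (by positivity), by constructor <;> linarith⟩
  · have h1 : Metric.ball z.1 (ρ / 2) ×ˢ Ioo (z.2 - h) (z.2 + h) ⊆
        Metric.ball z.1 (ρ / 2) ×ˢ Ico (z.2 - h) (z.2 - h + 2 * h) :=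
      Set.prod_mono Subset.rfl fun t ht => ⟨ht.1.le, by linarith [ht.2]⟩
    have h2 : Metric.ball z.1 (ρ / 2) ×ˢ Ioo (z.2 - h) (z.2 + h) ⊆
        Metric.ball z.1 R ×ˢ Ioo (z.2 - τ) (z.2 + τ) :=
      Set.prod_mono (Metric.ball_subset_ball (by linarith)) (Ioo_subset_Ioo (by linarith)
        (by linarith))
    filter_upwards [ae_restrict_of_ae_restrict_of_subset h1 hres,
      ae_restrict_of_ae_restrict_of_subset h2 huv] with w h3 h4
    rw [h4]
    linarith [min_le_left (κ - c) 1]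

end DoublyNonlinear

end

noncomputable section

namespace DoublyNonlinear

variable {N : ℕ}

theorem le_essInfOn {u : SpaceTime N → ℝ} {S : Set (SpaceTime N)} {b : EReal}
    (h : ∀ᵐ w ∂volume.restrict S, b ≤ u w) : b ≤ essInfOn u S :=
  le_liminf_of_le (by isBoundedDefault) h

theorem ae_lt_of_lt_essInfOn {u : SpaceTime N → ℝ} {S : Set (SpaceTime N)} {b : EReal}
    (h : b < essInfOn u S) : ∀ᵐ w ∂volume.restrict S, b < u w :=
  eventually_lt_of_lt_liminf h

theorem essInfOn_anti (u : SpaceTime N → ℝ) {S S' : Set (SpaceTime N)} (h : S ⊆ S') :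
    essInfOn u S' ≤ essInfOn u S :=
  liminf_le_liminf_of_le (ae_mono (Measure.restrict_mono_set _ h)) (by isBoundedDefault)
    (by isBoundedDefault)

theorem le_lscReg {u : SpaceTime N → ℝ} {z : SpaceTime N} {V : Set (SpaceTime N)} (hV : V ∈ 𝓝 z)
    {b : EReal} (h : ∀ᵐ w ∂volume.restrict V, b ≤ u w) : b ≤ lscReg u z := by
  obtain ⟨V', hV', hVo, hzV⟩ := mem_nhds_iff.1 hV
  have h1 := (ae_restrict_iff' hVo.measurableSet).1 (ae_restrict_of_ae_restrict_of_subset hV' h)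
  refine le_liminf_of_le (by isBoundedDefault) ?_
  exact eventually_inf.2 ⟨V', hVo.mem_nhds hzV, _, h1, fun w hw => hw.2 hw.1⟩

theorem cube_mono (x : EuclideanSpace ℝ (Fin N)) {ρ ρ' : ℝ} (h : ρ ≤ ρ') : cube x ρ ⊆ cube x ρ' :=
  fun _ hy i => (hy i).trans_le h

/-- The past cylinder is contained in a backward cylinder of a comparable radius. -/
theorem exists_pastCyl_subset {p θ : ℝ} (hp : 0 < p) (hθ : 0 < θ) (z : SpaceTime N) :
    ∃ l : ℝ, 0 < l ∧ ∀ ρ, 0 < ρ → pastCyl p θ z ρ ⊆ backwardCyl p z (l * ρ) := by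
  refine ⟨max 1 ((2 * θ) ^ (1 / p)), by positivity, fun ρ hρ => Set.prod_mono ?_ ?_⟩
  · exact cube_mono _ (le_mul_of_one_le_left hρ.le (le_max_left _ _))
  · have h1 : 2 * θ ≤ max 1 ((2 * θ) ^ (1 / p)) ^ p := by
      calc 2 * θ = ((2 * θ) ^ (1 / p)) ^ p := by
            rw [← Real.rpow_mul (by positivity), one_div_mul_cancel hp.ne', Real.rpow_one]
        _ ≤ _ := Real.rpow_le_rpow (by positivity) (le_max_right _ _) hp.le
    have h2 : 0 < ρ ^ p := by positivity
    refine Ioo_subset_Ioo ?_ ?_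
    · rw [Real.mul_rpow (by positivity) hρ.le]
      have := mul_le_mul_of_nonneg_right h1 h2.le
      linarith
    · have : 0 < θ * ρ ^ p := by positivity
      linarith

theorem backwardCyl_subset_centeredCyl {p ρ : ℝ} (hρ : 0 < ρ) (z : SpaceTime N) :
    backwardCyl p z ρ ⊆ centeredCyl p z ρ := by
  have h1 : 0 < ρ ^ p := by positivity
  exact Set.prod_mono Subset.rfl (Ioo_subset_Ioo_right (by linarith))

theorem tendsto_mul_nhdsGT_zero {l : ℝ} (hl : 0 < l) :
    Tendsto (fun ρ : ℝ => l * ρ) (𝓝[>] 0) (𝓝[>] 0) := by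
  refine tendsto_nhdsWithin_iff.2 ⟨?_, ?_⟩
  · have : Tendsto (fun ρ : ℝ => l * ρ) (𝓝 0) (𝓝 (l * 0)) :=
      (continuous_const.mul continuous_id).tendsto 0
    rw [mul_zero] at this
    exact this.mono_left nhdsWithin_le_nhds
  · filter_upwards [self_mem_nhdsWithin] with ρ hρ
    exact mul_pos hl hρ

theorem eventually_centeredCyl_subset {p : ℝ} (hp : 0 < p) {z : SpaceTime N} {s : Set (SpaceTime N)}
    (hs : s ∈ 𝓝 z) : ∀ᶠ ρ : ℝ in 𝓝[>] 0, centeredCyl p z ρ ⊆ s := by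
  obtain ⟨ε, hε, hball⟩ := Metric.mem_nhds_iff.1 hs
  have c1 : Tendsto (fun ρ : ℝ => (Real.sqrt N + 1) * ρ) (𝓝[>] 0) (𝓝 0) :=
    (tendsto_mul_nhdsGT_zero (by positivity)).mono_right nhdsWithin_le_nhds
  have c2 : Tendsto (fun ρ : ℝ => ρ ^ p) (𝓝[>] 0) (𝓝 0) := by
    have : Tendsto (fun ρ : ℝ => ρ ^ p) (𝓝 0) (𝓝 ((0 : ℝ) ^ p)) :=
      (Real.continuous_rpow_const hp.le).tendsto 0
    rw [Real.zero_rpow hp.ne'] at this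
    exact this.mono_left nhdsWithin_le_nhds
  filter_upwards [c1.eventually (gt_mem_nhds hε), c2.eventually (gt_mem_nhds hε),
    self_mem_nhdsWithin] with ρ h1 h2 (h3 : 0 < ρ) w hw
  refine hball ?_
  rw [Metric.mem_ball, Prod.dist_eq, max_lt_iff]
  refine ⟨?_, ?_⟩
  · refine lt_of_le_of_lt ?_ h1
    calc dist w.1 z.1 = √(∑ i, dist (w.1 i) (z.1 i) ^ 2) := EuclideanSpace.dist_eq _ _
      _ ≤ √(∑ _i : Fin N, ρ ^ 2) := by
          refine Real.sqrt_le_sqrt (Finset.sum_le_sum fun i _ => ?_)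
          rw [Real.dist_eq]
          exact pow_le_pow_left₀ (abs_nonneg _) (hw.1 i).le 2
      _ = Real.sqrt N * ρ := by simp [Real.sqrt_sq h3.le]
      _ ≤ (Real.sqrt N + 1) * ρ := by nlinarith
  · rw [Real.dist_eq, abs_lt]
    constructor <;> linarith [hw.2.1, hw.2.2]

theorem le_liminf_essInfOn {p l : ℝ} (hp : 0 < p) (hl : 0 < l) (u : SpaceTime N → ℝ)
    (z : SpaceTime N) {S : ℝ → Set (SpaceTime N)}
    (hS : ∀ ρ, 0 < ρ → S ρ ⊆ backwardCyl p z (l * ρ)) :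
    lscReg u z ≤ liminf (fun ρ => essInfOn u (S ρ)) (𝓝[>] 0) := by
  rw [← ((tendsto_essInfOn_centeredCyl hp u z).comp (tendsto_mul_nhdsGT_zero hl)).liminf_eq]
  refine liminf_le_liminf ?_
  filter_upwards [self_mem_nhdsWithin] with ρ (hρ : 0 < ρ)
  exact essInfOn_anti u ((hS ρ hρ).trans (backwardCyl_subset_centeredCyl (by positivity) z))

/-- The four representations follow when lower bounds in the past cylinders propagate to the
vertex. -/
theorem lscReg_eq_of_propagation {p : ℝ} (hp : 0 < p) {u : SpaceTime N → ℝ} {z : SpaceTime N}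
    (hprop : ∀ c κ : ℝ, c < κ → ∃ θ : ℝ, 0 < θ ∧ ∃ ρ₀ : ℝ, 0 < ρ₀ ∧ ∀ ρ, 0 < ρ → ρ < ρ₀ →
      (∀ᵐ w ∂volume.restrict (pastCyl p θ z ρ), κ ≤ u w) →
      ∃ V ∈ 𝓝 z, ∀ᵐ w ∂volume.restrict V, c ≤ u w) :
    lscReg u z = ⨅ (θ : ℝ) (_ : 0 < θ),
      liminf (fun ρ : ℝ => essInfOn u (pastCyl p θ z ρ)) (𝓝[>] 0) ∧
    lscReg u z = ⨅ (θ : ℝ) (_ : 0 < θ),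
      limsup (fun ρ : ℝ => essInfOn u (pastCyl p θ z ρ)) (𝓝[>] 0) ∧
    Tendsto (fun ρ : ℝ => essInfOn u (backwardCyl p z ρ)) (𝓝[>] 0) (𝓝 (lscReg u z)) ∧
    lscReg u z = essLiminf u (𝓝[{w : SpaceTime N | w.2 < z.2}] z) := by
  have hfreq : ∀ b : EReal,
      (∀ θ > 0, ∃ᶠ ρ : ℝ in 𝓝[>] 0, b < essInfOn u (pastCyl p θ z ρ)) → b ≤ lscReg u z := by
    intro b hb
    by_contra! hlt
    obtain ⟨c, hc1, hc2⟩ := EReal.lt_iff_exists_real_btwn.1 hlt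
    obtain ⟨κ, hκ1, hκ2⟩ := EReal.lt_iff_exists_real_btwn.1 hc2
    obtain ⟨θ, hθ, ρ₀, hρ₀, h⟩ := hprop c κ (by exact_mod_cast hκ1)
    have h1 : ∀ᶠ ρ : ℝ in 𝓝[>] 0, ρ ∈ Ioo 0 ρ₀ := Ioo_mem_nhdsGT hρ₀
    obtain ⟨ρ, h2, h3⟩ := ((hb θ hθ).and_eventually h1).exists
    obtain ⟨V, hV, h4⟩ := h ρ h3.1 h3.2 (by
      filter_upwards [ae_lt_of_lt_essInfOn (hκ2.trans h2)] with w hw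
      exact_mod_cast hw.le)
    refine absurd (le_lscReg (b := (c : EReal)) hV ?_) (not_le.2 hc1)
    filter_upwards [h4] with w hw
    exact_mod_cast hw
  have hlow : lscReg u z ≤ ⨅ (θ : ℝ) (_ : 0 < θ),
      liminf (fun ρ : ℝ => essInfOn u (pastCyl p θ z ρ)) (𝓝[>] 0) := by
    refine le_iInf₂ fun θ hθ => ?_
    obtain ⟨l, hl, hsub⟩ := exists_pastCyl_subset hp hθ z
    exact le_liminf_essInfOn hp hl u z hsub
  have hmid : (⨅ (θ : ℝ) (_ : 0 < θ),
      liminf (fun ρ : ℝ => essInfOn u (pastCyl p θ z ρ)) (𝓝[>] 0)) ≤ ⨅ (θ : ℝ) (_ : 0 < θ),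
      limsup (fun ρ : ℝ => essInfOn u (pastCyl p θ z ρ)) (𝓝[>] 0) :=
    iInf₂_mono fun θ _ => liminf_le_limsup
  have hup : (⨅ (θ : ℝ) (_ : 0 < θ),
      limsup (fun ρ : ℝ => essInfOn u (pastCyl p θ z ρ)) (𝓝[>] 0)) ≤ lscReg u z := by
    refine le_of_forall_lt fun b hb => ?_
    obtain ⟨b', hb', hb''⟩ := exists_between hb
    refine hb'.trans_le (hfreq b' fun θ hθ => ?_)
    exact frequently_lt_of_lt_limsup (by isBoundedDefault)
      (hb''.trans_le (iInf₂_le θ hθ))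
  have hback : Tendsto (fun ρ : ℝ => essInfOn u (backwardCyl p z ρ)) (𝓝[>] 0)
      (𝓝 (lscReg u z)) := by
    refine tendsto_of_le_liminf_of_limsup_le ?_ ?_
    · exact le_liminf_essInfOn hp one_pos u z fun ρ _ => by rw [one_mul]
    · refine le_of_forall_lt fun b hb => ?_
      obtain ⟨b', hb', hb''⟩ := exists_between hb
      refine hb'.trans_le (hfreq b' fun θ hθ => ?_)
      obtain ⟨l, hl, hsub⟩ := exists_pastCyl_subset hp hθ z
      refine (tendsto_mul_nhdsGT_zero (inv_pos.2 hl)).frequently ?_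
      have h1 := frequently_lt_of_lt_limsup (by isBoundedDefault) hb''
      refine (h1.and_eventually self_mem_nhdsWithin).mono fun ρ hρ => ?_
      have hρ0 : 0 < ρ := hρ.2
      refine hρ.1.trans_le (essInfOn_anti u ?_)
      have h2 := hsub (l⁻¹ * ρ) (by positivity)
      rwa [mul_inv_cancel_left₀ hl.ne'] at h2
  refine ⟨le_antisymm hlow (hmid.trans hup), le_antisymm (hlow.trans hmid) hup, hback,
    le_antisymm ?_ ?_⟩
  · exact liminf_le_liminf_of_le (inf_le_inf_right _ nhdsWithin_le_nhds) (by isBoundedDefault)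
      (by isBoundedDefault)
  · refine le_of_forall_lt fun b hb => ?_
    obtain ⟨b', hb', hb''⟩ := exists_between hb
    refine hb'.trans_le (ge_of_tendsto hback ?_)
    have h1 : ∀ᶠ w in 𝓝[{w : SpaceTime N | w.2 < z.2}] z ⊓ ae volume, b' < (u w : EReal) :=
      eventually_lt_of_lt_liminf hb''
    obtain ⟨s, hs, t, ht, hst⟩ := eventually_inf.1 h1
    obtain ⟨s', hs', hss⟩ := mem_nhdsWithin_iff_exists_mem_nhds_inter.1 hs
    filter_upwards [eventually_centeredCyl_subset hp hs', self_mem_nhdsWithin] with ρ h2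
      (hρ : 0 < ρ)
    have hm : MeasurableSet (backwardCyl p z ρ) :=
      (isOpen_cube_and_mem z.1 hρ).1.measurableSet.prod measurableSet_Ioo
    refine le_essInfOn ?_
    rw [ae_restrict_iff' hm]
    filter_upwards [ht] with w hw hwb
    exact (hst w ⟨hss ⟨h2 (backwardCyl_subset_centeredCyl hρ z hwb), hwb.2.2⟩, hw⟩).le

end DoublyNonlinear

end

theorem mainTheorem3 {N : ℕ} (hN : 1 ≤ N) (E : Set (EuclideanSpace ℝ (Fin N))) (hE : IsOpen E)
    (T p q C₀ C₁ : ℝ) (hT : 0 < T) (hp : 1 < p) (hq : 0 < q) (hC₀ : 0 < C₀) (hC₁ : 0 < C₁)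
    (A : DoublyNonlinear.SpaceTime N → ℝ → EuclideanSpace ℝ (Fin N) → EuclideanSpace ℝ (Fin N))
    (hA : DoublyNonlinear.IsAdmissibleField E T p C₀ C₁ A)
    (u : DoublyNonlinear.SpaceTime N → ℝ)
    (hu : DoublyNonlinear.IsWeakSupersolution E T p q A u)
    (hbdd : DoublyNonlinear.LocEssBddBelow u (DoublyNonlinear.spaceTimeCylinder E T))
    (z : DoublyNonlinear.SpaceTime N) (hz : z ∈ DoublyNonlinear.spaceTimeCylinder E T) :
    DoublyNonlinear.lscReg u z =
        ⨅ (θ : ℝ) (_ : 0 < θ),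
          liminf (fun ρ : ℝ => DoublyNonlinear.essInfOn u (DoublyNonlinear.pastCyl p θ z ρ))
            (𝓝[>] 0) ∧
    DoublyNonlinear.lscReg u z =
        ⨅ (θ : ℝ) (_ : 0 < θ),
          limsup (fun ρ : ℝ => DoublyNonlinear.essInfOn u (DoublyNonlinear.pastCyl p θ z ρ))
            (𝓝[>] 0) ∧
    Tendsto (fun ρ : ℝ => DoublyNonlinear.essInfOn u (DoublyNonlinear.backwardCyl p z ρ))
      (𝓝[>] 0) (𝓝 (DoublyNonlinear.lscReg u z)) ∧
    DoublyNonlinear.lscReg u z =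
      DoublyNonlinear.essLiminf u (𝓝[{w : DoublyNonlinear.SpaceTime N | w.2 < z.2}] z) := by
  exact DoublyNonlinear.lscReg_eq_of_propagation (by linarith) fun _ _ hc =>
    DoublyNonlinear.exists_nhds_lower_bound hN hE hp hq hC₀ hC₁ hA hu hbdd hz hc
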